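/- **Calculus.** Types are $A,B ::= \mathtt{bit}\mid\mathtt{qbit}\mid 1\mid A\multimap B\mid A\otimes B$; the operations, with their sequences of input and output base types, are $\mathtt{zero},\mathtt{one}:()\to(\mathtt{bit})$, $\mathtt{discard}:(\mathtt{bit})\to()$, $\mathtt{new}:(\mathtt{bit})\to(\mathtt{qbit})$, $\mathtt{meas}:(\mathtt{qbit})\to(\mathtt{bit})$, $H,S,T:(\mathtt{qbit})\to(\mathtt{qbit})$, $\mathtt{CNOT}:(\mathtt{qbit},\mathtt{qbit})\to(\mathtt{qbit},\mathtt{qbit})$. The terms of $\lambda^Q$ are $x$, $\lambda x.M$, $MN$, $*$, $\mathtt{let}\,*=M\,\mathtt{in}\,N$, $\langle M,N\rangle$, $\mathtt{let}\,\langle x,y\rangle=M\,\mathtt{in}\,N$, $\mathtt{if}\,M\,\mathtt{then}\,N\,\mathtt{else}\,P$, and operations $c$. They are typed by the usual linear rules for judgements $\Delta\vdash M:A$: variables and constants are axioms, premises have disjoint contexts, except that the two branches of a conditional, whose guard has type $\mathtt{bit}$, share their context $\Gamma$ and type; $c:\mathbb B_1\otimes\dots\otimes\mathbb B_n\multimap\mathbb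 B'_1\otimes\dots\otimes\mathbb B'_m$, where an empty tensor is $1$. **Positions.** Let $\pi$ be a typing derivation. A position is an occurrence of an atom ($\mathtt{bit}$, $\mathtt{qbit}$ or $1$) in a judgement of $\pi$. It is positive or negative; polarity is reversed on the left of $\multimap$ and on the left of $\vdash$. Positions are linked as usual: in $x:A\vdash x:A$ the two copies of an atom; in each rule an atom of the conclusion and the atom of the premise it comes from; in an application the argument type in the two premises; in $\mathtt{let}\,\langle x,y\rangle=M\,\mathtt{in}\,N$ the components of the type of $M$ and the hypotheses $x,y$ of $N$. (For a conditional only the hypotheses of the guard are linked by structural rules; the other hypotheses and the conclusion are linked to the branches by the rules for conditionals below.) Tokens go upwards at negative positions and downwards at positive ones. **Circuits.** Circuits, with wires labelled by positions, are gates $c^{\bar l}_{\bar r}$, identities, renamings of wires, compositions $C;D$ and conditionals $\mathtt{ite}\,l\,C\,D$, with typing judgements $\Gamma\rhd C\rhd\Delta$ between environments (sets of distinct labels with base types): a gate replaces $\bar l$ by $\bar r$ and leaves the other wires alone, an identity or renaming keeps the wires up to an injective change of labels, and $\Gamma,l:\mathtt{bit}\rhd\mathtt{ite}\,l\,C\,D\rhd\Delta$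 if $\Gamma\rhd C\rhd\Delta$ and $\Gamma\rhd D\rhd\Delta$. An extended circuit $E$ is a circuit $C$ or a node $C\mapsto^{l}(E_0,E_1)$. Its addresses are the sets $\mathcal G$ of pairs $(l,b)$ describing the paths from the root to the leaves, and $\tau(E)$ is the circuit obtained by reading $C\mapsto^l(E_0,E_1)$ as $C;\mathtt{ite}\,l\,\tau(E_0)\,\tau(E_1)$. $\Gamma\rhd E\rhd\mathcal I$ means that $E$ is typed with input $\Gamma$ and with output $\mathcal I(\mathcal G)$ at each address $\mathcal G$. **Configurations.** Let $\pi'$ be a sub-derivation of $\pi$ (possibly $\pi$ itself). A token is a position with an address and a flag, on or off. A configuration is a set of tokens together with an extended circuit. The tokens of address $\mathcal G$ form the slice $\mathcal G$; its environment consists of its $\mathtt{bit}$ and $\mathtt{qbit}$ tokens with flag off. A node of $\pi'$ is open in the slice $\mathcal G$ if $(l,b)\in\mathcal G$ whenever the node lies in branch $b$ of a conditional of $\pi'$ with guard position $l$ ($b=0$ for the first branch, $b=1$ for the second one). The initial configuration $\mathrm{init}(\pi')$ has one token, with empty address and flag off, at each negative position of the conclusion of $\pi'$ and at each unit axiom $\vdash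 *:1$ in $\pi'$, and the identity circuit. A configuration is *final* for $\pi'$ if its tokens have addresses of $E$, if $N\rhd E\rhd\mathcal I$ where $N$ is the set of negative bits and qubits of the conclusion of $\pi'$ and $\mathcal I(\mathcal G)$ is the environment of the slice $\mathcal G$, and if for each address $\mathcal G$ of $E$: $\mathcal I(\mathcal G)$ is the set of positive bits and qubits of the conclusion of $\pi'$; and the positions of the tokens of the slice are exactly the positive positions of the conclusion, the conclusions $1$ of $M$ for the open nodes $\mathtt{let}\,*=M\,\mathtt{in}\,N$, the guards of the open conditionals, and the unit axioms that are not open. **Transitions** of $\mathrm{QCSIAM}^!$, for an address $\mathcal G$; tokens that move have flag off, and a circuit is "added" at the end of the leaf $\mathcal G$ of $E$: 1. structural: a token at a position of a node open in $\mathcal G$ moves along a link in the direction of its polarity, and its wire is renamed; 2. circuit: if there are tokens with flag off at all the negative positions of an axiom $c$, they are replaced by tokens with flag off at all its positive positions, and the gate $c$ is added; 3. guard (asynchronous): if there is a token with flag off at a guard $l$, the leaf $C$ at $\mathcal G$ is replaced by $C\mapsto^l(\mathrm{id},\mathrm{id})$, every token of the slice $\mathcal G$ is replaced by its two copies with addresses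 $\mathcal G\cup\{(l,0)\}$ and $\mathcal G\cup\{(l,1)\}$, and the flag at $l$ is turned on; 4. conditional (asynchronous): if the token at $l$ has its flag on and $(l,b)\in\mathcal G$, a token at a negative position that the conclusion of the conditional shares with its branches (in $\Gamma$ or in the type) moves to the corresponding position of branch $b$, a token at a positive position of the conclusion of branch $b$ moves to the corresponding position of the conclusion of the conditional, and wires are renamed; 5. synchronous: suppose that the token at $l$ has its flag off, that there are tokens with flag off at all negative positions that the conclusion of the conditional shares with its branches, and that on each branch $\pi_b$ ($b=0,1$) the machine can go from $\mathrm{init}(\pi_b)$ to a final configuration, with extended circuit $E_b$. Then these tokens are replaced by tokens with flag off at all positive positions that the conclusion shares with the branches, the flag at $l$ is turned on, and $\mathtt{ite}\,l\,\tau(E_0)\,\tau(E_1)$ is added (the wires at the conclusion of a branch being identified with those at the conclusion of the conditional). **Theorem.** Let $\pi$ be a typing derivation of $\Delta\vdash M:A$. Then $\mathrm{QCSIAM}^!$ terminates on $\mathrm{init}(\pi)$: there is no infinite sequence of transitions from $\mathrm{init}(\pi)$. Moreover it terminates in a final configuration: every configuration that is reachable from $\mathrm{init}(\pi)$ and from which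 no transition is possible is final for $\pi$. -/

import Mathlib

namespace QCSIAM

/-! ### Types, terms and typing derivations of the linear quantum lambda-calculus -/

/-- Base types: classical bits and quantum bits. -/
inductive BTy : Type
  | bit
  | qbit
  deriving DecidableEq

/-- Atomic types: a base type or the unit type `1`. -/
inductive Atom : Type
  | base (B : BTy)
  | one
  deriving DecidableEq

/-- Types: atoms, linear function types and tensor products. -/
inductive Ty : Type
  | atom (a : Atom)
  | lolli (A B : Ty)
  | tensor (A B : Ty)
  deriving DecidableEq

/-- The type of bits. -/
abbrev Ty.bit : Ty := .atom (.base .bit)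

/-- The unit type `1`. -/
abbrev Ty.one : Ty := .atom .one

/-- The predefined operations. -/
inductive Op : Type
  | zero
  | one
  | discard
  | new
  | meas
  | H
  | S
  | T
  | CNOT
  deriving DecidableEq

/-- The sequence of input types of an operation. -/
def Op.inTy : Op → List BTy
  | .zero => []
  | .one => []
  | .discard => [.bit]
  | .new => [.bit]
  | .meas => [.qbit]
  | .H => [.qbit]
  | .S => [.qbit]
  | .T => [.qbit]
  | .CNOT => [.qbit, .qbit]

/-- The sequence of output types of an operation. -/
def Op.outTy : Op → List BTy
  | .zero => [.bit]
  | .one => [.bit]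
  | .discard => []
  | .new => [.qbit]
  | .meas => [.bit]
  | .H => [.qbit]
  | .S => [.qbit]
  | .T => [.qbit]
  | .CNOT => [.qbit, .qbit]

/-- `B₁ ⊗ ⋯ ⊗ Bₚ`, which is `1` for `p = 0`. -/
def tensorList : List BTy → Ty
  | [] => .one
  | [B] => .atom (.base B)
  | B :: C :: Bs => .tensor (.atom (.base B)) (tensorList (C :: Bs))

/-- The type of an operation, seen as a constant of the calculus. -/
def Op.ty (c : Op) : Ty := .lolli (tensorList c.inTy) (tensorList c.outTy)

/-- Term variables. -/
abbrev Var : Type := ℕ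

/-- Terms. -/
inductive Tm : Type
  | var (x : Var)
  | lam (x : Var) (M : Tm)
  | app (M N : Tm)
  | star
  | letStar (M N : Tm)
  | pair (M N : Tm)
  | letPair (x y : Var) (M N : Tm)
  | ite (M N P : Tm)
  | op (c : Op)

/-- Typing contexts: finite sets of pairs of a variable and a type. -/
abbrev Ctx : Type := Finset (Var × Ty)

/-- The variables of a context. -/
def Ctx.dom (Δ : Ctx) : Finset Var := Finset.image Prod.fst Δ

/-- Typing derivations: `π : Der Δ M A` is a derivation of `Δ ⊢ M : A`. Contexts are put together
only when they share no variable. -/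
inductive Der : Ctx → Tm → Ty → Type
  | var {Ξ : Ctx} (x : Var) (A : Ty) (hΞ : Ξ = {(x, A)}) : Der Ξ (.var x) A
  | lam {Δ Ξ : Ctx} {M : Tm} {B : Ty} (x : Var) (A : Ty)
      (hΞ : Ξ = insert (x, A) Δ) (hx : x ∉ Ctx.dom Δ) (d : Der Ξ M B) :
      Der Δ (.lam x M) (.lolli A B)
  | app {Δ Γ Ξ : Ctx} {M N : Tm} {A B : Ty}
      (hΞ : Ξ = Δ ∪ Γ) (hd : Disjoint (Ctx.dom Δ) (Ctx.dom Γ))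
      (d₀ : Der Δ M (.lolli A B)) (d₁ : Der Γ N A) : Der Ξ (.app M N) B
  | star {Ξ : Ctx} (hΞ : Ξ = ∅) : Der Ξ .star .one
  | letStar {Δ Γ Ξ : Ctx} {M N : Tm} {A : Ty}
      (hΞ : Ξ = Δ ∪ Γ) (hd : Disjoint (Ctx.dom Δ) (Ctx.dom Γ))
      (d₀ : Der Δ M .one) (d₁ : Der Γ N A) : Der Ξ (.letStar M N) A
  | pair {Δ Γ Ξ : Ctx} {M N : Tm} {A B : Ty}
      (hΞ : Ξ = Δ ∪ Γ) (hd : Disjoint (Ctx.dom Δ) (Ctx.dom Γ))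
      (d₀ : Der Δ M A) (d₁ : Der Γ N B) : Der Ξ (.pair M N) (.tensor A B)
  | letPair {Δ Γ Γ' Ξ : Ctx} {M N : Tm} {C : Ty} (x y : Var) (A B : Ty)
      (hΞ : Ξ = Δ ∪ Γ) (hd : Disjoint (Ctx.dom Δ) (Ctx.dom Γ))
      (hΓ' : Γ' = insert (x, A) (insert (y, B) Γ))
      (hxy : x ≠ y) (hx : x ∉ Ctx.dom Γ) (hy : y ∉ Ctx.dom Γ)
      (d₀ : Der Δ M (.tensor A B)) (d₁ : Der Γ' N C) : Der Ξ (.letPair x y M N) C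
  | ite {Δ Γ Ξ : Ctx} {M N P : Tm} {A : Ty}
      (hΞ : Ξ = Δ ∪ Γ) (hd : Disjoint (Ctx.dom Δ) (Ctx.dom Γ))
      (d₀ : Der Δ M .bit) (d₁ : Der Γ N A) (d₂ : Der Γ P A) : Der Ξ (.ite M N P) A
  | op {Ξ : Ctx} (c : Op) (hΞ : Ξ = ∅) : Der Ξ (.op c) c.ty

/-- A node of a derivation: a judgement together with the sub-derivation proving it. -/
structure Node : Type where
  ctx : Ctx
  tm : Tm
  ty : Ty
  der : Der ctx tm ty

/-- The `i`-th premise of the last rule of a derivation (numbered from `0`). -/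
def Der.premise {Δ : Ctx} {M : Tm} {A : Ty} : Der Δ M A → ℕ → Option Node
  | .lam _ _ _ _ d, 0 => some ⟨_, _, _, d⟩
  | .app _ _ d _, 0 => some ⟨_, _, _, d⟩
  | .app _ _ _ d, 1 => some ⟨_, _, _, d⟩
  | .letStar _ _ d _, 0 => some ⟨_, _, _, d⟩
  | .letStar _ _ _ d, 1 => some ⟨_, _, _, d⟩
  | .pair _ _ d _, 0 => some ⟨_, _, _, d⟩
  | .pair _ _ _ d, 1 => some ⟨_, _, _, d⟩
  | .letPair _ _ _ _ _ _ _ _ _ _ d _, 0 => some ⟨_, _, _, d⟩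
  | .letPair _ _ _ _ _ _ _ _ _ _ _ d, 1 => some ⟨_, _, _, d⟩
  | .ite _ _ d _ _, 0 => some ⟨_, _, _, d⟩
  | .ite _ _ _ d _, 1 => some ⟨_, _, _, d⟩
  | .ite _ _ _ _ d, 2 => some ⟨_, _, _, d⟩
  | _, _ => none

/-- A path from the root of a derivation to one of its nodes. Sub-derivations are identified with
the paths leading to them, and `r <+: q` says that the node `q` lies in the sub-derivation `r`. -/
abbrev Path : Type := List ℕ

/-- The node of a derivation at a given path. -/
def Der.sub {Δ : Ctx} {M : Tm} {A : Ty} (π : Der Δ M A) : Path → Option Node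
  | [] => some ⟨Δ, M, A, π⟩
  | i :: p =>
    match π.premise i with
    | none => none
    | some N => N.der.sub p

/-! ### Positions -/

/-- Going to the left or to the right component of a type `A ⊸ B` or `A ⊗ B`. -/
inductive Dir : Type
  | L
  | R
  deriving DecidableEq

/-- The atom occurring at a place of a type, with its polarity (`true` for positive). -/
def Ty.atomAt : Ty → List Dir → Option (Atom × Bool)
  | .atom a, [] => some (a, true)
  | .lolli A _, .L :: s => (A.atomAt s).map fun u => (u.1, !u.2)
  | .lolli _ B, .R :: s => B.atomAt s
  | .tensor A _, .L :: s => A.atomAt s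
  | .tensor _ B, .R :: s => B.atomAt s
  | _, _ => none

/-- The formulas of a sequent `Δ ⊢ A`: the hypothesis of a variable, or the conclusion `A`. -/
inductive Slot : Type
  | hyp (x : Var)
  | concl
  deriving DecidableEq

/-- Places in the judgements of a derivation: a node, a formula in its judgement, and a place in
this formula. -/
structure Pos : Type where
  node : Path
  slot : Slot
  path : List Dir
  deriving DecidableEq

section Positions

variable {Δ₀ : Ctx} {M₀ : Tm} {A₀ : Ty} (π : Der Δ₀ M₀ A₀)

/-- `OccursAt π p a e`: the atom `a` occurs at the position `p` of `π`, with polarity `e` in the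
judgement of its node. Hypotheses stand on the left, so they count with reversed polarity. -/
def OccursAt (p : Pos) (a : Atom) (e : Bool) : Prop :=
  ∃ N : Node, π.sub p.node = some N ∧
    match p.slot with
    | .concl => N.ty.atomAt p.path = some (a, e)
    | .hyp x => ∃ A : Ty, (x, A) ∈ N.ctx ∧ A.atomAt p.path = some (a, !e)

/-- Positive positions, in which tokens travel downwards. -/
def IsPos (p : Pos) : Prop := ∃ a, OccursAt π p a true

/-- Negative positions, in which tokens travel upwards. -/
def IsNeg (p : Pos) : Prop := ∃ a, OccursAt π p a false

/-- The two occurrences of an atom in an identity axiom `x : A ⊢ x : A`. -/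
inductive AxLink : Pos → Pos → Prop
  | var {q : Path} {Ξ : Ctx} {x : Var} {A : Ty} {hΞ : Ξ = {(x, A)}} (s : List Dir)
      (h : π.sub q = some ⟨_, _, _, .var x A hΞ⟩) :
      AxLink ⟨q, .hyp x, s⟩ ⟨q, .concl, s⟩

/-- `VertLink π a b`: the position `a` in the conclusion of a rule is carried over from the
position `b` in one of its premises. The two branches of a conditional are treated apart. -/
inductive VertLink : Pos → Pos → Prop
  | lamCtx {q : Path} {Δ Ξ : Ctx} {M : Tm} {B : Ty} {x : Var} {A : Ty}
      {hΞ : Ξ = insert (x, A) Δ} {hx : x ∉ Ctx.dom Δ} {d : Der Ξ M B} {y : Var} (s : List Dir)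
      (h : π.sub q = some ⟨_, _, _, .lam x A hΞ hx d⟩) (hy : y ∈ Ctx.dom Δ) :
      VertLink ⟨q, .hyp y, s⟩ ⟨q ++ [0], .hyp y, s⟩
  | lamVar {q : Path} {Δ Ξ : Ctx} {M : Tm} {B : Ty} {x : Var} {A : Ty}
      {hΞ : Ξ = insert (x, A) Δ} {hx : x ∉ Ctx.dom Δ} {d : Der Ξ M B} (s : List Dir)
      (h : π.sub q = some ⟨_, _, _, .lam x A hΞ hx d⟩) :
      VertLink ⟨q, .concl, .L :: s⟩ ⟨q ++ [0], .hyp x, s⟩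
  | lamBody {q : Path} {Δ Ξ : Ctx} {M : Tm} {B : Ty} {x : Var} {A : Ty}
      {hΞ : Ξ = insert (x, A) Δ} {hx : x ∉ Ctx.dom Δ} {d : Der Ξ M B} (s : List Dir)
      (h : π.sub q = some ⟨_, _, _, .lam x A hΞ hx d⟩) :
      VertLink ⟨q, .concl, .R :: s⟩ ⟨q ++ [0], .concl, s⟩
  | appLeft {q : Path} {Δ Γ Ξ : Ctx} {M N : Tm} {A B : Ty} {hΞ : Ξ = Δ ∪ Γ}
      {hd : Disjoint (Ctx.dom Δ) (Ctx.dom Γ)} {d₀ : Der Δ M (.lolli A B)} {d₁ : Der Γ N A}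
      {y : Var} (s : List Dir)
      (h : π.sub q = some ⟨_, _, _, .app hΞ hd d₀ d₁⟩) (hy : y ∈ Ctx.dom Δ) :
      VertLink ⟨q, .hyp y, s⟩ ⟨q ++ [0], .hyp y, s⟩
  | appRight {q : Path} {Δ Γ Ξ : Ctx} {M N : Tm} {A B : Ty} {hΞ : Ξ = Δ ∪ Γ}
      {hd : Disjoint (Ctx.dom Δ) (Ctx.dom Γ)} {d₀ : Der Δ M (.lolli A B)} {d₁ : Der Γ N A}
      {y : Var} (s : List Dir)
      (h : π.sub q = some ⟨_, _, _, .app hΞ hd d₀ d₁⟩) (hy : y ∈ Ctx.dom Γ) :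
      VertLink ⟨q, .hyp y, s⟩ ⟨q ++ [1], .hyp y, s⟩
  | appConcl {q : Path} {Δ Γ Ξ : Ctx} {M N : Tm} {A B : Ty} {hΞ : Ξ = Δ ∪ Γ}
      {hd : Disjoint (Ctx.dom Δ) (Ctx.dom Γ)} {d₀ : Der Δ M (.lolli A B)} {d₁ : Der Γ N A}
      (s : List Dir)
      (h : π.sub q = some ⟨_, _, _, .app hΞ hd d₀ d₁⟩) :
      VertLink ⟨q, .concl, s⟩ ⟨q ++ [0], .concl, .R :: s⟩
  | letStarLeft {q : Path} {Δ Γ Ξ : Ctx} {M N : Tm} {A : Ty} {hΞ : Ξ = Δ ∪ Γ}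
      {hd : Disjoint (Ctx.dom Δ) (Ctx.dom Γ)} {d₀ : Der Δ M .one} {d₁ : Der Γ N A}
      {y : Var} (s : List Dir)
      (h : π.sub q = some ⟨_, _, _, .letStar hΞ hd d₀ d₁⟩) (hy : y ∈ Ctx.dom Δ) :
      VertLink ⟨q, .hyp y, s⟩ ⟨q ++ [0], .hyp y, s⟩
  | letStarRight {q : Path} {Δ Γ Ξ : Ctx} {M N : Tm} {A : Ty} {hΞ : Ξ = Δ ∪ Γ}
      {hd : Disjoint (Ctx.dom Δ) (Ctx.dom Γ)} {d₀ : Der Δ M .one} {d₁ : Der Γ N A}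
      {y : Var} (s : List Dir)
      (h : π.sub q = some ⟨_, _, _, .letStar hΞ hd d₀ d₁⟩) (hy : y ∈ Ctx.dom Γ) :
      VertLink ⟨q, .hyp y, s⟩ ⟨q ++ [1], .hyp y, s⟩
  | letStarConcl {q : Path} {Δ Γ Ξ : Ctx} {M N : Tm} {A : Ty} {hΞ : Ξ = Δ ∪ Γ}
      {hd : Disjoint (Ctx.dom Δ) (Ctx.dom Γ)} {d₀ : Der Δ M .one} {d₁ : Der Γ N A}
      (s : List Dir)
      (h : π.sub q = some ⟨_, _, _, .letStar hΞ hd d₀ d₁⟩) :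
      VertLink ⟨q, .concl, s⟩ ⟨q ++ [1], .concl, s⟩
  | pairLeft {q : Path} {Δ Γ Ξ : Ctx} {M N : Tm} {A B : Ty} {hΞ : Ξ = Δ ∪ Γ}
      {hd : Disjoint (Ctx.dom Δ) (Ctx.dom Γ)} {d₀ : Der Δ M A} {d₁ : Der Γ N B}
      {y : Var} (s : List Dir)
      (h : π.sub q = some ⟨_, _, _, .pair hΞ hd d₀ d₁⟩) (hy : y ∈ Ctx.dom Δ) :
      VertLink ⟨q, .hyp y, s⟩ ⟨q ++ [0], .hyp y, s⟩
  | pairRight {q : Path} {Δ Γ Ξ : Ctx} {M N : Tm} {A B : Ty} {hΞ : Ξ = Δ ∪ Γ}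
      {hd : Disjoint (Ctx.dom Δ) (Ctx.dom Γ)} {d₀ : Der Δ M A} {d₁ : Der Γ N B}
      {y : Var} (s : List Dir)
      (h : π.sub q = some ⟨_, _, _, .pair hΞ hd d₀ d₁⟩) (hy : y ∈ Ctx.dom Γ) :
      VertLink ⟨q, .hyp y, s⟩ ⟨q ++ [1], .hyp y, s⟩
  | pairFst {q : Path} {Δ Γ Ξ : Ctx} {M N : Tm} {A B : Ty} {hΞ : Ξ = Δ ∪ Γ}
      {hd : Disjoint (Ctx.dom Δ) (Ctx.dom Γ)} {d₀ : Der Δ M A} {d₁ : Der Γ N B}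
      (s : List Dir)
      (h : π.sub q = some ⟨_, _, _, .pair hΞ hd d₀ d₁⟩) :
      VertLink ⟨q, .concl, .L :: s⟩ ⟨q ++ [0], .concl, s⟩
  | pairSnd {q : Path} {Δ Γ Ξ : Ctx} {M N : Tm} {A B : Ty} {hΞ : Ξ = Δ ∪ Γ}
      {hd : Disjoint (Ctx.dom Δ) (Ctx.dom Γ)} {d₀ : Der Δ M A} {d₁ : Der Γ N B}
      (s : List Dir)
      (h : π.sub q = some ⟨_, _, _, .pair hΞ hd d₀ d₁⟩) :
      VertLink ⟨q, .concl, .R :: s⟩ ⟨q ++ [1], .concl, s⟩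
  | letPairLeft {q : Path} {Δ Γ Γ' Ξ : Ctx} {M N : Tm} {C : Ty} {x y : Var} {A B : Ty}
      {hΞ : Ξ = Δ ∪ Γ} {hd : Disjoint (Ctx.dom Δ) (Ctx.dom Γ)}
      {hΓ' : Γ' = insert (x, A) (insert (y, B) Γ)}
      {hxy : x ≠ y} {hx : x ∉ Ctx.dom Γ} {hy : y ∉ Ctx.dom Γ}
      {d₀ : Der Δ M (.tensor A B)} {d₁ : Der Γ' N C} {z : Var} (s : List Dir)
      (h : π.sub q = some ⟨_, _, _, .letPair x y A B hΞ hd hΓ' hxy hx hy d₀ d₁⟩)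
      (hz : z ∈ Ctx.dom Δ) :
      VertLink ⟨q, .hyp z, s⟩ ⟨q ++ [0], .hyp z, s⟩
  | letPairRight {q : Path} {Δ Γ Γ' Ξ : Ctx} {M N : Tm} {C : Ty} {x y : Var} {A B : Ty}
      {hΞ : Ξ = Δ ∪ Γ} {hd : Disjoint (Ctx.dom Δ) (Ctx.dom Γ)}
      {hΓ' : Γ' = insert (x, A) (insert (y, B) Γ)}
      {hxy : x ≠ y} {hx : x ∉ Ctx.dom Γ} {hy : y ∉ Ctx.dom Γ}
      {d₀ : Der Δ M (.tensor A B)} {d₁ : Der Γ' N C} {z : Var} (s : List Dir)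
      (h : π.sub q = some ⟨_, _, _, .letPair x y A B hΞ hd hΓ' hxy hx hy d₀ d₁⟩)
      (hz : z ∈ Ctx.dom Γ) :
      VertLink ⟨q, .hyp z, s⟩ ⟨q ++ [1], .hyp z, s⟩
  | letPairConcl {q : Path} {Δ Γ Γ' Ξ : Ctx} {M N : Tm} {C : Ty} {x y : Var} {A B : Ty}
      {hΞ : Ξ = Δ ∪ Γ} {hd : Disjoint (Ctx.dom Δ) (Ctx.dom Γ)}
      {hΓ' : Γ' = insert (x, A) (insert (y, B) Γ)}
      {hxy : x ≠ y} {hx : x ∉ Ctx.dom Γ} {hy : y ∉ Ctx.dom Γ}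
      {d₀ : Der Δ M (.tensor A B)} {d₁ : Der Γ' N C} (s : List Dir)
      (h : π.sub q = some ⟨_, _, _, .letPair x y A B hΞ hd hΓ' hxy hx hy d₀ d₁⟩) :
      VertLink ⟨q, .concl, s⟩ ⟨q ++ [1], .concl, s⟩
  | iteGuard {q : Path} {Δ Γ Ξ : Ctx} {M N P : Tm} {A : Ty} {hΞ : Ξ = Δ ∪ Γ}
      {hd : Disjoint (Ctx.dom Δ) (Ctx.dom Γ)} {d₀ : Der Δ M .bit} {d₁ : Der Γ N A}
      {d₂ : Der Γ P A} {y : Var} (s : List Dir)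
      (h : π.sub q = some ⟨_, _, _, .ite hΞ hd d₀ d₁ d₂⟩) (hy : y ∈ Ctx.dom Δ) :
      VertLink ⟨q, .hyp y, s⟩ ⟨q ++ [0], .hyp y, s⟩

/-- `CutLink π a b`: the positions `a` and `b` in two premises of a rule are connected by it
(the argument of an application, the components of a pair that is taken apart). -/
inductive CutLink : Pos → Pos → Prop
  | app {q : Path} {Δ Γ Ξ : Ctx} {M N : Tm} {A B : Ty} {hΞ : Ξ = Δ ∪ Γ}
      {hd : Disjoint (Ctx.dom Δ) (Ctx.dom Γ)} {d₀ : Der Δ M (.lolli A B)} {d₁ : Der Γ N A}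
      (s : List Dir)
      (h : π.sub q = some ⟨_, _, _, .app hΞ hd d₀ d₁⟩) :
      CutLink ⟨q ++ [0], .concl, .L :: s⟩ ⟨q ++ [1], .concl, s⟩
  | letPairFst {q : Path} {Δ Γ Γ' Ξ : Ctx} {M N : Tm} {C : Ty} {x y : Var} {A B : Ty}
      {hΞ : Ξ = Δ ∪ Γ} {hd : Disjoint (Ctx.dom Δ) (Ctx.dom Γ)}
      {hΓ' : Γ' = insert (x, A) (insert (y, B) Γ)}
      {hxy : x ≠ y} {hx : x ∉ Ctx.dom Γ} {hy : y ∉ Ctx.dom Γ}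
      {d₀ : Der Δ M (.tensor A B)} {d₁ : Der Γ' N C} (s : List Dir)
      (h : π.sub q = some ⟨_, _, _, .letPair x y A B hΞ hd hΓ' hxy hx hy d₀ d₁⟩) :
      CutLink ⟨q ++ [0], .concl, .L :: s⟩ ⟨q ++ [1], .hyp x, s⟩
  | letPairSnd {q : Path} {Δ Γ Γ' Ξ : Ctx} {M N : Tm} {C : Ty} {x y : Var} {A B : Ty}
      {hΞ : Ξ = Δ ∪ Γ} {hd : Disjoint (Ctx.dom Δ) (Ctx.dom Γ)}
      {hΓ' : Γ' = insert (x, A) (insert (y, B) Γ)}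
      {hxy : x ≠ y} {hx : x ∉ Ctx.dom Γ} {hy : y ∉ Ctx.dom Γ}
      {d₀ : Der Δ M (.tensor A B)} {d₁ : Der Γ' N C} (s : List Dir)
      (h : π.sub q = some ⟨_, _, _, .letPair x y A B hΞ hd hΓ' hxy hx hy d₀ d₁⟩) :
      CutLink ⟨q ++ [0], .concl, .R :: s⟩ ⟨q ++ [1], .hyp y, s⟩

/-- `Move π a b`: a token in position `a` travels to position `b` by a structural rule. -/
inductive Move : Pos → Pos → Prop
  | up {a b : Pos} : VertLink π a b → IsNeg π a → Move a b
  | down {a b : Pos} : VertLink π a b → IsPos π b → Move b a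
  | cutRight {a b : Pos} : CutLink π a b → IsPos π a → Move a b
  | cutLeft {a b : Pos} : CutLink π a b → IsPos π b → Move b a
  | axRight {a b : Pos} : AxLink π a b → IsNeg π a → Move a b
  | axLeft {a b : Pos} : AxLink π a b → IsNeg π b → Move b a

/-- The last rule at the node `q` is a unit axiom `⊢ * : 1`. -/
def IsStar (q : Path) : Prop :=
  ∃ (Ξ : Ctx) (hΞ : Ξ = ∅), π.sub q = some ⟨_, _, _, .star hΞ⟩

/-- The last rule at the node `q` is a `let * = M in N`. -/
def IsLetStar (q : Path) : Prop :=
  ∃ (Δ Γ Ξ : Ctx) (M N : Tm) (A : Ty) (hΞ : Ξ = Δ ∪ Γ)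
    (hd : Disjoint (Ctx.dom Δ) (Ctx.dom Γ)) (d₀ : Der Δ M .one) (d₁ : Der Γ N A),
    π.sub q = some ⟨_, _, _, .letStar hΞ hd d₀ d₁⟩

/-- The last rule at the node `q` is a conditional whose two branches have the context `Γ`. -/
def IsIte (q : Path) (Γ : Ctx) : Prop :=
  ∃ (Δ Ξ : Ctx) (M N P : Tm) (A : Ty) (hΞ : Ξ = Δ ∪ Γ)
    (hd : Disjoint (Ctx.dom Δ) (Ctx.dom Γ)) (d₀ : Der Δ M .bit) (d₁ : Der Γ N A)
    (d₂ : Der Γ P A),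
    π.sub q = some ⟨_, _, _, .ite hΞ hd d₀ d₁ d₂⟩

/-- The last rule at the node `q` is the axiom for the operation `c`. -/
def IsOp (q : Path) (c : Op) : Prop :=
  ∃ (Ξ : Ctx) (hΞ : Ξ = ∅), π.sub q = some ⟨_, _, _, .op c hΞ⟩

end Positions

/-- The formulas that the conclusion of a conditional shares with its branches: the hypotheses
in the context `Γ` of the branches, and the conclusion. -/
def BranchSlot (Γ : Ctx) : Slot → Prop
  | .hyp y => y ∈ Ctx.dom Γ
  | .concl => True

/-- The position of the guard bit of the conditional at the node `q`. -/
def guardPos (q : Path) : Pos := ⟨q ++ [0], .concl, []⟩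

/-- The branch of the conditional at the node `q` selected by a Boolean: the value `0` (`false`)
selects the first branch, the value `1` (`true`) selects the second one. -/
def branch (q : Path) (b : Bool) : Path := q ++ [if b then 2 else 1]

/-! ### Circuits and extended circuits -/

/-- Labels of wires. A wire carries the label of the position of its token. -/
abbrev Label : Type := Pos

/-- Circuits with classical control flow. `id` is the identity circuit, `relabel f` is the
identity up to the renaming of wires by `f`, and `gate c ls rs` applies the operation `c` with
inputs `ls` and outputs `rs`. -/
inductive Circ : Type
  | id
  | relabel (f : Label → Label)
  | gate (c : Op) (ls rs : List Label)
  | seq (C D : Circ)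
  | ite (l : Label) (C D : Circ)

/-- Environments: sets of labels with their base types. -/
abbrev Env : Type := Set (Label × BTy)

/-- The labels of an environment. -/
def Env.labels (Γ : Env) : Set Label := Prod.fst '' Γ

/-- Every label occurs at most once in the environment. -/
def Env.WF (Γ : Env) : Prop := Set.InjOn Prod.fst Γ

/-- The environment `l₁ : B₁, …, lₙ : Bₙ`. -/
def Env.ofList (ls : List Label) (Bs : List BTy) : Env := {w | w ∈ ls.zip Bs}

/-- Circuit typing `Γ ▷ C ▷ Δ`. -/
inductive Circ.HasType : Env → Circ → Env → Prop
  | id {Γ : Env} (h : Γ.WF) : HasType Γ .id Γ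
  | relabel {Γ : Env} (f : Label → Label) (h : Γ.WF) (hf : Set.InjOn f Γ.labels) :
      HasType Γ (.relabel f) ((fun w => (f w.1, w.2)) '' Γ)
  | gate {Θ : Env} {c : Op} {ls rs : List Label} (h : Θ.WF)
      (hl : ls.length = c.inTy.length) (hr : rs.length = c.outTy.length)
      (hln : ls.Nodup) (hrn : rs.Nodup)
      (hld : ∀ l ∈ ls, l ∉ Θ.labels) (hrd : ∀ r ∈ rs, r ∉ Θ.labels) :
      HasType (Θ ∪ Env.ofList ls c.inTy) (.gate c ls rs) (Θ ∪ Env.ofList rs c.outTy)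
  | seq {Γ Ψ Δ : Env} {C D : Circ} (hC : HasType Γ C Ψ) (hD : HasType Ψ D Δ) :
      HasType Γ (.seq C D) Δ
  | ite {Γ Δ : Env} {l : Label} {C D : Circ} (hl : l ∉ Γ.labels)
      (hC : HasType Γ C Δ) (hD : HasType Γ D Δ) :
      HasType (insert (l, .bit) Γ) (.ite l C D) Δ

/-- Addresses: finite sets of choices of a value for some labels of guards. -/
abbrev Addr : Type := Finset (Label × Bool)

/-- Extended circuits: binary trees of circuits, in which a node `C ↦ˡ (E₀, E₁)` runs `C` and
then goes on with `E₀` or with `E₁` according to the value of the bit `l`. -/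
inductive ECirc : Type
  | leaf (C : Circ)
  | node (C : Circ) (l : Label) (E₀ E₁ : ECirc)

/-- The addresses of the leaves of an extended circuit. -/
def ECirc.addrs : ECirc → Set Addr
  | .leaf _ => {∅}
  | .node _ l E₀ E₁ =>
    (fun G => insert (l, false) G) '' E₀.addrs ∪ (fun G => insert (l, true) G) '' E₁.addrs

/-- The extended circuit obtained by replacing the leaf `C` at address `G` by `f C`. -/
def ECirc.update (G : Addr) (f : Circ → ECirc) : ECirc → ECirc
  | .leaf C => f C
  | .node C l E₀ E₁ =>
    if (l, false) ∈ G then .node C l (E₀.update G f) E₁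
    else if (l, true) ∈ G then .node C l E₀ (E₁.update G f)
    else .node C l E₀ E₁

/-- The circuit `C'` is put after the leaf at address `G`. -/
def ECirc.append (G : Addr) (C' : Circ) (E : ECirc) : ECirc :=
  E.update G fun C => .leaf (.seq C C')

/-- The circuit associated with an extended circuit. -/
def ECirc.toCirc : ECirc → Circ
  | .leaf C => C
  | .node C l E₀ E₁ => .seq C (.ite l E₀.toCirc E₁.toCirc)

/-- Typing of extended circuits: the input environment is `Γ`, and the leaf at address `G` has
the output environment `J G`. -/
inductive ECirc.HasType : Env → ECirc → (Addr → Env) → Prop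
  | leaf {Γ : Env} {C : Circ} {J : Addr → Env} (h : Circ.HasType Γ C (J ∅)) :
      HasType Γ (.leaf C) J
  | node {Γ Δ : Env} {C : Circ} {l : Label} {E₀ E₁ : ECirc} {J : Addr → Env}
      (hl : l ∉ Δ.labels) (hC : Circ.HasType Γ C (insert (l, .bit) Δ))
      (h₀ : HasType Δ E₀ fun G => J (insert (l, false) G))
      (h₁ : HasType Δ E₁ fun G => J (insert (l, true) G)) :
      HasType Γ (.node C l E₀ E₁) J

/-! ### Configurations -/

/-- Tokens: a position, an address and a flag. The flag is off (`false`) at first; it is turned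
on for a token in the guard of a conditional once the bit has been used up by the circuit. -/
structure Token : Type where
  pos : Pos
  addr : Addr
  flag : Bool

/-- A configuration for a derivation: a set of tokens and an extended circuit. -/
structure Config : Type where
  tokens : Set Token
  circ : ECirc

section Machine

variable {Δ₀ : Ctx} {M₀ : Tm} {A₀ : Ty} (π : Der Δ₀ M₀ A₀)

/-- The environment of the negative occurrences of bits and qubits in the conclusion of the
sub-derivation `r`. -/
def ndata (r : Path) : Env := {w | w.1.node = r ∧ OccursAt π w.1 (.base w.2) false}

/-- The environment of the positive occurrences of bits and qubits in the conclusion of the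
sub-derivation `r`. -/
def pdata (r : Path) : Env := {w | w.1.node = r ∧ OccursAt π w.1 (.base w.2) true}

/-- The wires at address `G`: one for every token over a bit or qubit that has not been used
up. -/
def Config.env (c : Config) (G : Addr) : Env :=
  {w | ⟨w.1, G, false⟩ ∈ c.tokens ∧ ∃ e, OccursAt π w.1 (.base w.2) e}

/-- The positions of the tokens at address `G`. -/
def Config.positions (c : Config) (G : Addr) : Set Pos :=
  {a | ∃ e, ⟨a, G, e⟩ ∈ c.tokens}

/-- `Opened π r p G`: in the slice `G` of a run on the sub-derivation `r`, the branch of every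
conditional of `r` in which the node `p` lies has been selected. -/
def Opened (r p : Path) (G : Addr) : Prop :=
  ∀ (q : Path) (Γ : Ctx) (b : Bool), r <+: q → IsIte π q Γ → branch q b <+: p →
    (guardPos q, b) ∈ G

/-- The initial configuration for the sub-derivation `r`: tokens with empty address in the
negative positions of the conclusion and in the unit axioms, and the identity circuit. -/
def initial (r : Path) : Config where
  tokens := {t | t.addr = ∅ ∧ t.flag = false ∧
    ((t.pos.node = r ∧ IsNeg π t.pos) ∨
      ∃ p, r <+: p ∧ IsStar π p ∧ t.pos = ⟨p, .concl, []⟩)}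
  circ := .leaf .id

/-- The circuit of a configuration for the sub-derivation `r` goes from the negative data of the
conclusion to the wires of the tokens, at every address, and tokens have addresses of the
circuit. -/
def Config.WellFormed (r : Path) (c : Config) : Prop :=
  (∀ t ∈ c.tokens, t.addr ∈ c.circ.addrs) ∧ c.circ.HasType (ndata π r) (c.env π)

/-- The positions of the tokens in the slice `G` of a final configuration for the sub-derivation
`r`: the positive positions of the conclusion and, in the part of `r` that has been opened in this
slice, the occurrences of `1` eliminated by a `let * = M in N` and the guards of the conditionals;
the tokens of the unit axioms in branches that have not been opened are still in their place. -/
def finalPositions (r : Path) (G : Addr) : Set Pos :=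
  {a | a.node = r ∧ IsPos π a} ∪
  {a | ∃ q, r <+: q ∧ IsLetStar π q ∧ Opened π r q G ∧ a = ⟨q ++ [0], .concl, []⟩} ∪
  {a | ∃ q Γ, r <+: q ∧ IsIte π q Γ ∧ Opened π r q G ∧ a = guardPos q} ∪
  {a | ∃ p, r <+: p ∧ IsStar π p ∧ ¬ Opened π r p G ∧ a = ⟨p, .concl, []⟩}

/-- Final configurations for the sub-derivation `r`. In particular the circuit is uniform: it goes
from the negative to the positive data of the conclusion, at every address. -/
def Config.Final (r : Path) (c : Config) : Prop :=
  c.WellFormed π r ∧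
    ∀ G ∈ c.circ.addrs, c.positions G = finalPositions π r G ∧ c.env π G = pdata π r

/-! ### Transitions -/

/-- The places of the base types in `B₁ ⊗ ⋯ ⊗ Bₚ`, from left to right. -/
def tensorPlaces : List BTy → List (List Dir)
  | [] => []
  | [_] => [[]]
  | _ :: C :: Bs => [.L] :: (tensorPlaces (C :: Bs)).map (.R :: ·)

/-- The labels of the inputs of the operation `c` at the node `q`. -/
def inLabels (q : Path) (c : Op) : List Label :=
  (tensorPlaces c.inTy).map fun s => ⟨q, .concl, .L :: s⟩

/-- The labels of the outputs of the operation `c` at the node `q`. -/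
def outLabels (q : Path) (c : Op) : List Label :=
  (tensorPlaces c.outTy).map fun s => ⟨q, .concl, .R :: s⟩

/-- The token at position `a` and address `G` moves to the position `b`, and its wire is
renamed accordingly. -/
def Config.move (c : Config) (G : Addr) (a b : Pos) : Config where
  tokens := insert ⟨b, G, false⟩ (c.tokens \ {⟨a, G, false⟩})
  circ := c.circ.append G (.relabel (Function.update (fun l => l) a b))

/-- The operation `o` at the node `q` is applied at address `G`. -/
def Config.applyOp (c : Config) (G : Addr) (q : Path) (o : Op) : Config where
  tokens := {t ∈ c.tokens | ¬ (t.addr = G ∧ t.pos.node = q ∧ IsNeg π t.pos)} ∪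
    {t | t.addr = G ∧ t.flag = false ∧ t.pos.node = q ∧ IsPos π t.pos}
  circ := c.circ.append G (.gate o (inLabels q o) (outLabels q o))

/-- The slice `G` is split according to the guard of the conditional at the node `q`: all its
tokens are duplicated, and the flag of the guard is turned on. -/
def Config.split (c : Config) (G : Addr) (q : Path) : Config where
  tokens := {t ∈ c.tokens | t.addr ≠ G} ∪
    {t | ∃ u ∈ c.tokens, ∃ b : Bool, u.addr = G ∧ t.pos = u.pos ∧
      t.addr = insert (guardPos q, b) G ∧ (t.flag = true ↔ u.flag = true ∨ u.pos = guardPos q)}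
  circ := c.circ.update G fun C => .node C (guardPos q) (.leaf .id) (.leaf .id)

open Classical in
/-- Renaming of the wires at the conclusion of the conditional at the node `q`, whose branches have
the context `Γ`, to the corresponding wires at the conclusion of a branch. -/
noncomputable def enterBranch (q : Path) (Γ : Ctx) (b : Bool) (l : Label) : Label :=
  if l.node = q ∧ BranchSlot Γ l.slot then ⟨branch q b, l.slot, l.path⟩ else l

/-- Renaming of the wires at the conclusion of a branch to the corresponding wires at the
conclusion of the conditional. -/
def exitBranch (q : Path) (b : Bool) (l : Label) : Label :=
  if l.node = branch q b then ⟨q, l.slot, l.path⟩ else l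

/-- The circuit produced by a run on a branch, as a circuit between wires at the conclusion of
the conditional. -/
noncomputable def branchCirc (q : Path) (Γ : Ctx) (b : Bool) (E : ECirc) : Circ :=
  .seq (.relabel (enterBranch q Γ b)) (.seq E.toCirc (.relabel (exitBranch q b)))

/-- The tokens in the slice `G` at the conclusion of the conditional at the node `q` cross both
branches at once; these have produced the extended circuits `E₀` and `E₁`. -/
noncomputable def Config.cross (c : Config) (G : Addr) (q : Path) (Γ : Ctx)
    (E₀ E₁ : ECirc) : Config where
  tokens :=
    {t ∈ c.tokens | ¬ (t.addr = G ∧ (t.pos = guardPos q ∨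
      (t.pos.node = q ∧ BranchSlot Γ t.pos.slot ∧ IsNeg π t.pos)))} ∪
    {t | t.addr = G ∧ t.flag = false ∧
      t.pos.node = q ∧ BranchSlot Γ t.pos.slot ∧ IsPos π t.pos} ∪
    {⟨guardPos q, G, true⟩}
  circ := c.circ.append G
    (.ite (guardPos q) (branchCirc q Γ false E₀) (branchCirc q Γ true E₁))

mutual

/-- `Step π r c c'`: one transition of the machine with both asynchronous and synchronous rules for
conditionals, on the sub-derivation `r` of `π`. -/
inductive Step : Path → Config → Config → Prop
  /-- Structural rules. A token inside a branch of a conditional may only move in a slice for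
  which the branch has been selected (this only matters for the tokens of unit axioms, as the
  other tokens have entered the branch). -/
  | structural {r : Path} {c : Config} {G : Addr} {a b : Pos}
      (ht : ⟨a, G, false⟩ ∈ c.tokens) (hm : Move π a b)
      (ha : r <+: a.node) (hb : r <+: b.node) (ho : Opened π r a.node G) :
      Step r c (c.move G a b)
  /-- Circuit rules: all the inputs of an operation have been reached in the slice `G`. -/
  | circuit {r : Path} {c : Config} {G : Addr} {q : Path} {o : Op}
      (hq : r <+: q) (h : IsOp π q o)
      (ht : ∀ a : Pos, a.node = q → IsNeg π a → ⟨a, G, false⟩ ∈ c.tokens) :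
      Step r c (c.applyOp π G q o)
  /-- Asynchronous guard rule: the bit in the guard is read, and the slice is split. -/
  | guard {r : Path} {c : Config} {G : Addr} {q : Path} {Γ : Ctx}
      (hq : r <+: q) (h : IsIte π q Γ) (ht : ⟨guardPos q, G, false⟩ ∈ c.tokens) :
      Step r c (c.split G q)
  /-- A token enters the branch that has been selected for its slice. -/
  | enter {r : Path} {c : Config} {G : Addr} {q : Path} {Γ : Ctx} {b : Bool} {σ : Slot}
      {s : List Dir} (hq : r <+: q) (h : IsIte π q Γ)
      (hg : ⟨guardPos q, G, true⟩ ∈ c.tokens) (hb : (guardPos q, b) ∈ G)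
      (hσ : BranchSlot Γ σ) (hn : IsNeg π ⟨q, σ, s⟩) (ht : ⟨⟨q, σ, s⟩, G, false⟩ ∈ c.tokens) :
      Step r c (c.move G ⟨q, σ, s⟩ ⟨branch q b, σ, s⟩)
  /-- A token leaves the branch that has been selected for its slice. -/
  | exit {r : Path} {c : Config} {G : Addr} {q : Path} {Γ : Ctx} {b : Bool} {σ : Slot}
      {s : List Dir} (hq : r <+: q) (h : IsIte π q Γ)
      (hg : ⟨guardPos q, G, true⟩ ∈ c.tokens) (hb : (guardPos q, b) ∈ G)
      (hp : IsPos π ⟨branch q b, σ, s⟩) (ht : ⟨⟨branch q b, σ, s⟩, G, false⟩ ∈ c.tokens) :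
      Step r c (c.move G ⟨branch q b, σ, s⟩ ⟨q, σ, s⟩)
  /-- Synchronous rule: the guard has been reached and has not been read, all the negative
  positions that the conditional shares with its branches have been reached, and the machine takes
  both branches from their initial to a final configuration. -/
  | sync {r : Path} {c : Config} {G : Addr} {q : Path} {Γ : Ctx} {c₀ c₁ : Config}
      (hq : r <+: q) (h : IsIte π q Γ) (hg : ⟨guardPos q, G, false⟩ ∈ c.tokens)
      (ht : ∀ a : Pos, a.node = q → BranchSlot Γ a.slot → IsNeg π a →
        ⟨a, G, false⟩ ∈ c.tokens)
      (h₀ : Run (branch q false) (initial π (branch q false)) c₀)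
      (hf₀ : c₀.Final π (branch q false))
      (h₁ : Run (branch q true) (initial π (branch q true)) c₁)
      (hf₁ : c₁.Final π (branch q true)) :
      Step r c (c.cross π G q Γ c₀.circ c₁.circ)

/-- `Run π r c c'`: a finite sequence of transitions leads from `c` to `c'`. -/
inductive Run : Path → Config → Config → Prop
  | refl {r : Path} {c : Config} : Run r c c
  | tail {r : Path} {c c' c'' : Config} (h : Run r c c') (hs : Step r c' c'') : Run r c c''

end

end Machine

end QCSIAM

namespace QCSIAM

set_option linter.unusedSimpArgs false

/-! ### Rules, ports and links -/

/-- The last rule of a derivation, with the variables of the contexts of its premises. -/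
inductive Kind : Type
  | var (x : Var)
  | lam (D : Finset Var) (x : Var)
  | app (D E : Finset Var)
  | star
  | letStar (D E : Finset Var)
  | pair (D E : Finset Var)
  | letPair (D E : Finset Var) (x y : Var)
  | ite (D E : Finset Var)
  | op (c : Op)

def Der.kind {Δ : Ctx} {M : Tm} {A : Ty} : Der Δ M A → Kind
  | .var x _ _ => .var x
  | @Der.lam Δ _ _ _ x _ _ _ _ => .lam (Ctx.dom Δ) x
  | @Der.app Δ Γ _ _ _ _ _ _ _ _ _ => .app (Ctx.dom Δ) (Ctx.dom Γ)
  | .star _ => .star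
  | @Der.letStar Δ Γ _ _ _ _ _ _ _ _ => .letStar (Ctx.dom Δ) (Ctx.dom Γ)
  | @Der.pair Δ Γ _ _ _ _ _ _ _ _ _ => .pair (Ctx.dom Δ) (Ctx.dom Γ)
  | @Der.letPair Δ Γ _ _ _ _ _ x y _ _ _ _ _ _ _ _ _ _ =>
      .letPair (Ctx.dom Δ) (Ctx.dom Γ) x y
  | @Der.ite Δ Γ _ _ _ _ _ _ _ _ _ _ => .ite (Ctx.dom Δ) (Ctx.dom Γ)
  | .op c _ => .op c

/-- The side conditions of a rule on the variables of its contexts. -/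
def Kind.Valid : Kind → Prop
  | .lam D x => x ∉ D
  | .app D E | .letStar D E | .pair D E | .ite D E => Disjoint D E
  | .letPair D E x y => Disjoint D E ∧ x ≠ y ∧ x ∉ E ∧ y ∉ E
  | _ => True

theorem Der.kind_valid {Δ : Ctx} {M : Tm} {A : Ty} (d : Der Δ M A) : d.kind.Valid := by
  cases d <;> simp_all [Der.kind, Kind.Valid]

/-- Places in the judgements of a rule: in the conclusion, or in a premise. -/
inductive Port : Type
  | top (σ : Slot) (s : List Dir)
  | prem (i : ℕ) (σ : Slot) (s : List Dir)

def Port.place (q : Path) : Port → Pos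
  | .top σ s => ⟨q, σ, s⟩
  | .prem i σ s => ⟨q ++ [i], σ, s⟩

theorem Port.place_injective (q : Path) : Function.Injective (Port.place q) := by
  intro p p' h
  cases p <;> cases p' <;> simp_all [Port.place]

/-- The other end of the structural link at a port of a rule. -/
def Kind.link : Kind → Port → Option Port
  | .var x, .top (.hyp y) s => if y = x then some (.top .concl s) else none
  | .var x, .top .concl s => some (.top (.hyp x) s)
  | .lam D _, .top (.hyp y) s => if y ∈ D then some (.prem 0 (.hyp y) s) else none
  | .lam _ x, .top .concl (.L :: s) => some (.prem 0 (.hyp x) s)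
  | .lam _ _, .top .concl (.R :: s) => some (.prem 0 .concl s)
  | .lam D x, .prem 0 (.hyp y) s =>
      if y = x then some (.top .concl (.L :: s))
      else if y ∈ D then some (.top (.hyp y) s) else none
  | .lam _ _, .prem 0 .concl s => some (.top .concl (.R :: s))
  | .app D E, .top (.hyp y) s =>
      if y ∈ D then some (.prem 0 (.hyp y) s)
      else if y ∈ E then some (.prem 1 (.hyp y) s) else none
  | .app D _, .prem 0 (.hyp y) s => if y ∈ D then some (.top (.hyp y) s) else none
  | .app _ E, .prem 1 (.hyp y) s => if y ∈ E then some (.top (.hyp y) s) else none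
  | .app _ _, .top .concl s => some (.prem 0 .concl (.R :: s))
  | .app _ _, .prem 0 .concl (.R :: s) => some (.top .concl s)
  | .app _ _, .prem 0 .concl (.L :: s) => some (.prem 1 .concl s)
  | .app _ _, .prem 1 .concl s => some (.prem 0 .concl (.L :: s))
  | .letStar D E, .top (.hyp y) s =>
      if y ∈ D then some (.prem 0 (.hyp y) s)
      else if y ∈ E then some (.prem 1 (.hyp y) s) else none
  | .letStar D _, .prem 0 (.hyp y) s => if y ∈ D then some (.top (.hyp y) s) else none
  | .letStar _ E, .prem 1 (.hyp y) s => if y ∈ E then some (.top (.hyp y) s) else none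
  | .letStar _ _, .top .concl s => some (.prem 1 .concl s)
  | .letStar _ _, .prem 1 .concl s => some (.top .concl s)
  | .pair D E, .top (.hyp y) s =>
      if y ∈ D then some (.prem 0 (.hyp y) s)
      else if y ∈ E then some (.prem 1 (.hyp y) s) else none
  | .pair D _, .prem 0 (.hyp y) s => if y ∈ D then some (.top (.hyp y) s) else none
  | .pair _ E, .prem 1 (.hyp y) s => if y ∈ E then some (.top (.hyp y) s) else none
  | .pair _ _, .top .concl (.L :: s) => some (.prem 0 .concl s)
  | .pair _ _, .top .concl (.R :: s) => some (.prem 1 .concl s)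
  | .pair _ _, .prem 0 .concl s => some (.top .concl (.L :: s))
  | .pair _ _, .prem 1 .concl s => some (.top .concl (.R :: s))
  | .letPair D E _ _, .top (.hyp z) s =>
      if z ∈ D then some (.prem 0 (.hyp z) s)
      else if z ∈ E then some (.prem 1 (.hyp z) s) else none
  | .letPair D _ _ _, .prem 0 (.hyp z) s => if z ∈ D then some (.top (.hyp z) s) else none
  | .letPair _ E x y, .prem 1 (.hyp z) s =>
      if z = x then some (.prem 0 .concl (.L :: s))
      else if z = y then some (.prem 0 .concl (.R :: s))
      else if z ∈ E then some (.top (.hyp z) s) else none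
  | .letPair _ _ _ _, .top .concl s => some (.prem 1 .concl s)
  | .letPair _ _ _ _, .prem 1 .concl s => some (.top .concl s)
  | .letPair _ _ x _, .prem 0 .concl (.L :: s) => some (.prem 1 (.hyp x) s)
  | .letPair _ _ _ y, .prem 0 .concl (.R :: s) => some (.prem 1 (.hyp y) s)
  | .ite D _, .top (.hyp y) s => if y ∈ D then some (.prem 0 (.hyp y) s) else none
  | .ite D _, .prem 0 (.hyp y) s => if y ∈ D then some (.top (.hyp y) s) else none
  | _, _ => none

theorem Kind.link_symm {k : Kind} (hk : k.Valid) {p p' : Port} (h : k.link p = some p') :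
    k.link p' = some p := by
  unfold Kind.link at h
  split at h <;> (try split_ifs at h) <;> simp only [Option.some.injEq, reduceCtorEq] at h <;>
    subst h <;> simp_all [Kind.link, Kind.Valid, Finset.disjoint_left]
  all_goals aesop

section

variable {Δ₀ : Ctx} {M₀ : Tm} {A₀ : Ty} (π : Der Δ₀ M₀ A₀)

def Der.kindAt (q : Path) : Option Kind := (π.sub q).map fun N => N.der.kind

variable {π}

theorem Der.kindAt_of_sub {q : Path} {N : Node} (h : π.sub q = some N) :
    π.kindAt q = some N.der.kind := by
  simp [Der.kindAt, h]

theorem Der.kindAt_valid {q : Path} {k : Kind} (h : π.kindAt q = some k) : k.Valid := by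
  simp only [Der.kindAt, Option.map_eq_some_iff] at h
  obtain ⟨N, -, rfl⟩ := h
  exact N.der.kind_valid

theorem Der.sub_append (q p : Path) :
    π.sub (q ++ p) = (π.sub q).bind fun N => N.der.sub p := by
  suffices H : ∀ {Δ : Ctx} {M : Tm} {A : Ty} (d : Der Δ M A),
      d.sub (q ++ p) = (d.sub q).bind fun N => N.der.sub p from H π
  induction q with
  | nil => intro _ _ _ d; simp [Der.sub]
  | cons i q ih =>
    intro _ _ _ d
    simp only [List.cons_append, Der.sub]
    cases d.premise i with
    | none => simp
    | some N => simp [ih]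

theorem Der.sub_snoc {q : Path} {N : Node} (h : π.sub q = some N) (i : ℕ) :
    π.sub (q ++ [i]) = N.der.premise i := by
  rw [Der.sub_append, h]
  simp only [Option.bind_some, Der.sub]
  cases N.der.premise i <;> rfl

theorem IsStar.kindAt {q : Path} (h : IsStar π q) : π.kindAt q = some .star := by
  obtain ⟨_, _, h⟩ := h
  exact Der.kindAt_of_sub h

theorem IsLetStar.kindAt {q : Path} (h : IsLetStar π q) :
    ∃ D E, π.kindAt q = some (.letStar D E) := by
  obtain ⟨Δ, Γ, _, _, _, _, _, _, _, _, h⟩ := h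
  exact ⟨_, _, Der.kindAt_of_sub h⟩

theorem IsIte.kindAt {q : Path} {Γ : Ctx} (h : IsIte π q Γ) :
    ∃ D, π.kindAt q = some (.ite D (Ctx.dom Γ)) := by
  obtain ⟨Δ, _, _, _, _, _, _, _, _, _, _, h⟩ := h
  exact ⟨_, Der.kindAt_of_sub h⟩

theorem IsOp.kindAt {q : Path} {c : Op} (h : IsOp π q c) : π.kindAt q = some (.op c) := by
  obtain ⟨_, _, h⟩ := h
  exact Der.kindAt_of_sub h

theorem isStar_of_kindAt {q : Path} (h : π.kindAt q = some .star) : IsStar π q := by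
  simp only [Der.kindAt, Option.map_eq_some_iff] at h
  obtain ⟨⟨_, _, _, d⟩, h, hk⟩ := h
  cases d <;> simp [Der.kind] at hk
  exact ⟨_, _, h⟩

theorem isLetStar_of_kindAt {q : Path} {D E : Finset Var}
    (h : π.kindAt q = some (.letStar D E)) : IsLetStar π q := by
  simp only [Der.kindAt, Option.map_eq_some_iff] at h
  obtain ⟨⟨_, _, _, d⟩, h, hk⟩ := h
  cases d <;> simp [Der.kind] at hk
  exact ⟨_, _, _, _, _, _, _, _, _, _, h⟩

theorem isIte_of_kindAt {q : Path} {D E : Finset Var} (h : π.kindAt q = some (.ite D E)) :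
    ∃ Γ, E = Ctx.dom Γ ∧ IsIte π q Γ := by
  simp only [Der.kindAt, Option.map_eq_some_iff] at h
  obtain ⟨⟨_, _, _, d⟩, h, hk⟩ := h
  cases d <;> simp [Der.kind] at hk
  exact ⟨_, hk.2.symm, _, _, _, _, _, _, _, _, _, _, _, h⟩

theorem isOp_of_kindAt {q : Path} {c : Op} (h : π.kindAt q = some (.op c)) : IsOp π q c := by
  simp only [Der.kindAt, Option.map_eq_some_iff] at h
  obtain ⟨⟨_, _, _, d⟩, h, hk⟩ := h
  cases d <;> simp [Der.kind] at hk
  subst hk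
  exact ⟨_, _, h⟩

/-! ### Occurrences of atoms -/

theorem occursAt_concl {q : Path} {N : Node} (h : π.sub q = some N) {s : List Dir} {a : Atom}
    {e : Bool} : OccursAt π ⟨q, .concl, s⟩ a e ↔ N.ty.atomAt s = some (a, e) := by
  simp [OccursAt, h]

theorem occursAt_hyp {q : Path} {N : Node} (h : π.sub q = some N) {s : List Dir} {a : Atom}
    {e : Bool} {x : Var} :
    OccursAt π ⟨q, .hyp x, s⟩ a e ↔ ∃ A, (x, A) ∈ N.ctx ∧ A.atomAt s = some (a, !e) := by
  simp [OccursAt, h]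

theorem Ctx.mem_dom {Δ : Ctx} {x : Var} : x ∈ Ctx.dom Δ ↔ ∃ A, (x, A) ∈ Δ := by
  simp [Ctx.dom]

theorem Ctx.mem_dom_of_mem {Δ : Ctx} {x : Var} {A : Ty} (h : (x, A) ∈ Δ) : x ∈ Ctx.dom Δ :=
  Ctx.mem_dom.2 ⟨A, h⟩

/-- Every variable has at most one type in the context. -/
def Ctx.Functional (Δ : Ctx) : Prop :=
  ∀ (x : Var) (B C : Ty), (x, B) ∈ Δ → (x, C) ∈ Δ → B = C

theorem Ctx.Functional.union {Δ Γ : Ctx} (hd : Disjoint (Ctx.dom Δ) (Ctx.dom Γ))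
    (h₁ : Δ.Functional) (h₂ : Γ.Functional) : Ctx.Functional (Δ ∪ Γ) := by
  intro x B C hB hC
  rw [Finset.disjoint_left] at hd
  rcases Finset.mem_union.1 hB with hB | hB <;> rcases Finset.mem_union.1 hC with hC | hC
  · exact h₁ _ _ _ hB hC
  · exact absurd (Ctx.mem_dom_of_mem hC) (hd (Ctx.mem_dom_of_mem hB))
  · exact absurd (Ctx.mem_dom_of_mem hB) (hd (Ctx.mem_dom_of_mem hC))
  · exact h₂ _ _ _ hB hC

theorem Der.ctx_functional {Δ : Ctx} {M : Tm} {A : Ty} (d : Der Δ M A) : Δ.Functional := by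
  induction d with
  | var x A h => subst h; intro y B C; simp_all
  | lam x A h hx d ih =>
    subst h
    intro y B C hB hC
    exact ih y B C (Finset.mem_insert_of_mem hB) (Finset.mem_insert_of_mem hC)
  | app h hd _ _ ih₀ ih₁ => subst h; exact .union hd ih₀ ih₁
  | star h => subst h; simp [Ctx.Functional]
  | letStar h hd _ _ ih₀ ih₁ => subst h; exact .union hd ih₀ ih₁
  | pair h hd _ _ ih₀ ih₁ => subst h; exact .union hd ih₀ ih₁
  | letPair x y A B h hd h' hxy hx hy _ _ ih₀ ih₁ =>
    subst h
    refine .union hd ih₀ fun z B C hB hC => ih₁ z B C ?_ ?_ <;> simp [h', hB, hC]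
  | ite h hd _ _ _ ih₀ ih₁ _ => subst h; exact .union hd ih₀ ih₁
  | op c h => subst h; simp [Ctx.Functional]

theorem Ctx.mem_union_left_iff {Δ Γ : Ctx} (hd : Disjoint (Ctx.dom Δ) (Ctx.dom Γ)) {x : Var}
    (hx : x ∈ Ctx.dom Δ) (A : Ty) : (x, A) ∈ Δ ∪ Γ ↔ (x, A) ∈ Δ := by
  rw [Finset.mem_union, or_iff_left]
  exact fun h => Finset.disjoint_left.1 hd hx (Ctx.mem_dom_of_mem h)

theorem Ctx.mem_union_right_iff {Δ Γ : Ctx} (hd : Disjoint (Ctx.dom Δ) (Ctx.dom Γ)) {x : Var}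
    (hx : x ∈ Ctx.dom Γ) (A : Ty) : (x, A) ∈ Δ ∪ Γ ↔ (x, A) ∈ Γ := by
  rw [Finset.mem_union, or_iff_right]
  exact fun h => Finset.disjoint_right.1 hd hx (Ctx.mem_dom_of_mem h)

theorem Ctx.mem_insert_iff_of_mem {Δ : Ctx} {x y : Var} {A : Ty} (hx : x ∉ Ctx.dom Δ)
    (hy : y ∈ Ctx.dom Δ) (B : Ty) : (y, B) ∈ (insert (x, A) Δ : Ctx) ↔ (y, B) ∈ Δ := by
  rw [Finset.mem_insert, or_iff_right]
  rintro h
  simp only [Prod.mk.injEq] at h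
  exact hx (h.1 ▸ hy)

theorem Ctx.mem_insert_self_iff {Δ : Ctx} {x : Var} {A : Ty} (hx : x ∉ Ctx.dom Δ) (B : Ty) :
    (x, B) ∈ (insert (x, A) Δ : Ctx) ↔ B = A := by
  rw [Finset.mem_insert, or_iff_left fun h => hx (Ctx.mem_dom_of_mem h)]
  simp

theorem Ctx.mem_insert_insert_iff {Δ : Ctx} {x y : Var} {A B : Ty} (hxy : x ≠ y)
    (hx : x ∉ Ctx.dom Δ) (hy : y ∉ Ctx.dom Δ) :
    (∀ C, (x, C) ∈ (insert (x, A) (insert (y, B) Δ) : Ctx) ↔ C = A) ∧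
    (∀ C, (y, C) ∈ (insert (x, A) (insert (y, B) Δ) : Ctx) ↔ C = B) ∧
    ∀ z ∈ Ctx.dom Δ, ∀ C, (z, C) ∈ (insert (x, A) (insert (y, B) Δ) : Ctx) ↔ (z, C) ∈ Δ := by
  have hx' : ∀ C, (x, C) ∉ Δ := fun C h => hx (Ctx.mem_dom_of_mem h)
  have hy' : ∀ C, (y, C) ∉ Δ := fun C h => hy (Ctx.mem_dom_of_mem h)
  refine ⟨fun C => ?_, fun C => ?_, fun z hz C => ?_⟩
  · simp [hxy, hx']
  · simp [hxy.symm, hy']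
  · have h₁ : z ≠ x := fun h => hx (h ▸ hz)
    have h₂ : z ≠ y := fun h => hy (h ▸ hz)
    simp [h₁, h₂]

theorem OccursAt.unique {p : Pos} {a a' : Atom} {e e' : Bool} (h : OccursAt π p a e)
    (h' : OccursAt π p a' e') : a = a' ∧ e = e' := by
  obtain ⟨q, σ, s⟩ := p
  obtain ⟨N, hN, h₁⟩ := h
  have h : OccursAt π ⟨q, σ, s⟩ a e := ⟨N, hN, h₁⟩
  cases σ with
  | concl =>
    have := ((occursAt_concl hN).1 h).symm.trans ((occursAt_concl hN).1 h')
    simpa using this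
  | hyp x =>
    obtain ⟨A, hA, h₁⟩ := (occursAt_hyp hN).1 h
    obtain ⟨B, hB, h₂⟩ := (occursAt_hyp hN).1 h'
    obtain rfl := N.der.ctx_functional _ _ _ hA hB
    have := h₁.symm.trans h₂
    simpa using this

theorem not_isPos_of_isNeg {a : Pos} (h : IsNeg π a) (h' : IsPos π a) : False := by
  obtain ⟨_, h⟩ := h
  obtain ⟨_, h'⟩ := h'
  exact absurd (h.unique h').2 (by simp)

theorem Ty.atomAt_lolli_left {A B : Ty} {s : List Dir} {a : Atom} {e : Bool} :
    (Ty.lolli A B).atomAt (.L :: s) = some (a, e) ↔ A.atomAt s = some (a, !e) := by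
  cases e <;> simp [Ty.atomAt]

theorem Ty.atomAt_lolli_right {A B : Ty} {s : List Dir} :
    (Ty.lolli A B).atomAt (.R :: s) = B.atomAt s := by
  simp [Ty.atomAt]

theorem Ty.atomAt_tensor_left {A B : Ty} {s : List Dir} :
    (Ty.tensor A B).atomAt (.L :: s) = A.atomAt s := by
  simp [Ty.atomAt]

theorem Ty.atomAt_tensor_right {A B : Ty} {s : List Dir} :
    (Ty.tensor A B).atomAt (.R :: s) = B.atomAt s := by
  simp [Ty.atomAt]

variable (π) in
/-- A port carries an atom; the flag tells whether tokens reach the rule (`true`) or leave the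
rule (`false`) through this port. -/
def Port.Carries (q : Path) : Port → Atom → Bool → Prop
  | .top σ s, a, e => OccursAt π ⟨q, σ, s⟩ a !e
  | .prem i σ s, a, e => OccursAt π ⟨q ++ [i], σ, s⟩ a e

set_option maxHeartbeats 2000000 in
theorem Port.Carries.link {q : Path} {k : Kind} (hk : π.kindAt q = some k) {p p' : Port}
    (h : k.link p = some p') {a : Atom} {e : Bool} (hp : p.Carries π q a e) :
    p'.Carries π q a !e := by
  simp only [Der.kindAt, Option.map_eq_some_iff] at hk
  obtain ⟨⟨_, _, _, d⟩, hq, rfl⟩ := hk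
  have hprem := Der.sub_snoc hq
  cases d with
  | var x A hΞ =>
    subst hΞ
    unfold Der.kind Kind.link at h
    split at h <;> (first | contradiction | skip) <;> rename_i heq <;> cases heq <;>
      (try split_ifs at h) <;> cases h <;>
      simp_all [Port.Carries, occursAt_hyp hq, occursAt_concl hq]
  | star | op => simp [Der.kind, Kind.link] at h
  | lam x A hΞ hx d =>
    subst hΞ
    have h0 := hprem 0
    unfold Der.kind Kind.link at h
    split at h <;> (first | contradiction | skip) <;> rename_i heq <;> cases heq <;>
      (try split_ifs at h) <;> cases h <;>
      simp_all [Port.Carries, occursAt_hyp hq, occursAt_concl hq, occursAt_hyp h0,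
        occursAt_concl h0, Ctx.mem_insert_iff_of_mem hx, Ctx.mem_insert_self_iff hx,
        Ty.atomAt_lolli_left, Ty.atomAt_lolli_right, -Finset.mem_insert]
  | app hΞ hd d₀ d₁ =>
    subst hΞ
    have h0 := hprem 0
    have h1 := hprem 1
    unfold Der.kind Kind.link at h
    split at h <;> (first | contradiction | skip) <;> rename_i heq <;> cases heq <;>
      (try split_ifs at h) <;> cases h <;>
      simp_all [Port.Carries, occursAt_hyp hq, occursAt_concl hq, occursAt_hyp h0,
        occursAt_concl h0, occursAt_hyp h1, occursAt_concl h1, Ty.atomAt_lolli_left,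
        Ty.atomAt_lolli_right, Ty.atomAt_tensor_left, Ty.atomAt_tensor_right,
        Ctx.mem_union_left_iff hd, Ctx.mem_union_right_iff hd, -Finset.mem_union,
        -Finset.mem_insert]
  | letStar hΞ hd d₀ d₁ =>
    subst hΞ
    have h0 := hprem 0
    have h1 := hprem 1
    unfold Der.kind Kind.link at h
    split at h <;> (first | contradiction | skip) <;> rename_i heq <;> cases heq <;>
      (try split_ifs at h) <;> cases h <;>
      simp_all [Port.Carries, occursAt_hyp hq, occursAt_concl hq, occursAt_hyp h0,
        occursAt_concl h0, occursAt_hyp h1, occursAt_concl h1, Ty.atomAt_lolli_left,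
        Ty.atomAt_lolli_right, Ty.atomAt_tensor_left, Ty.atomAt_tensor_right,
        Ctx.mem_union_left_iff hd, Ctx.mem_union_right_iff hd, -Finset.mem_union,
        -Finset.mem_insert]
  | pair hΞ hd d₀ d₁ =>
    subst hΞ
    have h0 := hprem 0
    have h1 := hprem 1
    unfold Der.kind Kind.link at h
    split at h <;> (first | contradiction | skip) <;> rename_i heq <;> cases heq <;>
      (try split_ifs at h) <;> cases h <;>
      simp_all [Port.Carries, occursAt_hyp hq, occursAt_concl hq, occursAt_hyp h0,
        occursAt_concl h0, occursAt_hyp h1, occursAt_concl h1, Ty.atomAt_lolli_left,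
        Ty.atomAt_lolli_right, Ty.atomAt_tensor_left, Ty.atomAt_tensor_right,
        Ctx.mem_union_left_iff hd, Ctx.mem_union_right_iff hd, -Finset.mem_union,
        -Finset.mem_insert]
  | ite hΞ hd d₀ d₁ d₂ =>
    subst hΞ
    have h0 := hprem 0
    have h1 := hprem 1
    unfold Der.kind Kind.link at h
    split at h <;> (first | contradiction | skip) <;> rename_i heq <;> cases heq <;>
      (try split_ifs at h) <;> cases h <;>
      simp_all [Port.Carries, occursAt_hyp hq, occursAt_concl hq, occursAt_hyp h0,
        occursAt_concl h0, occursAt_hyp h1, occursAt_concl h1, Ty.atomAt_lolli_left,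
        Ty.atomAt_lolli_right, Ty.atomAt_tensor_left, Ty.atomAt_tensor_right,
        Ctx.mem_union_left_iff hd, Ctx.mem_union_right_iff hd, -Finset.mem_union,
        -Finset.mem_insert]
  | letPair x y A B hΞ hd hΓ' hxy hx hy d₀ d₁ =>
    subst hΞ hΓ'
    have h0 := hprem 0
    have h1 := hprem 1
    obtain ⟨hX, hY, hZ⟩ := Ctx.mem_insert_insert_iff (A := A) (B := B) hxy hx hy
    unfold Der.kind Kind.link at h
    split at h <;> (first | contradiction | skip) <;> rename_i heq <;> cases heq <;>
      (try split_ifs at h) <;> cases h <;> (try subst_vars) <;>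
      simp_all [Port.Carries, occursAt_hyp hq, occursAt_concl hq, occursAt_hyp h0,
        occursAt_concl h0, occursAt_hyp h1, occursAt_concl h1,
        Ty.atomAt_tensor_left, Ty.atomAt_tensor_right,
        Ctx.mem_union_left_iff hd, Ctx.mem_union_right_iff hd, -Finset.mem_union,
        -Finset.mem_insert]

end


section

variable {Δ₀ : Ctx} {M₀ : Tm} {A₀ : Ty} {π : Der Δ₀ M₀ A₀}

/-! ### Structural moves in terms of ports -/

theorem VertLink.link {a b : Pos} (h : VertLink π a b) :
    ∃ (q : Path) (k : Kind) (σ : Slot) (s : List Dir) (i : ℕ) (σ' : Slot) (s' : List Dir),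
      π.kindAt q = some k ∧ a = ⟨q, σ, s⟩ ∧ b = ⟨q ++ [i], σ', s'⟩ ∧
        k.link (.top σ s) = some (.prem i σ' s') := by
  cases h <;> rename_i h <;>
    refine ⟨_, _, _, _, _, _, _, Der.kindAt_of_sub ‹π.sub _ = _›, rfl, rfl, ?_⟩ <;>
    first
    | simp [Der.kind, Kind.link, Finset.disjoint_right.1 ‹Disjoint _ _›, *]
    | simp [Der.kind, Kind.link, *]

theorem CutLink.link {a b : Pos} (h : CutLink π a b) :
    ∃ (q : Path) (k : Kind) (i : ℕ) (σ : Slot) (s : List Dir) (j : ℕ) (σ' : Slot)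
      (s' : List Dir),
      π.kindAt q = some k ∧ a = ⟨q ++ [i], σ, s⟩ ∧ b = ⟨q ++ [j], σ', s'⟩ ∧
        k.link (.prem i σ s) = some (.prem j σ' s') := by
  cases h <;> refine ⟨_, _, _, _, _, _, _, _, Der.kindAt_of_sub ‹π.sub _ = _›, rfl, rfl, ?_⟩ <;>
    simp [Der.kind, Kind.link]

theorem AxLink.link {a b : Pos} (h : AxLink π a b) :
    ∃ (q : Path) (k : Kind) (σ : Slot) (s : List Dir) (σ' : Slot) (s' : List Dir),
      π.kindAt q = some k ∧ a = ⟨q, σ, s⟩ ∧ b = ⟨q, σ', s'⟩ ∧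
        k.link (.top σ s) = some (.top σ' s') := by
  cases h
  refine ⟨_, _, _, _, _, _, Der.kindAt_of_sub ‹π.sub _ = _›, rfl, rfl, ?_⟩
  simp [Der.kind, Kind.link]

theorem Move.link {a b : Pos} (h : Move π a b) :
    ∃ (q : Path) (k : Kind) (p p' : Port) (c : Atom), π.kindAt q = some k ∧
      k.link p = some p' ∧ p.Carries π q c true ∧ a = p.place q ∧ b = p'.place q := by
  cases h with
  | up h hn =>
    obtain ⟨q, k, σ, s, i, σ', s', hk, rfl, rfl, hl⟩ := h.link
    exact ⟨q, k, _, _, hn.choose, hk, hl, by simpa [Port.Carries] using hn.choose_spec, rfl, rfl⟩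
  | down h hn =>
    obtain ⟨q, k, σ, s, i, σ', s', hk, rfl, rfl, hl⟩ := h.link
    exact ⟨q, k, _, _, hn.choose, hk, Kind.link_symm (Der.kindAt_valid hk) hl,
      by simpa [Port.Carries] using hn.choose_spec, rfl, rfl⟩
  | cutRight h hn =>
    obtain ⟨q, k, i, σ, s, j, σ', s', hk, rfl, rfl, hl⟩ := h.link
    exact ⟨q, k, _, _, hn.choose, hk, hl, by simpa [Port.Carries] using hn.choose_spec, rfl, rfl⟩
  | cutLeft h hn =>
    obtain ⟨q, k, i, σ, s, j, σ', s', hk, rfl, rfl, hl⟩ := h.link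
    exact ⟨q, k, _, _, hn.choose, hk, Kind.link_symm (Der.kindAt_valid hk) hl,
      by simpa [Port.Carries] using hn.choose_spec, rfl, rfl⟩
  | axRight h hn =>
    obtain ⟨q, k, σ, s, σ', s', hk, rfl, rfl, hl⟩ := h.link
    exact ⟨q, k, _, _, hn.choose, hk, hl, by simpa [Port.Carries] using hn.choose_spec, rfl, rfl⟩
  | axLeft h hn =>
    obtain ⟨q, k, σ, s, σ', s', hk, rfl, rfl, hl⟩ := h.link
    exact ⟨q, k, _, _, hn.choose, hk, Kind.link_symm (Der.kindAt_valid hk) hl,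
      by simpa [Port.Carries] using hn.choose_spec, rfl, rfl⟩

theorem vertLink_of_link {q : Path} {k : Kind} (hk : π.kindAt q = some k) {σ σ' : Slot}
    {s s' : List Dir} {i : ℕ} (h : k.link (.top σ s) = some (.prem i σ' s')) :
    VertLink π ⟨q, σ, s⟩ ⟨q ++ [i], σ', s'⟩ := by
  simp only [Der.kindAt, Option.map_eq_some_iff] at hk
  obtain ⟨⟨_, _, _, d⟩, hq, rfl⟩ := hk
  cases d <;> rcases σ with y | _ <;> (try rcases s with _ | ⟨_ | _, s⟩) <;>
    simp only [Der.kind, Kind.link, reduceCtorEq] at h <;> (try split_ifs at h) <;> cases h <;>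
    first
    | exact .lamCtx _ hq ‹_›
    | exact .lamVar _ hq
    | exact .lamBody _ hq
    | exact .appLeft _ hq ‹_›
    | exact .appRight _ hq ‹_›
    | exact .appConcl _ hq
    | exact .letStarLeft _ hq ‹_›
    | exact .letStarRight _ hq ‹_›
    | exact .letStarConcl _ hq
    | exact .pairLeft _ hq ‹_›
    | exact .pairRight _ hq ‹_›
    | exact .pairFst _ hq
    | exact .pairSnd _ hq
    | exact .letPairLeft _ hq ‹_›
    | exact .letPairRight _ hq ‹_›
    | exact .letPairConcl _ hq
    | exact .iteGuard _ hq ‹_›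

theorem cutLink_of_link {q : Path} {k : Kind} (hk : π.kindAt q = some k) {σ σ' : Slot}
    {s s' : List Dir} {i j : ℕ} (h : k.link (.prem i σ s) = some (.prem j σ' s')) :
    CutLink π ⟨q ++ [i], σ, s⟩ ⟨q ++ [j], σ', s'⟩ ∨
      CutLink π ⟨q ++ [j], σ', s'⟩ ⟨q ++ [i], σ, s⟩ := by
  simp only [Der.kindAt, Option.map_eq_some_iff] at hk
  obtain ⟨⟨_, _, _, d⟩, hq, rfl⟩ := hk
  unfold Kind.link at h
  split at h <;> (first | contradiction | skip) <;> rename_i hp hd <;>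
    (try split_ifs at h) <;> cases h <;> cases hd <;> cases d <;>
    simp only [Der.kind, Kind.app.injEq, Kind.letPair.injEq, reduceCtorEq] at hp <;>
    first
    | exact .inl (.app _ hq)
    | exact .inr (.app _ hq)
    | (obtain ⟨-, -, rfl, rfl⟩ := hp; subst_vars
       first
       | exact .inl (.letPairFst _ hq)
       | exact .inl (.letPairSnd _ hq)
       | exact .inr (.letPairFst _ hq)
       | exact .inr (.letPairSnd _ hq))

theorem axLink_of_link {q : Path} {k : Kind} (hk : π.kindAt q = some k) {σ σ' : Slot}
    {s s' : List Dir} (h : k.link (.top σ s) = some (.top σ' s')) :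
    AxLink π ⟨q, σ, s⟩ ⟨q, σ', s'⟩ ∨ AxLink π ⟨q, σ', s'⟩ ⟨q, σ, s⟩ := by
  simp only [Der.kindAt, Option.map_eq_some_iff] at hk
  obtain ⟨⟨_, _, _, d⟩, hq, rfl⟩ := hk
  unfold Kind.link at h
  split at h <;> (first | contradiction | skip) <;> rename_i hp hd <;>
    (try split_ifs at h) <;> cases h <;> cases hd <;> cases d <;>
    simp only [Der.kind, Kind.var.injEq, reduceCtorEq] at hp <;> subst_vars <;>
    first
    | exact .inl (.var _ hq)
    | exact .inr (.var _ hq)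

theorem move_of_link {q : Path} {k : Kind} (hk : π.kindAt q = some k) {p p' : Port}
    (h : k.link p = some p') {c : Atom} (hc : p.Carries π q c true) :
    Move π (p.place q) (p'.place q) := by
  have hc' := hc.link hk h
  have hs := Kind.link_symm (Der.kindAt_valid hk) h
  cases p <;> cases p'
  · rcases axLink_of_link hk h with h | h
    · exact .axRight h ⟨_, hc⟩
    · exact .axLeft h ⟨_, hc⟩
  · exact .up (vertLink_of_link hk h) ⟨_, hc⟩
  · exact .down (vertLink_of_link hk hs) ⟨_, hc⟩
  · rcases cutLink_of_link hk h with h | h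
    · exact .cutRight h ⟨_, hc⟩
    · exact .cutLeft h ⟨_, hc⟩

/-! ### The rule that acts on a position -/

variable (π) in
/-- Tokens in the position `a` are about to reach the rule at the node `q`. -/
def Inp (q : Path) (a : Pos) : Prop :=
  (a.node = q ∧ IsNeg π a) ∨ ∃ i, a.node = q ++ [i] ∧ IsPos π a

variable (π) in
/-- Tokens in the position `a` have just left the rule at the node `q`. -/
def Out (q : Path) (a : Pos) : Prop :=
  (a.node = q ∧ IsPos π a) ∨ ∃ i, a.node = q ++ [i] ∧ IsNeg π a

theorem Inp.unique {q q' : Path} {a : Pos} (h : Inp π q a) (h' : Inp π q' a) : q = q' := by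
  rcases h with ⟨h, hn⟩ | ⟨i, h, hn⟩ <;> rcases h' with ⟨h', hn'⟩ | ⟨j, h', hn'⟩
  · exact h.symm.trans h'
  · exact (not_isPos_of_isNeg hn hn').elim
  · exact (not_isPos_of_isNeg hn' hn).elim
  · exact (List.append_inj' (h.symm.trans h') rfl).1

theorem Out.unique {q q' : Path} {a : Pos} (h : Out π q a) (h' : Out π q' a) : q = q' := by
  rcases h with ⟨h, hn⟩ | ⟨i, h, hn⟩ <;> rcases h' with ⟨h', hn'⟩ | ⟨j, h', hn'⟩
  · exact h.symm.trans h'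
  · exact (not_isPos_of_isNeg hn' hn).elim
  · exact (not_isPos_of_isNeg hn hn').elim
  · exact (List.append_inj' (h.symm.trans h') rfl).1

theorem Port.Carries.inp {q : Path} {p : Port} {c : Atom} (h : p.Carries π q c true) :
    Inp π q (p.place q) := by
  cases p
  · exact .inl ⟨rfl, _, h⟩
  · exact .inr ⟨_, rfl, _, h⟩

theorem Port.Carries.out {q : Path} {p : Port} {c : Atom} (h : p.Carries π q c false) :
    Out π q (p.place q) := by
  cases p
  · exact .inl ⟨rfl, _, h⟩
  · exact .inr ⟨_, rfl, _, h⟩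

theorem Port.Carries.occursAt {q : Path} {p : Port} {c : Atom} {e : Bool}
    (h : p.Carries π q c e) : ∃ e', OccursAt π (p.place q) c e' := by
  cases p <;> exact ⟨_, h⟩

/-- A port of a rule at which no structural link starts. -/
inductive Kind.Special : Kind → Port → Prop
  | star (σ : Slot) (s : List Dir) : Special .star (.top σ s)
  | op (c : Op) (σ : Slot) (s : List Dir) : Special (.op c) (.top σ s)
  | letStar (D E : Finset Var) : Special (.letStar D E) (.prem 0 .concl [])
  | guard (D E : Finset Var) : Special (.ite D E) (.prem 0 .concl [])
  | shared (D E : Finset Var) (σ : Slot) (s : List Dir) (hσ : ∀ y, σ = .hyp y → y ∈ E) :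
      Special (.ite D E) (.top σ s)
  | branch (D E : Finset Var) (b : Bool) (σ : Slot) (s : List Dir) :
      Special (.ite D E) (.prem (if b then 2 else 1) σ s)

theorem Kind.Special.link_eq_none {k : Kind} (hk : k.Valid) {p : Port} (h : k.Special p) :
    k.link p = none := by
  cases h with
  | shared D E σ s hσ =>
    cases σ with
    | concl => rfl
    | hyp y => simp [Kind.link, Finset.disjoint_right.1 hk (hσ y rfl)]
  | branch D E b σ s => cases b <;> simp [Kind.link]
  | _ => simp [Kind.link]

end


section

variable {Δ₀ : Ctx} {M₀ : Tm} {A₀ : Ty} {π : Der Δ₀ M₀ A₀}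

theorem kindAt_ite_unique {q : Path} {D E : Finset Var} (h : π.kindAt q = some (.ite D E))
    {Γ : Ctx} (h' : IsIte π q Γ) : E = Ctx.dom Γ := by
  obtain ⟨D', h'⟩ := h'.kindAt
  have := h.symm.trans h'
  simp_all

theorem branchSlot_iff {Γ : Ctx} {σ : Slot} :
    BranchSlot Γ σ ↔ ∀ y, σ = .hyp y → y ∈ Ctx.dom Γ := by
  cases σ <;> simp [BranchSlot]

theorem occursAt_guardPos {q : Path} {Γ : Ctx} (h : IsIte π q Γ) :
    OccursAt π (guardPos q) (.base .bit) true := by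
  obtain ⟨Δ, _, _, _, _, _, _, _, _, _, _, h⟩ := h
  exact (occursAt_concl (Der.sub_snoc h 0)).2 rfl

theorem occursAt_letStar {q : Path} (h : IsLetStar π q) :
    OccursAt π ⟨q ++ [0], .concl, []⟩ .one true := by
  obtain ⟨Δ, Γ, _, _, _, _, _, _, _, _, h⟩ := h
  exact (occursAt_concl (Der.sub_snoc h 0)).2 rfl

theorem occursAt_star {q : Path} (h : IsStar π q) : OccursAt π ⟨q, .concl, []⟩ .one true := by
  obtain ⟨_, _, h⟩ := h
  exact (occursAt_concl h).2 rfl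

theorem occursAt_branch {q : Path} {Γ : Ctx} (h : IsIte π q Γ) {b : Bool} {σ : Slot}
    {s : List Dir} {a : Atom} {e : Bool} :
    OccursAt π ⟨branch q b, σ, s⟩ a e ↔ BranchSlot Γ σ ∧ OccursAt π ⟨q, σ, s⟩ a e := by
  obtain ⟨Δ, _, _, _, _, _, rfl, hd, d₀, d₁, d₂, h⟩ := h
  have h₁ := Der.sub_snoc h 1
  have h₂ := Der.sub_snoc h 2
  cases σ with
  | concl =>
    cases b <;> simp [branch, occursAt_concl h, occursAt_concl h₁, occursAt_concl h₂, BranchSlot]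
  | hyp y =>
    have : (∃ A, (y, A) ∈ Γ ∧ A.atomAt s = some (a, !e)) ↔
        y ∈ Ctx.dom Γ ∧ ∃ A, (y, A) ∈ Δ ∪ Γ ∧ A.atomAt s = some (a, !e) := by
      constructor
      · rintro ⟨A, hA, hs⟩
        exact ⟨Ctx.mem_dom_of_mem hA, A, Finset.mem_union_right _ hA, hs⟩
      · rintro ⟨hy, A, hA, hs⟩
        exact ⟨A, (Ctx.mem_union_right_iff hd hy A).1 hA, hs⟩
    cases b <;> simp [branch, occursAt_hyp h, occursAt_hyp h₁, occursAt_hyp h₂, BranchSlot, this]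

theorem exists_kindAt_of_occursAt {a : Pos} {c : Atom} {e : Bool} (h : OccursAt π a c e) :
    ∃ k, π.kindAt a.node = some k := by
  obtain ⟨N, hN, -⟩ := h
  exact ⟨_, Der.kindAt_of_sub hN⟩

theorem Der.sub_prefix {q : Path} {i : ℕ} {N : Node} (h : π.sub (q ++ [i]) = some N) :
    ∃ N', π.sub q = some N' := by
  rw [Der.sub_append] at h
  cases hq : π.sub q <;> simp_all

theorem Inp.exists_kindAt {q : Path} {a : Pos} (h : Inp π q a) : ∃ k, π.kindAt q = some k := by
  rcases h with ⟨rfl, c, h⟩ | ⟨i, hi, c, N, hN, -⟩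
  · exact exists_kindAt_of_occursAt h
  · rw [hi] at hN
    obtain ⟨N', h⟩ := Der.sub_prefix hN
    exact ⟨_, Der.kindAt_of_sub h⟩

set_option maxHeartbeats 1000000 in
theorem Port.Carries.link_or_special {q : Path} {k : Kind} (hk : π.kindAt q = some k) {p : Port}
    {a : Atom} {e : Bool} (hp : p.Carries π q a e) : (∃ p', k.link p = some p') ∨ k.Special p := by
  simp only [Der.kindAt, Option.map_eq_some_iff] at hk
  obtain ⟨⟨_, _, _, d⟩, hq, rfl⟩ := hk
  have mem_union : ∀ {Δ Γ : Ctx} {x : Var} {A : Ty}, (x, A) ∈ Δ ∪ Γ →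
      x ∈ Ctx.dom Δ ∨ x ∈ Ctx.dom Γ := fun h =>
    (Finset.mem_union.1 h).imp Ctx.mem_dom_of_mem Ctx.mem_dom_of_mem
  cases p with
  | top σ s =>
    simp only [Port.Carries] at hp
    cases d with
    | star => exact .inr (.star _ _)
    | op => exact .inr (.op _ _ _)
    | var x A hΞ =>
      left
      cases σ with
      | concl => exact ⟨_, rfl⟩
      | hyp y =>
        obtain ⟨B, hB, -⟩ := (occursAt_hyp hq).1 hp
        simp_all [Der.kind, Kind.link]
    | lam x A hΞ hx d =>
      left
      cases σ with
      | hyp y =>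
        obtain ⟨B, hB, -⟩ := (occursAt_hyp hq).1 hp
        simp [Der.kind, Kind.link, Ctx.mem_dom_of_mem hB]
      | concl =>
        rw [occursAt_concl hq] at hp
        rcases s with _ | ⟨_ | _, s⟩
        · simp [Ty.atomAt] at hp
        · exact ⟨_, rfl⟩
        · exact ⟨_, rfl⟩
    | pair hΞ hd d₀ d₁ =>
      left
      subst hΞ
      cases σ with
      | hyp y =>
        obtain ⟨B, hB, -⟩ := (occursAt_hyp hq).1 hp
        rcases mem_union hB with h | h <;> simp [Der.kind, Kind.link, h]
        split_ifs <;> simp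
      | concl =>
        rw [occursAt_concl hq] at hp
        rcases s with _ | ⟨_ | _, s⟩
        · simp [Ty.atomAt] at hp
        · exact ⟨_, rfl⟩
        · exact ⟨_, rfl⟩
    | app hΞ hd d₀ d₁ | letStar hΞ hd d₀ d₁ | letPair x y A B hΞ hd _ _ _ _ d₀ d₁ =>
      left
      subst hΞ
      cases σ with
      | hyp y =>
        obtain ⟨B, hB, -⟩ := (occursAt_hyp hq).1 hp
        rcases mem_union hB with h | h <;> simp [Der.kind, Kind.link, h]
        split_ifs <;> simp
      | concl => exact ⟨_, rfl⟩
    | ite hΞ hd d₀ d₁ d₂ =>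
      subst hΞ
      cases σ with
      | hyp y =>
        obtain ⟨B, hB, -⟩ := (occursAt_hyp hq).1 hp
        rcases mem_union hB with h | h
        · left; simp [Der.kind, Kind.link, h]
        · exact .inr (.shared _ _ _ _ (by simpa using h))
      | concl => exact .inr (.shared _ _ _ _ (by simp))
  | prem i σ s =>
    simp only [Port.Carries] at hp
    obtain ⟨N, hN, hp'⟩ := id hp
    have hN' := hN
    rw [Der.sub_snoc hq] at hN'
    cases d with
    | star => simp [Der.premise] at hN'
    | op => simp [Der.premise] at hN'
    | var => simp [Der.premise] at hN'
    | lam x A hΞ hx d =>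
      left
      obtain _ | i := i
      · cases hN'
        subst hΞ
        cases σ with
        | concl => exact ⟨_, rfl⟩
        | hyp y =>
          obtain ⟨B, hB, -⟩ := hp'
          rcases Finset.mem_insert.1 hB with h | h
          · simp only [Prod.mk.injEq] at h
            simp [Der.kind, Kind.link, h]
          · simp only [Der.kind, Kind.link, Ctx.mem_dom_of_mem h]
            split_ifs <;> simp
      · simp [Der.premise] at hN'
    | pair hΞ hd d₀ d₁ =>
      left
      obtain _ | _ | i := i
      iterate 2
        cases hN'
        cases σ with
        | concl => exact ⟨_, rfl⟩
        | hyp y =>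
          obtain ⟨B, hB, -⟩ := hp'
          simp [Der.kind, Kind.link, Ctx.mem_dom_of_mem hB]
      · simp [Der.premise] at hN'
    | app hΞ hd d₀ d₁ =>
      left
      obtain _ | _ | i := i
      iterate 2
        cases hN'
        cases σ with
        | concl =>
          rcases s with _ | ⟨_ | _, s⟩
          · first
            | exact ⟨_, rfl⟩
            | simp [Ty.atomAt] at hp'
          · exact ⟨_, rfl⟩
          · exact ⟨_, rfl⟩
        | hyp y =>
          obtain ⟨B, hB, -⟩ := hp'
          simp [Der.kind, Kind.link, Ctx.mem_dom_of_mem hB]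
      · simp [Der.premise] at hN'
    | letStar hΞ hd d₀ d₁ =>
      obtain _ | _ | i := i
      iterate 2
        cases hN'
        cases σ with
        | concl =>
          first
          | exact .inl ⟨_, rfl⟩
          | (rcases s with _ | ⟨_ | _, s⟩
             · exact .inr (.letStar _ _)
             · simp [Ty.atomAt] at hp'
             · simp [Ty.atomAt] at hp')
        | hyp y =>
          obtain ⟨B, hB, -⟩ := hp'
          simp [Der.kind, Kind.link, Ctx.mem_dom_of_mem hB]
      · simp [Der.premise] at hN'
    | letPair x y A B hΞ hd hΓ' hxy hx hy d₀ d₁ =>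
      left
      obtain _ | _ | i := i
      · cases hN'
        cases σ with
        | concl =>
          rcases s with _ | ⟨_ | _, s⟩
          · simp [Ty.atomAt] at hp'
          · exact ⟨_, rfl⟩
          · exact ⟨_, rfl⟩
        | hyp y =>
          obtain ⟨B, hB, -⟩ := hp'
          simp [Der.kind, Kind.link, Ctx.mem_dom_of_mem hB]
      · cases hN'
        subst hΓ'
        cases σ with
        | concl => exact ⟨_, rfl⟩
        | hyp z =>
          obtain ⟨B, hB, -⟩ := hp'
          simp only [Der.kind, Kind.link]
          split_ifs with h₁ h₂ h₃
          · simp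
          · simp
          · simp
          · simp only [Finset.mem_insert, Prod.mk.injEq, h₁, h₂, false_and, false_or] at hB
            exact absurd (Ctx.mem_dom_of_mem hB) h₃
      · simp [Der.premise] at hN'
    | ite hΞ hd d₀ d₁ d₂ =>
      obtain _ | _ | _ | i := i
      · cases hN'
        cases σ with
        | concl =>
          rcases s with _ | ⟨_ | _, s⟩
          · exact .inr (.guard _ _)
          · simp [Ty.atomAt] at hp'
          · simp [Ty.atomAt] at hp'
        | hyp y =>
          obtain ⟨B, hB, -⟩ := hp'
          simp [Der.kind, Kind.link, Ctx.mem_dom_of_mem hB]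
      · exact .inr (.branch _ _ false _ _)
      · exact .inr (.branch _ _ true _ _)
      · simp [Der.premise] at hN'

/-! ### Opened nodes -/

theorem prefix_snoc_iff {r q : Path} {i : ℕ} : r <+: q ++ [i] ↔ r = q ++ [i] ∨ r <+: q := by
  rw [← List.prefix_concat_iff]

theorem branch_eq_snoc {q q' : Path} {b : Bool} {i : ℕ} (h : branch q' b = q ++ [i]) :
    q' = q ∧ (if b then 2 else 1) = i := by
  simpa [branch] using List.append_inj' h rfl

theorem guardPos_injective {q q' : Path} (h : guardPos q = guardPos q') : q = q' := by
  simpa [guardPos] using h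

variable {r p q : Path} {G : Addr}

theorem Opened.of_prefix {p' : Path} (h : Opened π r p' G) (hp : p <+: p') : Opened π r p G :=
  fun q Γ b hr hi hb => h q Γ b hr hi (hb.trans hp)

theorem Opened.mono {G' : Addr} (h : Opened π r p G) (hG : G ⊆ G') : Opened π r p G' :=
  fun q Γ b hr hi hb => hG (h q Γ b hr hi hb)

theorem opened_self (G : Addr) : Opened π r r G := by
  intro q Γ b hr _ hb
  have h₁ := hr.length_le
  have h₂ := hb.length_le
  simp only [branch, List.length_append, List.length_singleton] at h₂
  omega

theorem Opened.snoc {i : ℕ} (h : Opened π r q G)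
    (hi : ∀ Γ b, r <+: q → IsIte π q Γ → (if b then 2 else 1) = i → (guardPos q, b) ∈ G) :
    Opened π r (q ++ [i]) G := by
  intro q' Γ b hr hq' hb
  rcases prefix_snoc_iff.1 hb with hb | hb
  · obtain ⟨rfl, hb'⟩ := branch_eq_snoc hb
    exact hi Γ b hr hq' hb'
  · exact h q' Γ b hr hq' hb

theorem Opened.branch {b : Bool} (h : Opened π r q G) (hb : (guardPos q, b) ∈ G) :
    Opened π r (branch q b) G := by
  refine h.snoc fun Γ b' _ _ hb' => ?_
  cases b <;> cases b' <;> simp_all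

theorem opened_guardPos_iff : Opened π r (guardPos q).node G ↔ Opened π r q G := by
  refine ⟨fun h => h.of_prefix (List.prefix_append _ _), fun h => h.snoc fun Γ b _ _ hb => ?_⟩
  cases b <;> simp at hb

theorem opened_place_iff {k : Kind} (hk : π.kindAt q = some k) {p p' : Port}
    (h : k.link p = some p') : Opened π r (p.place q).node G ↔ Opened π r q G := by
  cases p with
  | top => rfl
  | prem i σ s =>
    refine ⟨fun h => h.of_prefix (List.prefix_append _ _), fun ho => ho.snoc ?_⟩
    rintro Γ b - hi rfl
    obtain ⟨D, hD⟩ := hi.kindAt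
    obtain rfl : k = .ite D (Ctx.dom Γ) := by simpa [hk] using hD
    have := (Kind.Special.branch D (Ctx.dom Γ) b σ s).link_eq_none (Der.kindAt_valid hk)
    rw [this] at h
    cases h

theorem link_prem_ne {k : Kind} {i j : ℕ} {σ σ' : Slot} {s s' : List Dir}
    (h : k.link (.prem i σ s) = some (.prem j σ' s')) : i ≠ j := by
  unfold Kind.link at h
  split at h <;> (first | contradiction | skip) <;> rename_i hp hd <;>
    (try split_ifs at h) <;> cases h <;> cases hd <;> simp

theorem prefix_of_link {k : Kind} {p p' : Port} (h : k.link p = some p')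
    (hp : r <+: (p.place q).node) (hp' : r <+: (p'.place q).node) : r <+: q := by
  cases p with
  | top => exact hp
  | prem i σ s =>
    cases p' with
    | top => exact hp'
    | prem j σ' s' =>
      rcases prefix_snoc_iff.1 hp with hp | hp
      · rcases prefix_snoc_iff.1 hp' with hp' | hp'
        · have := hp.symm.trans hp'
          simp only [List.append_cancel_left_eq, List.cons.injEq, and_true] at this
          exact absurd this (link_prem_ne h)
        · exact hp'
      · exact hp

theorem prefix_place {p : Port} (h : r <+: q) : r <+: (p.place q).node := by
  cases p with
  | top => exact h
  | prem i σ s => exact h.trans (List.prefix_append _ _)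

end


/-! ### Extended circuits -/

/-- The labels at the inner nodes of an extended circuit. -/
def ECirc.labels : ECirc → Set Label
  | .leaf _ => ∅
  | .node _ l E₀ E₁ => insert l (E₀.labels ∪ E₁.labels)

/-- No label is read twice on a path from the root to a leaf. -/
def ECirc.Nodup : ECirc → Prop
  | .leaf _ => True
  | .node _ l E₀ E₁ => l ∉ E₀.labels ∧ l ∉ E₁.labels ∧ E₀.Nodup ∧ E₁.Nodup

theorem ECirc.mem_labels {E : ECirc} : ∀ {G : Addr}, G ∈ E.addrs → ∀ {l b}, (l, b) ∈ G →
    l ∈ E.labels := by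
  induction E with
  | leaf C => rintro G rfl; simp
  | node C l E₀ E₁ ih₀ ih₁ =>
    rintro G (⟨G, hG, rfl⟩ | ⟨G, hG, rfl⟩) l' b h <;>
      rcases Finset.mem_insert.1 h with h | h
    · cases h; exact Set.mem_insert _ _
    · exact .inr (.inl (ih₀ hG h))
    · cases h; exact Set.mem_insert _ _
    · exact .inr (.inr (ih₁ hG h))

/-- `Upd f E G E'`: the leaf `C` of `E` at address `G` is replaced by `f C` in `E'`. -/
inductive ECirc.Upd (f : Circ → ECirc) : ECirc → Addr → ECirc → Prop
  | leaf (C : Circ) : Upd f (.leaf C) ∅ (f C)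
  | left {C : Circ} {l : Label} {E₀ E₁ E₀' : ECirc} {G : Addr} (h₀ : l ∉ E₀.labels)
      (h₁ : l ∉ E₁.labels) (hn : E₁.Nodup) (hG : G ∈ E₀.addrs) (h : Upd f E₀ G E₀') :
      Upd f (.node C l E₀ E₁) (insert (l, false) G) (.node C l E₀' E₁)
  | right {C : Circ} {l : Label} {E₀ E₁ E₁' : ECirc} {G : Addr} (h₀ : l ∉ E₀.labels)
      (h₁ : l ∉ E₁.labels) (hn : E₀.Nodup) (hG : G ∈ E₁.addrs) (h : Upd f E₁ G E₁') :
      Upd f (.node C l E₀ E₁) (insert (l, true) G) (.node C l E₀ E₁')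

theorem ECirc.upd_update {E : ECirc} (hE : E.Nodup) (f : Circ → ECirc) {G : Addr}
    (hG : G ∈ E.addrs) : E.Upd f G (E.update G f) := by
  suffices H : ∀ K : Addr, (∀ w ∈ K, w.1 ∉ E.labels) → E.Upd f G (E.update (K ∪ G) f) by
    simpa using H ∅ (by simp)
  induction E generalizing G with
  | leaf C => intro K _; obtain rfl := hG; exact .leaf C
  | node C l E₀ E₁ ih₀ ih₁ =>
    intro K hK
    obtain ⟨h₀, h₁, hn₀, hn₁⟩ := hE
    have hKl : ∀ b, (l, b) ∉ K := fun b h => hK _ h (Set.mem_insert _ _)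
    rcases hG with ⟨G, hG, rfl⟩ | ⟨G, hG, rfl⟩
    · have hm : (l, false) ∈ K ∪ insert (l, false) G := by simp
      have he : K ∪ insert (l, false) G = insert (l, false) K ∪ G := by
        simp [Finset.insert_union]
      simp only [ECirc.update, if_pos hm]
      rw [he]
      refine .left h₀ h₁ hn₁ hG (ih₀ hn₀ hG _ ?_)
      intro w hw hl
      rcases Finset.mem_insert.1 hw with rfl | hw
      · exact h₀ hl
      · exact hK _ hw (.inr (.inl hl))
    · have hm : (l, false) ∉ K ∪ insert (l, true) G := by
        simp only [Finset.mem_union, Finset.mem_insert, not_or]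
        exact ⟨hKl _, by simp, fun h => h₁ (mem_labels hG h)⟩
      have hm' : (l, true) ∈ K ∪ insert (l, true) G := by simp
      have he : K ∪ insert (l, true) G = insert (l, true) K ∪ G := by
        simp [Finset.insert_union]
      simp only [ECirc.update, if_neg hm, if_pos hm']
      rw [he]
      refine .right h₀ h₁ hn₀ hG (ih₁ hn₁ hG _ ?_)
      intro w hw hl
      rcases Finset.mem_insert.1 hw with rfl | hw
      · exact h₁ hl
      · exact hK _ hw (.inr (.inr hl))

theorem insert_injective_of_notMem {w : Label × Bool} {G G' : Addr} (h : w ∉ G) (h' : w ∉ G')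
    (he : insert w G = insert w G') : G = G' := by
  have := congrArg (fun K => K.erase w) he
  simpa [Finset.erase_insert h, Finset.erase_insert h'] using this

theorem ECirc.image_insert_diff {E : ECirc} {l : Label} (hl : l ∉ E.labels) (b : Bool) {G : Addr}
    (hG : G ∈ E.addrs) : (insert (l, b) '' E.addrs) \ {insert (l, b) G} =
      insert (l, b) '' (E.addrs \ {G}) := by
  have hn : ∀ {H : Addr}, H ∈ E.addrs → (l, b) ∉ H := fun hH h => hl (mem_labels hH h)
  rw [Set.image_sdiff_of_injOn, Set.image_singleton]
  · exact fun G h G' h' he => insert_injective_of_notMem (hn h) (hn h') he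
  · simpa using hG

theorem ECirc.notMem_image_insert {E E' : ECirc} {l : Label} (hl : l ∉ E.labels)
    {b b' : Bool} (hb : b' ≠ b) {G : Addr} (hG : G ∈ E.addrs) :
    insert (l, b) G ∉ (insert (l, b') : Addr → Addr) '' E'.addrs := by
  rintro ⟨G', -, he⟩
  have : (l, b') ∈ insert (l, b) G := he ▸ Finset.mem_insert_self _ _
  rcases Finset.mem_insert.1 this with h | h
  · simp_all
  · exact hl (mem_labels hG h)

theorem ECirc.Upd.addrs_eq {f : Circ → ECirc} {E E' : ECirc} {G : Addr} (h : E.Upd f G E')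
    {A : Set Addr} (hA : ∀ C, (f C).addrs = A) :
    E'.addrs = (E.addrs \ {G}) ∪ (G ∪ ·) '' A := by
  induction h with
  | leaf C => simp [hA, ECirc.addrs]
  | @left C l E₀ E₁ E₀' G h₀ h₁ _ hG _ ih =>
    have hi : (insert (l, false) '' ((G ∪ ·) '' A)) = ((insert (l, false) G ∪ ·) '' A) := by
      simp [Set.image_image, Finset.insert_union]
    have hd := notMem_image_insert (E' := E₁) h₀ (b := false) (b' := true) (by simp) hG
    have hs := image_insert_diff h₀ false hG
    simp only [ECirc.addrs]
    rw [ih, Set.union_sdiff_distrib, Set.sdiff_singleton_eq_self hd, hs, Set.image_union, hi]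
    ext; simp only [Set.mem_union]; tauto
  | @right C l E₀ E₁ E₁' G h₀ h₁ _ hG _ ih =>
    have hi : (insert (l, true) '' ((G ∪ ·) '' A)) = ((insert (l, true) G ∪ ·) '' A) := by
      simp [Set.image_image, Finset.insert_union]
    have hd := notMem_image_insert (E' := E₀) h₁ (b := true) (b' := false) (by simp) hG
    have hs := image_insert_diff h₁ true hG
    simp only [ECirc.addrs]
    rw [ih, Set.union_sdiff_distrib, Set.sdiff_singleton_eq_self hd, hs, Set.image_union, hi]
    ext; simp only [Set.mem_union]; tauto

theorem ECirc.Upd.labels_subset {f : Circ → ECirc} {E E' : ECirc} {G : Addr} (h : E.Upd f G E')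
    {L : Set Label} (hL : ∀ C, (f C).labels ⊆ L) : E'.labels ⊆ E.labels ∪ L := by
  induction h with
  | leaf C => simpa [ECirc.labels] using hL C
  | left _ _ _ _ _ ih =>
    simp only [ECirc.labels]
    intro l hl
    rcases hl with rfl | hl | hl
    · exact .inl (.inl rfl)
    · exact (ih hl).imp (fun h => .inr (.inl h)) id
    · exact .inl (.inr (.inr hl))
  | right _ _ _ _ _ ih =>
    simp only [ECirc.labels]
    intro l hl
    rcases hl with rfl | hl | hl
    · exact .inl (.inl rfl)
    · exact .inl (.inr (.inl hl))
    · exact (ih hl).imp (fun h => .inr (.inr h)) id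

theorem ECirc.Upd.nodup {f : Circ → ECirc} {E E' : ECirc} {G : Addr} (h : E.Upd f G E')
    {L : Set Label} (hL : ∀ C, (f C).labels ⊆ L) (hf : ∀ C, (f C).Nodup) (hE : E.Nodup)
    (hG : ∀ w ∈ G, w.1 ∉ L) : E'.Nodup := by
  induction h with
  | leaf C => exact hf C
  | left h₀ h₁ hn _ h ih =>
    refine ⟨fun hl => ?_, h₁, ih hE.2.2.1 fun w hw => hG w (Finset.mem_insert_of_mem hw), hn⟩
    rcases h.labels_subset hL hl with hl | hl
    · exact h₀ hl
    · exact hG _ (Finset.mem_insert_self _ _) hl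
  | right h₀ h₁ hn _ h ih =>
    refine ⟨h₀, fun hl => ?_, hn, ih hE.2.2.2 fun w hw => hG w (Finset.mem_insert_of_mem hw)⟩
    rcases h.labels_subset hL hl with hl | hl
    · exact h₁ hl
    · exact hG _ (Finset.mem_insert_self _ _) hl

theorem ECirc.HasType.congr {Γ : Env} {E : ECirc} {J J' : Addr → Env} (h : E.HasType Γ J)
    (hJ : ∀ G ∈ E.addrs, J' G = J G) : E.HasType Γ J' := by
  induction h generalizing J' with
  | leaf h => exact .leaf (by rwa [hJ _ rfl])
  | node hl hC _ _ ih₀ ih₁ =>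
    exact .node hl hC (ih₀ fun G hG => hJ _ (.inl ⟨G, hG, rfl⟩))
      (ih₁ fun G hG => hJ _ (.inr ⟨G, hG, rfl⟩))

theorem ECirc.Upd.hasType {f : Circ → ECirc} {E E' : ECirc} {G : Addr} (h : E.Upd f G E')
    {Γ : Env} {J J' : Addr → Env} (hE : E.HasType Γ J)
    (hf : ∀ Γ C, Circ.HasType Γ C (J G) → (f C).HasType Γ fun H => J' (G ∪ H))
    (hJ : ∀ G' ∈ E.addrs, G' ≠ G → J' G' = J G') : E'.HasType Γ J' := by
  induction h generalizing Γ J J' with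
  | leaf C =>
    cases hE with
    | leaf h => simpa using hf _ _ h
  | @left C l E₀ E₁ E₀' G h₀ h₁ _ hG _ ih =>
    cases hE with
    | node hl hC t₀ t₁ =>
      refine .node hl hC (ih t₀ ?_ ?_) (t₁.congr fun G' hG' => ?_)
      · simpa [Finset.insert_union] using hf
      · refine fun G' hG' hne => hJ _ (.inl ⟨G', hG', rfl⟩) fun he => hne ?_
        exact insert_injective_of_notMem (fun h => h₀ (mem_labels hG' h))
          (fun h => h₀ (mem_labels hG h)) he
      · refine hJ _ (.inr ⟨G', hG', rfl⟩) fun he => ?_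
        exact notMem_image_insert (E := E₀) (E' := E₁) h₀ (b := false) (b' := true) (by simp) hG
          ⟨G', hG', he⟩
  | @right C l E₀ E₁ E₁' G h₀ h₁ _ hG _ ih =>
    cases hE with
    | node hl hC t₀ t₁ =>
      refine .node hl hC (t₀.congr fun G' hG' => ?_) (ih t₁ ?_ ?_)
      · refine hJ _ (.inl ⟨G', hG', rfl⟩) fun he => ?_
        exact notMem_image_insert (E := E₁) (E' := E₀) h₁ (b := true) (b' := false) (by simp) hG
          ⟨G', hG', he⟩
      · simpa [Finset.insert_union] using hf
      · refine fun G' hG' hne => hJ _ (.inr ⟨G', hG', rfl⟩) fun he => hne ?_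
        exact insert_injective_of_notMem (fun h => h₁ (mem_labels hG' h))
          (fun h => h₁ (mem_labels hG h)) he

/-- The sum of the weights of the addresses of an extended circuit. -/
def ECirc.weight : (Addr → ℕ) → ECirc → ℕ
  | w, .leaf _ => w ∅
  | w, .node _ l E₀ E₁ =>
    E₀.weight (fun G => w (insert (l, false) G)) + E₁.weight (fun G => w (insert (l, true) G))

theorem ECirc.weight_congr {E : ECirc} {w w' : Addr → ℕ} (h : ∀ G ∈ E.addrs, w' G = w G) :
    E.weight w' = E.weight w := by
  induction E generalizing w w' with
  | leaf C => exact h _ rfl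
  | node C l E₀ E₁ ih₀ ih₁ =>
    simp only [ECirc.weight]
    rw [ih₀ fun G hG => h _ (.inl ⟨G, hG, rfl⟩), ih₁ fun G hG => h _ (.inr ⟨G, hG, rfl⟩)]

theorem ECirc.Upd.weight_lt {f : Circ → ECirc} {E E' : ECirc} {G : Addr} (h : E.Upd f G E')
    {w w' : Addr → ℕ} (hf : ∀ C, (f C).weight (fun H => w' (G ∪ H)) < w G)
    (hw : ∀ G' ∈ E.addrs, G' ≠ G → w' G' = w G') : E'.weight w' < E.weight w := by
  induction h generalizing w w' with
  | leaf C => have := hf C; simp only [Finset.empty_union] at this; exact this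
  | @left C l E₀ E₁ E₀' G h₀ h₁ _ hG _ ih =>
    refine Nat.add_lt_add_of_lt_of_le (ih ?_ ?_) (weight_congr fun G' hG' => ?_).le
    · simpa [Finset.insert_union] using hf
    · refine fun G' hG' hne => hw _ (.inl ⟨G', hG', rfl⟩) fun he => hne ?_
      exact insert_injective_of_notMem (fun h => h₀ (mem_labels hG' h))
        (fun h => h₀ (mem_labels hG h)) he
    · refine hw _ (.inr ⟨G', hG', rfl⟩) fun he => ?_
      exact notMem_image_insert (E := E₀) (E' := E₁) h₀ (b := false) (b' := true) (by simp) hG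
        ⟨G', hG', he⟩
  | @right C l E₀ E₁ E₁' G h₀ h₁ _ hG _ ih =>
    refine Nat.add_lt_add_of_le_of_lt (weight_congr fun G' hG' => ?_).le (ih ?_ ?_)
    · refine hw _ (.inl ⟨G', hG', rfl⟩) fun he => ?_
      exact notMem_image_insert (E := E₁) (E' := E₀) h₁ (b := true) (b' := false) (by simp) hG
        ⟨G', hG', he⟩
    · simpa [Finset.insert_union] using hf
    · refine fun G' hG' hne => hw _ (.inr ⟨G', hG', rfl⟩) fun he => hne ?_
      exact insert_injective_of_notMem (fun h => h₁ (mem_labels hG' h))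
        (fun h => h₁ (mem_labels hG h)) he

theorem ECirc.HasType.toCirc {Γ Δ : Env} {E : ECirc} {J : Addr → Env} (h : E.HasType Γ J)
    (hJ : ∀ G ∈ E.addrs, J G = Δ) : Circ.HasType Γ E.toCirc Δ := by
  induction h with
  | leaf h => simpa [ECirc.toCirc, hJ _ rfl] using h
  | node hl hC _ _ ih₀ ih₁ =>
    exact .seq hC (.ite hl (ih₀ fun G hG => hJ _ (.inl ⟨G, hG, rfl⟩))
      (ih₁ fun G hG => hJ _ (.inr ⟨G, hG, rfl⟩)))


/-! ### Typing of the circuits added by the transitions -/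

theorem Env.mem_labels {Γ : Env} {l : Label} : l ∈ Γ.labels ↔ ∃ B, (l, B) ∈ Γ := by
  simp [Env.labels]

theorem Env.labels_union (Γ Δ : Env) : Env.labels (Γ ∪ Δ) = Γ.labels ∪ Δ.labels :=
  Set.image_union _ _ _

theorem Env.WF.union {Γ Δ : Env} (h₁ : Γ.WF) (h₂ : Δ.WF) (hd : ∀ l ∈ Γ.labels, l ∉ Δ.labels) :
    Env.WF (Γ ∪ Δ) := by
  rintro ⟨l, B⟩ (h | h) ⟨l', B'⟩ (h' | h') (rfl : l = l')
  · exact h₁ h h' rfl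
  · exact absurd (mem_labels.2 ⟨_, h'⟩) (hd _ (mem_labels.2 ⟨_, h⟩))
  · exact absurd (mem_labels.2 ⟨_, h⟩) (hd _ (mem_labels.2 ⟨_, h'⟩))
  · exact h₂ h h' rfl

theorem Circ.HasType.relabel_frame {A B Θ : Env} {f : Label → Label} (hA : A.WF) (hΘ : Θ.WF)
    (hd : ∀ l ∈ A.labels, l ∉ Θ.labels) (hid : ∀ l ∈ Θ.labels, f l = l)
    (hinj : Set.InjOn f A.labels) (hd' : ∀ l ∈ A.labels, f l ∉ Θ.labels)
    (hB : (fun w => (f w.1, w.2)) '' A = B) :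
    Circ.HasType (A ∪ Θ) (.relabel f) (B ∪ Θ) := by
  have hB' : (fun w => (f w.1, w.2)) '' (A ∪ Θ) = B ∪ Θ := by
    rw [Set.image_union, hB]
    congr 1
    refine (Set.image_congr fun w hw => ?_).trans (Set.image_id _)
    rw [hid w.1 ⟨w, hw, rfl⟩]; rfl
  rw [← hB']
  refine .relabel f (hA.union hΘ hd) ?_
  rw [Env.labels_union]
  rintro l (h | h) l' (h' | h') he
  · exact hinj h h' he
  · rw [hid l' h'] at he
    exact absurd (he ▸ h') (hd' l h)
  · rw [hid l h] at he
    exact absurd (he ▸ h) (hd' l' h')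
  · rwa [hid l h, hid l' h'] at he

theorem length_tensorPlaces : ∀ Bs : List BTy, (tensorPlaces Bs).length = Bs.length
  | [] => rfl
  | [_] => rfl
  | _ :: C :: Bs => by simp [tensorPlaces, length_tensorPlaces (C :: Bs)]

theorem nodup_tensorPlaces : ∀ Bs : List BTy, (tensorPlaces Bs).Nodup
  | [] => List.nodup_nil
  | [_] => List.nodup_singleton _
  | _ :: C :: Bs => by
    simp only [tensorPlaces, List.nodup_cons, List.mem_map, not_exists]
    refine ⟨by simp, (nodup_tensorPlaces (C :: Bs)).map fun s s' h => ?_⟩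
    simpa using h

theorem atomAt_tensorList {B : BTy} {e : Bool} : ∀ {Bs : List BTy} {s : List Dir},
    (tensorList Bs).atomAt s = some (.base B, e) ↔ e = true ∧ (s, B) ∈ (tensorPlaces Bs).zip Bs
  | [], s => by cases s <;> simp [tensorList, Ty.atomAt, tensorPlaces]
  | [C], s => by
    cases s <;> simp [tensorList, Ty.atomAt, tensorPlaces]
    constructor <;> rintro ⟨rfl, rfl⟩ <;> simp
  | C :: D :: Bs, s => by
    have ih := @atomAt_tensorList B e (D :: Bs)
    have : ∀ s', (s', B) ∈ ((tensorPlaces (D :: Bs)).map (Dir.R :: ·)).zip (D :: Bs) ↔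
        ∃ s, s' = .R :: s ∧ (s, B) ∈ (tensorPlaces (D :: Bs)).zip (D :: Bs) := by
      intro s'
      rw [List.zip_map_left]
      simp only [List.mem_map, Prod.map, Prod.mk.injEq, Prod.exists, id]
      constructor
      · rintro ⟨s, B', h, rfl, rfl⟩; exact ⟨s, rfl, h⟩
      · rintro ⟨s, rfl, h⟩; exact ⟨s, B, h, rfl, rfl⟩
    simp only [tensorPlaces, List.zip_cons_cons, List.mem_cons, Prod.mk.injEq, this]
    rcases s with _ | ⟨_ | _, s⟩
    · simp [tensorList, Ty.atomAt]
    · cases s <;> simp [tensorList, Ty.atomAt]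
      constructor <;> rintro ⟨rfl, rfl⟩ <;> simp
    · simp only [tensorList, Ty.atomAt_tensor_right]
      rw [ih]
      simp

theorem polarity_tensorList {a : Atom} {e : Bool} : ∀ {Bs : List BTy} {s : List Dir},
    (tensorList Bs).atomAt s = some (a, e) → e = true
  | [], s => by cases s <;> simp [tensorList, Ty.atomAt]
  | [C], s => by cases s <;> simp [tensorList, Ty.atomAt]
  | C :: D :: Bs, s => by
    rcases s with _ | ⟨_ | _, s⟩
    · simp [tensorList, Ty.atomAt]
    · cases s <;> simp [tensorList, Ty.atomAt]
    · simpa [tensorList, Ty.atomAt] using @polarity_tensorList a e (D :: Bs) s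

section

variable {Δ₀ : Ctx} {M₀ : Tm} {A₀ : Ty} {π : Der Δ₀ M₀ A₀}

variable (π) in
/-- The wires of the tokens in a set of positions. -/
def wires (X : Set Pos) : Env := {w | w.1 ∈ X ∧ ∃ e, OccursAt π w.1 (.base w.2) e}

theorem wires_wf (X : Set Pos) : (wires π X).WF := by
  rintro ⟨l, B⟩ ⟨-, e, h⟩ ⟨l', B'⟩ ⟨-, e', h'⟩ (rfl : l = l')
  have := (h.unique h').1
  simp_all

theorem wires_union (X Y : Set Pos) : wires π (X ∪ Y) = wires π X ∪ wires π Y := by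
  ext w
  simp only [wires, Set.mem_union, Set.mem_ofPred_eq]
  tauto

theorem mem_of_mem_labels_wires {X : Set Pos} {l : Label} (h : l ∈ (wires π X).labels) :
    l ∈ X := by
  obtain ⟨_, h⟩ := Env.mem_labels.1 h
  exact h.1

theorem Circ.HasType.move {a b : Pos} {Θ : Env}
    (hab : ∀ c, (∃ e, OccursAt π a c e) ↔ ∃ e, OccursAt π b c e) (hΘ : Θ.WF)
    (ha : a ∉ Θ.labels) (hb : b ∉ Θ.labels) :
    Circ.HasType (wires π {a} ∪ Θ) (.relabel (Function.update (fun l => l) a b))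
      (wires π {b} ∪ Θ) := by
  have hl : ∀ l ∈ (wires π {a}).labels, l = a := fun l hl =>
    Set.mem_singleton_iff.1 (mem_of_mem_labels_wires hl)
  refine .relabel_frame (wires_wf _) hΘ ?_ ?_ ?_ ?_ ?_
  · intro l h; rwa [hl l h]
  · rintro l h
    exact Function.update_of_ne (by rintro rfl; exact ha h) _ _
  · intro l h l' h' _; rw [hl l h, hl l' h']
  · intro l h; rw [hl l h]; simpa
  · ext ⟨l, B⟩
    constructor
    · rintro ⟨⟨l', B'⟩, ⟨h, h'⟩, he⟩
      obtain rfl : l' = a := h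
      simp only [Function.update_self, Prod.mk.injEq] at he
      obtain ⟨rfl, rfl⟩ := he
      exact ⟨rfl, (hab _).1 h'⟩
    · rintro ⟨h, h'⟩
      obtain rfl : l = b := h
      exact ⟨(a, B), ⟨rfl, (hab _).2 h'⟩, by simp⟩

theorem occursAt_op {q : Path} {o : Op} (h : IsOp π q o) {σ : Slot} {s : List Dir} {a : Atom}
    {e : Bool} : OccursAt π ⟨q, σ, s⟩ a e ↔ σ = .concl ∧ o.ty.atomAt s = some (a, e) := by
  obtain ⟨_, rfl, h⟩ := h
  cases σ with
  | concl => simp [occursAt_concl h]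
  | hyp x => simp [occursAt_hyp h]

theorem isNeg_op {q : Path} {o : Op} (h : IsOp π q o) {σ : Slot} {s : List Dir} :
    IsNeg π ⟨q, σ, s⟩ ↔ σ = .concl ∧ ∃ s', s = .L :: s' ∧
      ∃ a, (tensorList o.inTy).atomAt s' = some (a, true) := by
  simp only [IsNeg, occursAt_op h, exists_and_left, Op.ty]
  refine and_congr_right fun _ => ?_
  rcases s with _ | ⟨_ | _, s⟩
  · simp [Ty.atomAt]
  · simp [Ty.atomAt_lolli_left]
  · simp only [Ty.atomAt_lolli_right, List.cons.injEq, reduceCtorEq, false_and, exists_false,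
      iff_false, not_exists]
    intro a ha
    exact absurd (polarity_tensorList ha) (by simp)

theorem isPos_op {q : Path} {o : Op} (h : IsOp π q o) {σ : Slot} {s : List Dir} :
    IsPos π ⟨q, σ, s⟩ ↔ σ = .concl ∧ ∃ s', s = .R :: s' ∧
      ∃ a, (tensorList o.outTy).atomAt s' = some (a, true) := by
  simp only [IsPos, occursAt_op h, exists_and_left, Op.ty]
  refine and_congr_right fun _ => ?_
  rcases s with _ | ⟨_ | _, s⟩
  · simp [Ty.atomAt]
  · simp only [Ty.atomAt_lolli_left, List.cons.injEq, reduceCtorEq, false_and, exists_false,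
      iff_false, not_exists]
    intro a ha
    exact absurd (polarity_tensorList ha) (by simp)
  · simp [Ty.atomAt_lolli_right]

theorem exists_isNeg_op {q : Path} {o : Op} (h : IsOp π q o) :
    ∃ a : Pos, a.node = q ∧ IsNeg π a := by
  have : ∃ s a, (tensorList o.inTy).atomAt s = some (a, true) := by
    cases o
    case CNOT => exact ⟨[.L], _, rfl⟩
    all_goals exact ⟨[], _, rfl⟩
  obtain ⟨s, a, hs⟩ := this
  exact ⟨⟨q, .concl, .L :: s⟩, rfl, (isNeg_op h).2 ⟨rfl, s, rfl, a, hs⟩⟩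

theorem exists_isPos_op {q : Path} {o : Op} (h : IsOp π q o) :
    ∃ a : Pos, a.node = q ∧ IsPos π a := by
  have : ∃ s a, (tensorList o.outTy).atomAt s = some (a, true) := by
    cases o
    case CNOT => exact ⟨[.L], _, rfl⟩
    all_goals exact ⟨[], _, rfl⟩
  obtain ⟨s, a, hs⟩ := this
  exact ⟨⟨q, .concl, .R :: s⟩, rfl, (isPos_op h).2 ⟨rfl, s, rfl, a, hs⟩⟩

theorem mem_ofList_map {f : List Dir → Label} {Bs : List BTy} {w : Label × BTy} :
    w ∈ Env.ofList ((tensorPlaces Bs).map f) Bs ↔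
      ∃ s, w.1 = f s ∧ (tensorList Bs).atomAt s = some (.base w.2, true) := by
  obtain ⟨l, B⟩ := w
  simp only [Env.ofList, Set.mem_ofPred_eq, List.zip_map_left, List.mem_map, Prod.map,
    Prod.mk.injEq, Prod.exists, id, atomAt_tensorList, true_and]
  constructor
  · rintro ⟨s, B', h, rfl, rfl⟩; exact ⟨s, rfl, h⟩
  · rintro ⟨s, rfl, h⟩; exact ⟨s, B, h, rfl, rfl⟩

theorem ofList_inLabels {q : Path} {o : Op} (h : IsOp π q o) :
    Env.ofList (inLabels q o) o.inTy = wires π {a | a.node = q ∧ IsNeg π a} := by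
  ext ⟨⟨q', σ, s⟩, B⟩
  rw [inLabels, mem_ofList_map]
  constructor
  · rintro ⟨s', he, hs'⟩
    cases he
    exact ⟨⟨rfl, (isNeg_op h).2 ⟨rfl, s', rfl, _, hs'⟩⟩, false,
      (occursAt_op h).2 ⟨rfl, Ty.atomAt_lolli_left.2 hs'⟩⟩
  · rintro ⟨⟨rfl, hn⟩, e, ho⟩
    obtain ⟨rfl, s', rfl, a, hs'⟩ := (isNeg_op h).1 hn
    refine ⟨s', rfl, ?_⟩
    have := (occursAt_op h).1 ho
    rw [Op.ty, Ty.atomAt_lolli_left, hs'] at this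
    simp_all

theorem ofList_outLabels {q : Path} {o : Op} (h : IsOp π q o) :
    Env.ofList (outLabels q o) o.outTy = wires π {a | a.node = q ∧ IsPos π a} := by
  ext ⟨⟨q', σ, s⟩, B⟩
  rw [outLabels, mem_ofList_map]
  constructor
  · rintro ⟨s', he, hs'⟩
    cases he
    exact ⟨⟨rfl, (isPos_op h).2 ⟨rfl, s', rfl, _, hs'⟩⟩, true,
      (occursAt_op h).2 ⟨rfl, by rwa [Op.ty, Ty.atomAt_lolli_right]⟩⟩
  · rintro ⟨⟨rfl, hn⟩, e, ho⟩
    obtain ⟨rfl, s', rfl, a, hs'⟩ := (isPos_op h).1 hn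
    refine ⟨s', rfl, ?_⟩
    have := (occursAt_op h).1 ho
    rw [Op.ty, Ty.atomAt_lolli_right, hs'] at this
    simp_all

theorem Circ.HasType.applyOp {q : Path} {o : Op} (h : IsOp π q o) {Θ : Env} (hΘ : Θ.WF)
    (hq : ∀ l ∈ Θ.labels, l.node ≠ q) :
    Circ.HasType (wires π {a | a.node = q ∧ IsNeg π a} ∪ Θ)
      (.gate o (inLabels q o) (outLabels q o))
      (wires π {a | a.node = q ∧ IsPos π a} ∪ Θ) := by
  rw [← ofList_inLabels h, ← ofList_outLabels h, Set.union_comm, Set.union_comm _ Θ]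
  refine .gate hΘ ?_ ?_ ?_ ?_ ?_ ?_
  · simp [inLabels, length_tensorPlaces]
  · simp [outLabels, length_tensorPlaces]
  · exact (nodup_tensorPlaces _).map fun s s' h => by simpa using h
  · exact (nodup_tensorPlaces _).map fun s s' h => by simpa using h
  · intro l hl hl'
    simp only [inLabels, List.mem_map] at hl
    obtain ⟨s, -, rfl⟩ := hl
    exact hq _ hl' rfl
  · intro l hl hl'
    simp only [outLabels, List.mem_map] at hl
    obtain ⟨s, -, rfl⟩ := hl
    exact hq _ hl' rfl

theorem branch_ne (q : Path) (b : Bool) : branch q b ≠ q := by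
  simp [branch]

/-- The positions with polarity `e` that the conclusion of the conditional at the node `q` shares
with its branches. -/
def shared (P : Pos → Prop) (q : Path) (Γ : Ctx) : Set Pos :=
  {a | a.node = q ∧ BranchSlot Γ a.slot ∧ P a}

theorem Circ.HasType.branchCirc {q : Path} {Γ : Ctx} (h : IsIte π q Γ) {b : Bool} {E : ECirc}
    {Θ : Env} (hΘ : Θ.WF) (hq : ∀ l ∈ Θ.labels, ¬ (l.node = q ∧ BranchSlot Γ l.slot))
    (hb : ∀ l ∈ Θ.labels, ¬ branch q b <+: l.node)
    (hE : Circ.HasType (ndata π (branch q b) ∪ Θ) E.toCirc (pdata π (branch q b) ∪ Θ)) :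
    Circ.HasType (wires π (shared (IsNeg π) q Γ) ∪ Θ) (branchCirc q Γ b E)
      (wires π (shared (IsPos π) q Γ) ∪ Θ) := by
  have hp : ∀ w ∈ pdata π (branch q b), w.1.node = branch q b := fun w hw => hw.1
  refine .seq (.relabel_frame (B := ndata π (branch q b)) (wires_wf _) hΘ ?_ ?_ ?_ ?_ ?_)
    (.seq hE (.relabel_frame ?_ hΘ ?_ ?_ ?_ ?_ ?_))
  · intro l hl hl'
    have := mem_of_mem_labels_wires hl
    exact hq l hl' ⟨this.1, this.2.1⟩
  · intro l hl
    simp only [enterBranch, if_neg (hq l hl)]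
  · intro l hl l' hl' he
    have h₁ := mem_of_mem_labels_wires hl
    have h₂ := mem_of_mem_labels_wires hl'
    obtain ⟨_, σ, s⟩ := l
    obtain ⟨_, σ', s'⟩ := l'
    obtain ⟨rfl, h₁, -⟩ := h₁
    obtain ⟨rfl, h₂, -⟩ := h₂
    simp only at h₁ h₂
    simpa [enterBranch, h₁, h₂] using he
  · intro l hl hl'
    have h₁ := mem_of_mem_labels_wires hl
    rw [enterBranch, if_pos ⟨h₁.1, h₁.2.1⟩] at hl'
    exact hb _ hl' List.prefix_rfl
  · ext ⟨⟨q', σ, s⟩, B⟩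
    constructor
    · rintro ⟨⟨⟨q'', σ', s'⟩, B'⟩, ⟨⟨rfl, hσ, c, hn⟩, e, ho⟩, he⟩
      simp only at hσ
      simp only [enterBranch, hσ, and_self, if_true, Prod.mk.injEq, Pos.mk.injEq] at he
      obtain ⟨⟨rfl, rfl, rfl⟩, rfl⟩ := he
      obtain ⟨-, rfl⟩ := hn.unique ho
      exact ⟨rfl, (occursAt_branch h).2 ⟨hσ, ho⟩⟩
    · rintro ⟨rfl, ho⟩
      obtain ⟨hσ, ho⟩ := (occursAt_branch h).1 ho
      exact ⟨(⟨q, σ, s⟩, B), ⟨⟨rfl, hσ, _, ho⟩, _, ho⟩, by simp [enterBranch, hσ]⟩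
  · rintro ⟨l, B⟩ ⟨-, h⟩ ⟨l', B'⟩ ⟨-, h'⟩ (rfl : l = l')
    have := (h.unique h').1
    simp_all
  · intro l hl hl'
    obtain ⟨B, hB⟩ := Env.mem_labels.1 hl
    exact hb l hl' (by rw [hp _ hB])
  · intro l hl
    rw [exitBranch, if_neg]
    exact fun he => hb l hl (he ▸ List.prefix_rfl)
  · intro l hl l' hl' he
    obtain ⟨B, hB⟩ := Env.mem_labels.1 hl
    obtain ⟨B', hB'⟩ := Env.mem_labels.1 hl'
    have h₁ := hp _ hB
    have h₂ := hp _ hB'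
    obtain ⟨_, σ, s⟩ := l
    obtain ⟨_, σ', s'⟩ := l'
    simp only at h₁ h₂
    subst h₁ h₂
    simpa [exitBranch] using he
  · intro l hl hl'
    obtain ⟨B, hB⟩ := Env.mem_labels.1 hl
    obtain ⟨_, σ, s⟩ := l
    obtain ⟨rfl, ho⟩ := hB
    rw [exitBranch, if_pos rfl] at hl'
    exact hq _ hl' ⟨rfl, ((occursAt_branch h).1 ho).1⟩
  · ext ⟨⟨q', σ, s⟩, B⟩
    constructor
    · rintro ⟨⟨⟨_, σ', s'⟩, B'⟩, ⟨rfl, ho⟩, he⟩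
      simp only [exitBranch, if_true, Prod.mk.injEq, Pos.mk.injEq] at he
      obtain ⟨⟨rfl, rfl, rfl⟩, rfl⟩ := he
      obtain ⟨hσ, ho⟩ := (occursAt_branch h).1 ho
      exact ⟨⟨rfl, hσ, _, ho⟩, _, ho⟩
    · rintro ⟨⟨rfl, hσ, c, hn⟩, e, ho⟩
      obtain ⟨-, rfl⟩ := hn.unique ho
      exact ⟨(⟨branch q' b, σ, s⟩, B), ⟨rfl, (occursAt_branch h).2 ⟨hσ, ho⟩⟩,
        by simp [exitBranch]⟩

theorem wires_guardPos {q : Path} {Γ : Ctx} (h : IsIte π q Γ) :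
    wires π {guardPos q} = {(guardPos q, .bit)} := by
  ext ⟨l, B⟩
  constructor
  · rintro ⟨hl, e, ho⟩
    obtain rfl : l = guardPos q := hl
    have := (ho.unique (occursAt_guardPos h)).1
    simp_all
  · intro hl
    cases hl
    exact ⟨rfl, _, occursAt_guardPos h⟩

end


section

variable {Δ₀ : Ctx} {M₀ : Tm} {A₀ : Ty} (π : Der Δ₀ M₀ A₀)

/-! ### Invariants of a slice -/

/-- The tokens that have reached (`W`) and left (`V`) the rule at the node `q` in the slice `G`
agree. -/
structure LocalInv (G : Addr) (q : Path) (V W : Set Pos) : Prop where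
  link : ∀ {k p p' c}, π.kindAt q = some k → k.link p = some p' → p.Carries π q c true →
    (p.place q ∈ W ↔ p'.place q ∈ V)
  op : ∀ {o}, IsOp π q o → ∀ {a b : Pos}, a.node = q → IsNeg π a → b.node = q → IsPos π b →
    (a ∈ W ↔ b ∈ V)
  enter : ∀ {Γ b σ s}, IsIte π q Γ → (guardPos q, b) ∈ G → BranchSlot Γ σ →
    IsNeg π ⟨q, σ, s⟩ → (⟨q, σ, s⟩ ∈ W ↔ ⟨branch q b, σ, s⟩ ∈ V)
  exit : ∀ {Γ b σ s}, IsIte π q Γ → (guardPos q, b) ∈ G → IsPos π ⟨branch q b, σ, s⟩ →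
    (⟨branch q b, σ, s⟩ ∈ W ↔ ⟨q, σ, s⟩ ∈ V)
  closedNeg : ∀ {Γ}, IsIte π q Γ → (∀ b, (guardPos q, b) ∉ G) →
    ∀ a ∈ shared (IsNeg π) q Γ, (a ∈ W ↔ guardPos q ∈ W)
  closedPos : ∀ {Γ}, IsIte π q Γ → (∀ b, (guardPos q, b) ∉ G) →
    ∀ a ∈ shared (IsPos π) q Γ, (a ∈ V ↔ guardPos q ∈ W)
  read : ∀ {Γ b}, IsIte π q Γ → (guardPos q, b) ∈ G → guardPos q ∈ W
  letStar : IsLetStar π q → ⟨q ++ [0], .concl, []⟩ ∉ W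

/-- `V` is the set of positions that have been visited by the tokens of the slice `G`, and `W` is
the set of those that have been left (or, for a guard, whose bit has been read). -/
structure SliceInv (r : Path) (G : Addr) (V W : Set Pos) : Prop where
  func : ∀ l, (l, false) ∈ G → (l, true) ∉ G
  occ : ∀ a ∈ V, r <+: a.node ∧ ∃ c e, OccursAt π a c e
  sub : W ⊆ V
  loc : ∀ q, r <+: q → LocalInv π G q V W
  unop : ∀ a ∈ V, ¬ Opened π r a.node G → a ∉ W ∧ IsStar π a.node ∧ a = ⟨a.node, .concl, []⟩
  neg : ∀ a : Pos, a.node = r → IsNeg π a → a ∈ V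
  star : ∀ p, r <+: p → IsStar π p → ⟨p, .concl, []⟩ ∈ V
  pos : ∀ a : Pos, a.node = r → IsPos π a → a ∉ W

variable {π}

theorem isNeg_branch {q : Path} {Γ : Ctx} (h : IsIte π q Γ) {b : Bool} {σ : Slot} {s : List Dir} :
    IsNeg π ⟨branch q b, σ, s⟩ ↔ BranchSlot Γ σ ∧ IsNeg π ⟨q, σ, s⟩ := by
  simp [IsNeg, occursAt_branch h]

theorem isPos_branch {q : Path} {Γ : Ctx} (h : IsIte π q Γ) {b : Bool} {σ : Slot} {s : List Dir} :
    IsPos π ⟨branch q b, σ, s⟩ ↔ BranchSlot Γ σ ∧ IsPos π ⟨q, σ, s⟩ := by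
  simp [IsPos, occursAt_branch h]

theorem inp_guardPos {q : Path} {Γ : Ctx} (h : IsIte π q Γ) : Inp π q (guardPos q) :=
  .inr ⟨0, rfl, _, occursAt_guardPos h⟩

theorem inp_branch {q : Path} {b : Bool} {σ : Slot} {s : List Dir}
    (h : IsPos π ⟨branch q b, σ, s⟩) : Inp π q ⟨branch q b, σ, s⟩ :=
  .inr ⟨_, rfl, h⟩

theorem out_branch {q : Path} {b : Bool} {σ : Slot} {s : List Dir}
    (h : IsNeg π ⟨branch q b, σ, s⟩) : Out π q ⟨branch q b, σ, s⟩ :=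
  .inr ⟨_, rfl, h⟩

theorem LocalInv.congr {G : Addr} {q : Path} {V W V' W' : Set Pos} (h : LocalInv π G q V W)
    (hV : ∀ a, Out π q a → (a ∈ V' ↔ a ∈ V)) (hW : ∀ a, Inp π q a → (a ∈ W' ↔ a ∈ W)) :
    LocalInv π G q V' W' where
  link hk hl hc := by
    have hc' := hc.link hk hl
    rw [hW _ hc.inp, hV _ hc'.out]
    exact h.link hk hl hc
  op ho a b ha hn hb hp := by
    rw [hW _ (.inl ⟨ha, hn⟩), hV _ (.inl ⟨hb, hp⟩)]
    exact h.op ho ha hn hb hp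
  enter hi hg hσ hn := by
    rw [hW _ (.inl ⟨rfl, hn⟩), hV _ (out_branch ((isNeg_branch hi).2 ⟨hσ, hn⟩))]
    exact h.enter hi hg hσ hn
  exit hi hg hp := by
    rw [hW _ (inp_branch hp), hV _ (.inl ⟨rfl, ((isPos_branch hi).1 hp).2⟩)]
    exact h.exit hi hg hp
  closedNeg hi hg a ha := by
    rw [hW _ (.inl ⟨ha.1, ha.2.2⟩), hW _ (inp_guardPos hi)]
    exact h.closedNeg hi hg a ha
  closedPos hi hg a ha := by
    rw [hV _ (.inl ⟨ha.1, ha.2.2⟩), hW _ (inp_guardPos hi)]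
    exact h.closedPos hi hg a ha
  read hi hg := (hW _ (inp_guardPos hi)).2 (h.read hi hg)
  letStar hl hw := h.letStar hl ((hW _ (.inr ⟨0, rfl, _, occursAt_letStar hl⟩)).1 hw)

theorem Inp.not_isPos_root {r q : Path} {a : Pos} (h : Inp π q a) (hq : r <+: q)
    (ha : a.node = r) : ¬ IsPos π a := by
  intro hp
  rcases h with ⟨-, hn⟩ | ⟨i, hi, -⟩
  · exact not_isPos_of_isNeg hn hp
  · have := hq.length_le
    rw [← ha, hi] at this
    simp at this

theorem Out.prefix {r q : Path} {a : Pos} (h : Out π q a) (hq : r <+: q) : r <+: a.node := by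
  rcases h with ⟨ha, -⟩ | ⟨i, ha, -⟩
  · exact ha ▸ hq
  · exact ha ▸ hq.trans (List.prefix_append _ _)

theorem Out.exists_occursAt {q : Path} {a : Pos} (h : Out π q a) : ∃ c e, OccursAt π a c e := by
  rcases h with ⟨-, c, h⟩ | ⟨i, -, c, h⟩ <;> exact ⟨_, _, h⟩

theorem SliceInv.fire {r : Path} {G : Addr} {V W : Set Pos} (h : SliceInv π r G V W) {q : Path}
    (hq : r <+: q) {X Y : Set Pos} (hX : ∀ x ∈ X, x ∈ V ∧ Inp π q x ∧ Opened π r x.node G)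
    (hY : ∀ y ∈ Y, Out π q y ∧ Opened π r y.node G)
    (hl : LocalInv π G q (V ∪ Y) (W ∪ X)) : SliceInv π r G (V ∪ Y) (W ∪ X) where
  func := h.func
  occ a ha := by
    rcases ha with ha | ha
    · exact h.occ a ha
    · exact ⟨(hY a ha).1.prefix hq, (hY a ha).1.exists_occursAt⟩
  sub := by
    rintro a (ha | ha)
    · exact .inl (h.sub ha)
    · exact .inl (hX a ha).1
  loc q' hq' := by
    by_cases hqq : q' = q
    · exact hqq ▸ hl
    · refine (h.loc q' hq').congr (fun a ha => or_iff_left fun ha' => hqq ?_)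
        (fun a ha => or_iff_left fun ha' => hqq ?_)
      · exact ha.unique (hY a ha').1
      · exact ha.unique (hX a ha').2.1
  unop a ha ho := by
    rcases ha with ha | ha
    · obtain ⟨h₁, h₂⟩ := h.unop a ha ho
      refine ⟨?_, h₂⟩
      rintro (h' | h')
      · exact h₁ h'
      · exact ho (hX a h').2.2
    · exact absurd (hY a ha).2 ho
  neg a ha hn := .inl (h.neg a ha hn)
  star p hp hs := .inl (h.star p hp hs)
  pos a ha hp := by
    rintro (h' | h')
    · exact h.pos a ha hp h'
    · exact (hX a h').2.1.not_isPos_root hq ha hp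

/-! ### The local invariant is preserved -/

variable {G : Addr} {q : Path} {V W : Set Pos}

theorem IsOp.not_isIte {o : Op} (h : IsOp π q o) {Γ : Ctx} : ¬ IsIte π q Γ := by
  intro h'
  obtain ⟨D, h'⟩ := h'.kindAt
  simp [h.kindAt] at h'

theorem IsOp.not_isLetStar {o : Op} (h : IsOp π q o) : ¬ IsLetStar π q := by
  intro h'
  obtain ⟨D, E, h'⟩ := h'.kindAt
  simp [h.kindAt] at h'

theorem IsIte.not_isLetStar {Γ : Ctx} (h : IsIte π q Γ) : ¬ IsLetStar π q := by
  intro h'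
  obtain ⟨D, E, h'⟩ := h'.kindAt
  obtain ⟨D, h⟩ := h.kindAt
  simp [h] at h'

theorem IsIte.branchSlot_iff {Γ Γ' : Ctx} (h : IsIte π q Γ) (h' : IsIte π q Γ') {σ : Slot} :
    BranchSlot Γ σ ↔ BranchSlot Γ' σ := by
  obtain ⟨D, hD⟩ := h.kindAt
  have := kindAt_ite_unique hD h'
  cases σ <;> simp [BranchSlot, this]

theorem IsIte.special_guard {Γ : Ctx} (h : IsIte π q Γ) {k : Kind} (hk : π.kindAt q = some k) :
    k.Special (.prem 0 .concl []) := by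
  obtain ⟨D, hD⟩ := h.kindAt
  obtain rfl : k = _ := Option.some_injective _ (hk.symm.trans hD)
  exact .guard _ _

theorem IsIte.special_shared {Γ : Ctx} (h : IsIte π q Γ) {k : Kind} (hk : π.kindAt q = some k)
    {σ : Slot} (hσ : BranchSlot Γ σ) (s : List Dir) : k.Special (.top σ s) := by
  obtain ⟨D, hD⟩ := h.kindAt
  obtain rfl : k = _ := Option.some_injective _ (hk.symm.trans hD)
  exact .shared _ _ _ _ (QCSIAM.branchSlot_iff.1 hσ)

theorem IsIte.special_branch {Γ : Ctx} (h : IsIte π q Γ) {k : Kind} (hk : π.kindAt q = some k)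
    (b : Bool) (σ : Slot) (s : List Dir) : k.Special (.prem (if b then 2 else 1) σ s) := by
  obtain ⟨D, hD⟩ := h.kindAt
  obtain rfl : k = _ := Option.some_injective _ (hk.symm.trans hD)
  exact .branch _ _ _ _ _

theorem special_place_ne {k : Kind} (hk : π.kindAt q = some k) {p₀ p p' : Port}
    (h₀ : k.Special p₀) (h : k.link p = some p') : p₀.place q ≠ p.place q := by
  intro he
  obtain rfl := Port.place_injective q he
  rw [h₀.link_eq_none (Der.kindAt_valid hk)] at h
  cases h

theorem LocalInv.move (h : LocalInv π G q V W) {k : Kind} (hk : π.kindAt q = some k)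
    {p p' : Port} (hp : k.link p = some p') :
    LocalInv π G q (V ∪ {p'.place q}) (W ∪ {p.place q}) := by
  have hv := Der.kindAt_valid hk
  have hp' := Kind.link_symm hv hp
  have hW : ∀ p₀, k.Special p₀ → (p₀.place q ∈ W ∪ {p.place q} ↔ p₀.place q ∈ W) :=
    fun p₀ h₀ => or_iff_left (special_place_ne hk h₀ hp)
  have hV : ∀ p₀, k.Special p₀ → (p₀.place q ∈ V ∪ {p'.place q} ↔ p₀.place q ∈ V) :=
    fun p₀ h₀ => or_iff_left (special_place_ne hk h₀ hp')
  refine ⟨?_, ?_, ?_, ?_, ?_, ?_, ?_, ?_⟩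
  · intro k' p₁ p₁' c hk' hl hc
    obtain rfl : k = k' := Option.some_injective _ (hk.symm.trans hk')
    refine or_congr (h.link hk hl hc) ⟨fun he => ?_, fun he => ?_⟩
    · obtain rfl := Port.place_injective q he
      obtain rfl : p' = p₁' := Option.some_injective _ (hp.symm.trans hl)
      rfl
    · obtain rfl := Port.place_injective q he
      have hl' := Kind.link_symm hv hl
      obtain rfl : p = p₁ := Option.some_injective _ (hp'.symm.trans hl')
      rfl
  · intro o ho a b ha hn hb hp₁
    obtain rfl : k = .op o := Option.some_injective _ (hk.symm.trans ho.kindAt)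
    cases p <;> simp [Kind.link] at hp
  · intro Γ b σ s hi hg hσ hn
    exact (hW _ (hi.special_shared hk hσ s)).trans <| (h.enter hi hg hσ hn).trans
      (hV _ (hi.special_branch hk b σ s)).symm
  · intro Γ b σ s hi hg hn
    exact (hW _ (hi.special_branch hk b σ s)).trans <| (h.exit hi hg hn).trans
      (hV _ (hi.special_shared hk ((isPos_branch hi).1 hn).1 s)).symm
  · rintro Γ hi hg ⟨_, σ, s⟩ ⟨rfl, ha⟩
    exact (hW _ (hi.special_shared hk ha.1 s)).trans <| (h.closedNeg hi hg _ ⟨rfl, ha⟩).trans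
      (hW _ (hi.special_guard hk)).symm
  · rintro Γ hi hg ⟨_, σ, s⟩ ⟨rfl, ha⟩
    exact (hV _ (hi.special_shared hk ha.1 s)).trans <| (h.closedPos hi hg _ ⟨rfl, ha⟩).trans
      (hW _ (hi.special_guard hk)).symm
  · exact fun hi hg => .inl (h.read hi hg)
  · intro hl
    obtain ⟨D, E, hD⟩ := hl.kindAt
    obtain rfl : k = _ := Option.some_injective _ (hk.symm.trans hD)
    exact fun hw => h.letStar hl ((hW _ (.letStar _ _)).1 hw)

theorem localInv_applyOp {o : Op} (ho : IsOp π q o) :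
    LocalInv π G q (V ∪ {a | a.node = q ∧ IsPos π a}) (W ∪ {a | a.node = q ∧ IsNeg π a}) where
  link hk hl hc := by
    obtain rfl := Option.some_injective _ (hk.symm.trans ho.kindAt)
    rename_i p _ _
    cases p <;> simp [Kind.link] at hl
  op _ a b ha hn hb hp := iff_of_true (.inr ⟨ha, hn⟩) (.inr ⟨hb, hp⟩)
  enter hi := (ho.not_isIte hi).elim
  exit hi := (ho.not_isIte hi).elim
  closedNeg hi := (ho.not_isIte hi).elim
  closedPos hi := (ho.not_isIte hi).elim
  read hi := (ho.not_isIte hi).elim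
  letStar hl := (ho.not_isLetStar hl).elim

theorem LocalInv.link_of_special (h : LocalInv π G q V W) {k : Kind} (hk : π.kindAt q = some k)
    {X Y : Set Pos} (hX : ∀ x ∈ X, ∃ p, k.Special p ∧ x = p.place q)
    (hY : ∀ y ∈ Y, ∃ p, k.Special p ∧ y = p.place q) {k' : Kind} {p p' : Port} {c : Atom}
    (hk' : π.kindAt q = some k') (hl : k'.link p = some p') (hc : p.Carries π q c true) :
    p.place q ∈ W ∪ X ↔ p'.place q ∈ V ∪ Y := by
  obtain rfl : k = k' := Option.some_injective _ (hk.symm.trans hk')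
  have hl' := Kind.link_symm (Der.kindAt_valid hk) hl
  refine (or_iff_left fun hx => ?_).trans <| (h.link hk hl hc).trans
    (or_iff_left fun hy => ?_).symm
  · obtain ⟨p₀, h₀, he⟩ := hX _ hx
    exact special_place_ne hk h₀ hl he.symm
  · obtain ⟨p₀, h₀, he⟩ := hY _ hy
    exact special_place_ne hk h₀ hl' he.symm

theorem IsIte.isOp_elim {Γ : Ctx} (h : IsIte π q Γ) {o : Op} (ho : IsOp π q o) {P : Prop} : P :=
  (ho.not_isIte h).elim

theorem LocalInv.enterBranch (h : LocalInv π G q V W) (hG : ∀ l, (l, false) ∈ G → (l, true) ∉ G)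
    {Γ : Ctx} (hi : IsIte π q Γ) {b : Bool} (hb : (guardPos q, b) ∈ G) {σ : Slot} {s : List Dir}
    (hσ : BranchSlot Γ σ) :
    LocalInv π G q (V ∪ {⟨branch q b, σ, s⟩}) (W ∪ {⟨q, σ, s⟩}) where
  link := by
    obtain ⟨D, hk⟩ := hi.kindAt
    refine fun hk' hl hc => h.link_of_special hk ?_ ?_ hk' hl hc
    · rintro _ rfl; exact ⟨_, hi.special_shared hk hσ s, rfl⟩
    · rintro _ rfl; exact ⟨_, hi.special_branch hk b σ s, rfl⟩
  op ho := hi.isOp_elim ho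
  enter {Γ' b' σ' s'} hi' hb' hσ' hn := by
    have : b' = b := by
      cases b <;> cases b'
      · rfl
      · exact absurd hb' (hG _ hb)
      · exact absurd hb (hG _ hb')
      · rfl
    subst this
    refine or_congr (h.enter hi' hb' hσ' hn) ?_
    simp
  exit {Γ' b' σ' s'} hi' hb' hp := by
    refine (or_iff_left ?_).trans <| (h.exit hi' hb' hp).trans (or_iff_left ?_).symm
    · intro he
      simp [branch_ne] at he
    · intro he
      simp [(branch_ne _ _).symm] at he
  closedNeg _ hg := absurd hb (hg b)
  closedPos _ hg := absurd hb (hg b)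
  read hi' hg := .inl (h.read hi' hg)
  letStar hl := (hi.not_isLetStar hl).elim

theorem LocalInv.exitBranch (h : LocalInv π G q V W) (hG : ∀ l, (l, false) ∈ G → (l, true) ∉ G)
    {Γ : Ctx} (hi : IsIte π q Γ) {b : Bool} (hb : (guardPos q, b) ∈ G) {σ : Slot} {s : List Dir}
    (hσ : BranchSlot Γ σ) :
    LocalInv π G q (V ∪ {⟨q, σ, s⟩}) (W ∪ {⟨branch q b, σ, s⟩}) where
  link := by
    obtain ⟨D, hk⟩ := hi.kindAt
    refine fun hk' hl hc => h.link_of_special hk ?_ ?_ hk' hl hc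
    · rintro _ rfl; exact ⟨_, hi.special_branch hk b σ s, rfl⟩
    · rintro _ rfl; exact ⟨_, hi.special_shared hk hσ s, rfl⟩
  op ho := hi.isOp_elim ho
  enter {Γ' b' σ' s'} hi' hb' hσ' hn := by
    refine (or_iff_left ?_).trans <| (h.enter hi' hb' hσ' hn).trans (or_iff_left ?_).symm
    · intro he
      simp [(branch_ne _ _).symm] at he
    · intro he
      simp [branch_ne] at he
  exit {Γ' b' σ' s'} hi' hb' hp := by
    have : b' = b := by
      cases b <;> cases b'
      · rfl
      · exact absurd hb' (hG _ hb)
      · exact absurd hb (hG _ hb')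
      · rfl
    subst this
    refine or_congr (h.exit hi' hb' hp) ?_
    simp
  closedNeg _ hg := absurd hb (hg b)
  closedPos _ hg := absurd hb (hg b)
  read hi' hg := .inl (h.read hi' hg)
  letStar hl := (hi.not_isLetStar hl).elim

theorem LocalInv.cross (h : LocalInv π G q V W) {Γ : Ctx} (hi : IsIte π q Γ)
    (hg : guardPos q ∉ W) :
    LocalInv π G q (V ∪ shared (IsPos π) q Γ) (W ∪ insert (guardPos q) (shared (IsNeg π) q Γ)) where
  link := by
    obtain ⟨D, hk⟩ := hi.kindAt
    refine fun hk' hl hc => h.link_of_special hk ?_ ?_ hk' hl hc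
    · rintro ⟨_, σ, s⟩ (he | ⟨rfl, hσ, -⟩)
      · exact ⟨_, hi.special_guard hk, he⟩
      · exact ⟨_, hi.special_shared hk hσ s, rfl⟩
    · rintro ⟨_, σ, s⟩ ⟨rfl, hσ, -⟩; exact ⟨_, hi.special_shared hk hσ s, rfl⟩
  op ho := hi.isOp_elim ho
  enter hi' hb := absurd (h.read hi' hb) hg
  exit hi' hb := absurd (h.read hi' hb) hg
  closedNeg hi' _ a ha :=
    iff_of_true (.inr (.inr ⟨ha.1, (hi'.branchSlot_iff hi).1 ha.2.1, ha.2.2⟩)) (.inr (.inl rfl))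
  closedPos hi' _ a ha :=
    iff_of_true (.inr ⟨ha.1, (hi'.branchSlot_iff hi).1 ha.2.1, ha.2.2⟩) (.inr (.inl rfl))
  read hi' hb := absurd (h.read hi' hb) hg
  letStar hl := (hi.not_isLetStar hl).elim

end


/-! ### Finiteness of the set of positions -/

theorem Ty.finite_places (A : Ty) : {s | ∃ u, A.atomAt s = some u}.Finite := by
  induction A with
  | atom a =>
    refine (Set.finite_singleton []).subset ?_
    rintro (_ | ⟨d, s⟩) ⟨u, h⟩
    · rfl
    · simp [Ty.atomAt] at h
  | lolli A B ihA ihB | tensor A B ihA ihB =>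
    refine ((ihA.image (Dir.L :: ·)).union (ihB.image (Dir.R :: ·))).subset ?_
    rintro (_ | ⟨_ | _, s⟩) ⟨u, h⟩
    · simp [Ty.atomAt] at h
    · refine .inl ⟨s, ?_, rfl⟩
      rcases hs : A.atomAt s with _ | v
      · simp [Ty.atomAt, hs] at h
      · exact ⟨v, hs⟩
    · exact .inr ⟨s, ⟨u, by simpa [Ty.atomAt] using h⟩, rfl⟩

theorem Der.finite_of_premises {Δ : Ctx} {M : Tm} {A : Ty} (d : Der Δ M A)
    (h : ∀ i N, d.premise i = some N → {q | N.der.sub q ≠ none}.Finite) :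
    {q | d.sub q ≠ none}.Finite := by
  have hp : ∀ i, {q | d.sub (i :: q) ≠ none}.Finite := by
    intro i
    cases hi : d.premise i with
    | none => simp [Der.sub, hi]
    | some N => simpa [Der.sub, hi] using h i N hi
  refine ((Set.finite_singleton []).union (((hp 0).image (0 :: ·)).union
    (((hp 1).image (1 :: ·)).union ((hp 2).image (2 :: ·))))).subset ?_
  rintro (_ | ⟨_ | _ | _ | i, q⟩) hq
  · exact .inl rfl
  · exact .inr (.inl ⟨q, hq, rfl⟩)
  · exact .inr (.inr (.inl ⟨q, hq, rfl⟩))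
  · exact .inr (.inr (.inr ⟨q, hq, rfl⟩))
  · exfalso
    cases d <;> simp [Der.sub, Der.premise] at hq

theorem Der.finite_nodes {Δ : Ctx} {M : Tm} {A : Ty} (d : Der Δ M A) :
    {q | d.sub q ≠ none}.Finite := by
  induction d with
  | var | star | op =>
    refine Der.finite_of_premises _ fun i N h => ?_
    simp [Der.premise] at h
  | lam _ _ _ _ _ ih =>
    refine Der.finite_of_premises _ fun i N h => ?_
    obtain _ | i := i
    · cases h; exact ih
    · simp [Der.premise] at h
  | app _ _ _ _ ih₀ ih₁ | letStar _ _ _ _ ih₀ ih₁ | pair _ _ _ _ ih₀ ih₁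
  | letPair _ _ _ _ _ _ _ _ _ _ _ _ ih₀ ih₁ =>
    refine Der.finite_of_premises _ fun i N h => ?_
    obtain _ | _ | i := i
    · cases h; exact ih₀
    · cases h; exact ih₁
    · simp [Der.premise] at h
  | ite _ _ _ _ _ ih₀ ih₁ ih₂ =>
    refine Der.finite_of_premises _ fun i N h => ?_
    obtain _ | _ | _ | i := i
    · cases h; exact ih₀
    · cases h; exact ih₁
    · cases h; exact ih₂
    · simp [Der.premise] at h

section

variable {Δ₀ : Ctx} {M₀ : Tm} {A₀ : Ty} (π : Der Δ₀ M₀ A₀)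

/-- The positions of a derivation. -/
def positions : Set Pos := {a | ∃ c e, OccursAt π a c e}

theorem finite_positions : (positions π).Finite := by
  have h : ∀ q, {a : Pos | a.node = q ∧ a ∈ positions π}.Finite := by
    intro q
    cases hq : π.sub q with
    | none =>
      refine Set.finite_empty.subset ?_
      rintro a ⟨rfl, _, _, N, hN, -⟩
      simp [hq] at hN
    | some N =>
      refine ((N.ty.finite_places.image fun s => Pos.mk q .concl s).union
        (N.ctx.finite_toSet.biUnion fun w _ =>
          w.2.finite_places.image fun s => Pos.mk q (.hyp w.1) s)).subset ?_
      rintro ⟨_, σ, s⟩ ⟨rfl, c, e, ho⟩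
      cases σ with
      | concl => exact .inl ⟨s, ⟨_, (occursAt_concl hq).1 ho⟩, rfl⟩
      | hyp x =>
        obtain ⟨A, hA, hs⟩ := (occursAt_hyp hq).1 ho
        exact .inr (Set.mem_biUnion (x := (x, A)) hA ⟨s, ⟨_, hs⟩, rfl⟩)
  refine (π.finite_nodes.biUnion fun q _ => h q).subset ?_
  rintro a ⟨c, e, N, hN, h⟩
  exact Set.mem_biUnion (x := a.node) (by simp [hN]) ⟨rfl, c, e, N, hN, h⟩

/-- The number of positions that have not been left yet. -/
noncomputable def slack (W : Set Pos) : ℕ := (positions π \ W).ncard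

variable {π}

theorem slack_lt {W X : Set Pos} {a : Pos} (ha : a ∈ positions π) (hW : a ∉ W) (hX : a ∈ X) :
    slack π (W ∪ X) < slack π W := by
  refine Set.ncard_lt_ncard ⟨fun b hb => ⟨hb.1, fun h => hb.2 (.inl h)⟩, fun h => ?_⟩
    ((finite_positions π).subset Set.sdiff_subset)
  exact (h ⟨ha, hW⟩).2 (.inr hX)

/-! ### Invariants of configurations -/

/-- An environment of wires that do not belong to the sub-derivation `r`. -/
def Frame (r : Path) (Θ : Env) : Prop := Θ.WF ∧ ∀ l ∈ Θ.labels, ¬ r <+: l.node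

variable (π) in
/-- `V G` and `W G` are the positions that have been visited and left in the slice `G`. -/
structure Config.Inv (r : Path) (c : Config) (V W : Addr → Set Pos) : Prop where
  nodup : c.circ.Nodup
  addr : ∀ t ∈ c.tokens, t.addr ∈ c.circ.addrs
  slice : ∀ G ∈ c.circ.addrs, SliceInv π r G (V G) (W G)
  off : ∀ G ∈ c.circ.addrs, ∀ a, ⟨a, G, false⟩ ∈ c.tokens ↔ a ∈ V G ∧ a ∉ W G
  on : ∀ G ∈ c.circ.addrs, ∀ a, ⟨a, G, true⟩ ∈ c.tokens ↔
    a ∈ W G ∧ ∃ q Γ, r <+: q ∧ IsIte π q Γ ∧ a = guardPos q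
  typed : ∀ Θ, Frame r Θ → c.circ.HasType (ndata π r ∪ Θ) fun G => wires π (V G \ W G) ∪ Θ

variable (π) in
/-- The termination measure: positions that have not been left, weighted over the slices. -/
noncomputable def Config.measure (c : Config) (W : Addr → Set Pos) : ℕ :=
  c.circ.weight fun G => 3 ^ slack π (W G)

theorem Config.Inv.fire {r : Path} {c c' : Config} {V W : Addr → Set Pos} (h : c.Inv π r V W)
    {G : Addr} (hG : G ∈ c.circ.addrs) {q : Path} (hq : r <+: q) {X Y : Set Pos}
    (hne : X.Nonempty)
    (hX : ∀ x ∈ X, ⟨x, G, false⟩ ∈ c.tokens ∧ Inp π q x ∧ Opened π r x.node G)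
    (hY : ∀ y ∈ Y, y ∉ V G ∧ Out π q y ∧ Opened π r y.node G)
    (hl : LocalInv π G q (V G ∪ Y) (W G ∪ X)) {C' : Circ}
    (hc : c'.circ = c.circ.append G C')
    (ht : ∀ t : Token, t.addr ≠ G → (t ∈ c'.tokens ↔ t ∈ c.tokens))
    (hoff : ∀ a, ⟨a, G, false⟩ ∈ c'.tokens ↔ (⟨a, G, false⟩ ∈ c.tokens ∧ a ∉ X) ∨ a ∈ Y)
    (hon : ∀ a, ⟨a, G, true⟩ ∈ c'.tokens ↔ ⟨a, G, true⟩ ∈ c.tokens ∨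
      (a ∈ X ∧ ∃ q Γ, r <+: q ∧ IsIte π q Γ ∧ a = guardPos q))
    (hC : ∀ Θ : Env, Θ.WF →
      (∀ l ∈ Θ.labels, (l ∈ V G ∧ l ∉ W G ∧ l ∉ X ∧ ∃ B e, OccursAt π l (.base B) e) ∨
        ¬ r <+: l.node) →
      Circ.HasType (wires π X ∪ Θ) C' (wires π Y ∪ Θ)) :
    ∃ V' W', c'.Inv π r V' W' ∧ c'.measure π W' < c.measure π W := by
  classical
  have hupd := ECirc.upd_update h.nodup (fun C => .leaf (.seq C C')) hG
  have hcirc : c'.circ = c.circ.update G fun C => .leaf (.seq C C') := hc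
  rw [← hcirc] at hupd
  have haddr : c'.circ.addrs = c.circ.addrs := by
    rw [hupd.addrs_eq (A := {∅}) fun C => rfl]
    simpa using Set.insert_eq_of_mem hG
  have hS := h.slice G hG
  have hXV : ∀ x ∈ X, x ∈ V G ∧ x ∉ W G := fun x hx => (h.off G hG x).1 (hX x hx).1
  have hfire : SliceInv π r G (V G ∪ Y) (W G ∪ X) :=
    hS.fire hq (fun x hx => ⟨(hXV x hx).1, (hX x hx).2⟩) (fun y hy => (hY y hy).2) hl
  have hYW : ∀ y ∈ Y, y ∉ W G ∪ X := by
    rintro y hy (hw | hx)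
    · exact (hY y hy).1 (hS.sub hw)
    · exact (hY y hy).1 (hXV y hx).1
  have hold : V G \ W G = X ∪ (V G \ W G) \ X :=
    (Set.union_sdiff_cancel (show X ⊆ V G \ W G from hXV)).symm
  have hnew : (V G ∪ Y) \ (W G ∪ X) = Y ∪ (V G \ W G) \ X := by
    ext a
    have := hYW a
    simp only [Set.mem_sdiff, Set.mem_union] at this ⊢
    tauto
  refine ⟨Function.update V G (V G ∪ Y), Function.update W G (W G ∪ X),
    ⟨?_, ?_, ?_, ?_, ?_, ?_⟩, ?_⟩
  · exact hupd.nodup (L := ∅) (fun _ => by simp [ECirc.labels]) (fun _ => trivial) h.nodup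
      (by simp)
  · intro t htm
    rw [haddr]
    by_cases he : t.addr = G
    · rwa [he]
    · exact h.addr t ((ht t he).1 htm)
  · intro G' hG'
    rw [haddr] at hG'
    by_cases he : G' = G
    · subst he; simpa using hfire
    · simpa [Function.update_of_ne he] using h.slice G' hG'
  · intro G' hG' a
    rw [haddr] at hG'
    by_cases he : G' = G
    · subst he
      rw [hoff, h.off _ hG, Function.update_self, Function.update_self]
      have := hYW a
      simp only [Set.mem_union] at this ⊢
      tauto
    · rw [ht ⟨a, G', false⟩ he, Function.update_of_ne he, Function.update_of_ne he]
      exact h.off G' hG' a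
  · intro G' hG' a
    rw [haddr] at hG'
    by_cases he : G' = G
    · subst he
      rw [hon, h.on _ hG, Function.update_self]
      exact or_and_right.symm
    · rw [ht ⟨a, G', true⟩ he, Function.update_of_ne he]
      exact h.on G' hG' a
  · intro Θ hΘ
    refine hupd.hasType (h.typed Θ hΘ) (fun Γ C hC' => .leaf ?_) fun G' _ hne => ?_
    · simp only [Finset.union_empty, Function.update_self]
      rw [hnew, wires_union, Set.union_assoc]
      rw [hold, wires_union, Set.union_assoc] at hC'
      refine .seq hC' (hC _ ?_ ?_)
      · refine (wires_wf _).union hΘ.1 fun l hl hl' => hΘ.2 l hl' ?_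
        exact (hS.occ l (mem_of_mem_labels_wires hl).1.1).1
      · intro l hl
        rw [Env.labels_union] at hl
        rcases hl with hl | hl
        · have hm := mem_of_mem_labels_wires hl
          obtain ⟨B, -, e, ho⟩ := Env.mem_labels.1 hl
          exact .inl ⟨hm.1.1, hm.1.2, hm.2, B, e, ho⟩
        · exact .inr (hΘ.2 l hl)
    · simp only [Function.update_of_ne hne]
  · refine hupd.weight_lt (fun C => ?_) fun G' _ hne => by simp only [Function.update_of_ne hne]
    simp only [ECirc.weight, Finset.union_empty, Function.update_self]
    obtain ⟨x, hx⟩ := hne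
    refine Nat.pow_lt_pow_right (by norm_num) (slack_lt ?_ (hXV x hx).2 hx)
    exact (hS.occ x (hXV x hx).1).2

theorem SliceInv.opened {r : Path} {G : Addr} {V W : Set Pos} (h : SliceInv π r G V W) {a : Pos}
    (ha : a ∈ V) (hs : ¬ OccursAt π a .one true) : Opened π r a.node G := by
  by_contra ho
  obtain ⟨-, hst, he⟩ := h.unop a ha ho
  exact hs (he ▸ occursAt_star hst)

theorem SliceInv.opened_of_isNeg {r : Path} {G : Addr} {V W : Set Pos} (h : SliceInv π r G V W)
    {a : Pos} (ha : a ∈ V) (hn : IsNeg π a) : Opened π r a.node G :=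
  h.opened ha fun ho => not_isPos_of_isNeg hn ⟨_, ho⟩

theorem SliceInv.opened_of_guardPos {r : Path} {G : Addr} {V W : Set Pos}
    (h : SliceInv π r G V W) {q : Path} {Γ : Ctx} (hi : IsIte π q Γ) (hg : guardPos q ∈ V) :
    Opened π r q G := by
  refine opened_guardPos_iff.1 (h.opened hg fun ho => ?_)
  have := (ho.unique (occursAt_guardPos hi)).1
  simp at this

theorem place_ne_guardPos {k : Kind} (hk : π.kindAt q = some k) {p p' : Port}
    (h : k.link p = some p') {c : Atom} (hc : p.Carries π q c true) {q' : Path} {Γ : Ctx}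
    (hi : IsIte π q' Γ) : p.place q ≠ guardPos q' := by
  intro he
  have h₁ := hc.inp
  rw [he] at h₁
  obtain rfl := h₁.unique (inp_guardPos hi)
  exact special_place_ne hk (hi.special_guard hk) h he.symm

/-- The token in position `a` at address `G` moves to the position `b`, by the rule at `q`. -/
theorem Config.Inv.move {r : Path} {c : Config} {V W : Addr → Set Pos} (h : c.Inv π r V W)
    {G : Addr} {q : Path} (hq : r <+: q) {a b : Pos} (ha : ⟨a, G, false⟩ ∈ c.tokens)
    (hai : Inp π q a) (hao : Opened π r a.node G) (hb : b ∉ V G) (hbo : Out π q b)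
    (hbop : Opened π r b.node G) (hl : LocalInv π G q (V G ∪ {b}) (W G ∪ {a}))
    (hab : ∀ c, (∃ e, OccursAt π a c e) ↔ ∃ e, OccursAt π b c e)
    (hg : ∀ q Γ, IsIte π q Γ → a ≠ guardPos q) :
    ∃ V' W', (c.move G a b).Inv π r V' W' ∧ (c.move G a b).measure π W' < c.measure π W := by
  have hG := h.addr _ ha
  have haV := (h.off G hG a).1 ha
  refine h.fire hG hq (X := {a}) (Y := {b}) (Set.singleton_nonempty a) ?_ ?_ hl rfl ?_ ?_ ?_ ?_
  · rintro _ rfl; exact ⟨ha, hai, hao⟩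
  · rintro _ rfl; exact ⟨hb, hbo, hbop⟩
  · rintro ⟨a', G', e⟩ (hne : G' ≠ G)
    simp [Config.move, hne]
  · intro a'
    simp only [Config.move, Set.mem_insert_iff, Set.mem_sdiff, Set.mem_singleton_iff,
      Token.mk.injEq]
    tauto
  · intro a'
    simp only [Config.move, Set.mem_insert_iff, Set.mem_sdiff, Set.mem_singleton_iff,
      Token.mk.injEq]
    constructor
    · rintro (h | h)
      · simp at h
      · exact .inl h.1
    · rintro (h | ⟨rfl, q', Γ', -, hi, he⟩)
      · simp [h]
      · exact absurd he (hg _ _ hi)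
  · intro Θ hΘ hl
    refine .move hab hΘ (fun h' => ?_) (fun h' => ?_)
    · rcases hl _ h' with h' | h'
      · exact h'.2.2.1 rfl
      · exact h' ((h.slice G hG).occ a haV.1).1
    · rcases hl _ h' with h' | h'
      · exact hb h'.1
      · exact h' (hbo.prefix hq)

end


section

variable {Δ₀ : Ctx} {M₀ : Tm} {A₀ : Ty} {π : Der Δ₀ M₀ A₀}

/-! ### The invariants are preserved by the transitions -/

theorem Config.Inv.structural {r : Path} {c : Config} {V W : Addr → Set Pos}
    (h : c.Inv π r V W) {G : Addr} {a b : Pos} (ht : ⟨a, G, false⟩ ∈ c.tokens) (hm : Move π a b)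
    (ha : r <+: a.node) (hb : r <+: b.node) (ho : Opened π r a.node G) :
    ∃ V' W', (c.move G a b).Inv π r V' W' ∧ (c.move G a b).measure π W' < c.measure π W := by
  obtain ⟨q, k, p, p', x, hk, hl, hc, rfl, rfl⟩ := hm.link
  have hq := prefix_of_link hl ha hb
  have hG := h.addr _ ht
  have hloc := (h.slice G hG).loc q hq
  have hl' := Kind.link_symm (Der.kindAt_valid hk) hl
  refine h.move hq ht hc.inp ho ?_ (hc.link hk hl).out ?_ (hloc.move hk hl) ?_ ?_
  · exact fun hv => ((h.off G hG _).1 ht).2 ((hloc.link hk hl hc).2 hv)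
  · exact (opened_place_iff hk hl').2 ((opened_place_iff hk hl).1 ho)
  · obtain ⟨e₁, h₁⟩ := hc.occursAt
    obtain ⟨e₂, h₂⟩ := (hc.link hk hl).occursAt
    intro y
    constructor
    · rintro ⟨e, he⟩
      obtain ⟨rfl, -⟩ := he.unique h₁
      exact ⟨_, h₂⟩
    · rintro ⟨e, he⟩
      obtain ⟨rfl, -⟩ := he.unique h₂
      exact ⟨_, h₁⟩
  · exact fun q' Γ hi => place_ne_guardPos hk hl hc hi

theorem Config.Inv.enter {r : Path} {c : Config} {V W : Addr → Set Pos}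
    (h : c.Inv π r V W) {G : Addr} {q : Path} {Γ : Ctx} {b : Bool} {σ : Slot} {s : List Dir}
    (hq : r <+: q) (hi : IsIte π q Γ) (hb : (guardPos q, b) ∈ G) (hσ : BranchSlot Γ σ)
    (hn : IsNeg π ⟨q, σ, s⟩) (ht : ⟨⟨q, σ, s⟩, G, false⟩ ∈ c.tokens) :
    ∃ V' W', (c.move G ⟨q, σ, s⟩ ⟨branch q b, σ, s⟩).Inv π r V' W' ∧
      (c.move G ⟨q, σ, s⟩ ⟨branch q b, σ, s⟩).measure π W' < c.measure π W := by
  have hG := h.addr _ ht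
  have hS := h.slice G hG
  have hloc := hS.loc q hq
  have hv := (h.off G hG _).1 ht
  have ho : Opened π r q G := hS.opened_of_isNeg hv.1 hn
  refine h.move hq ht (.inl ⟨rfl, hn⟩) ho ?_ (out_branch ((isNeg_branch hi).2 ⟨hσ, hn⟩))
    (ho.branch hb) (hloc.enterBranch hS.func hi hb hσ) ?_ ?_
  · exact fun hv' => hv.2 ((hloc.enter hi hb hσ hn).2 hv')
  · simp [occursAt_branch hi, hσ]
  · rintro q' Γ' hi' he
    exact not_isPos_of_isNeg hn (he ▸ ⟨_, occursAt_guardPos hi'⟩)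

theorem Config.Inv.exit {r : Path} {c : Config} {V W : Addr → Set Pos}
    (h : c.Inv π r V W) {G : Addr} {q : Path} {Γ : Ctx} {b : Bool} {σ : Slot} {s : List Dir}
    (hq : r <+: q) (hi : IsIte π q Γ) (hb : (guardPos q, b) ∈ G)
    (hp : IsPos π ⟨branch q b, σ, s⟩) (ht : ⟨⟨branch q b, σ, s⟩, G, false⟩ ∈ c.tokens) :
    ∃ V' W', (c.move G ⟨branch q b, σ, s⟩ ⟨q, σ, s⟩).Inv π r V' W' ∧
      (c.move G ⟨branch q b, σ, s⟩ ⟨q, σ, s⟩).measure π W' < c.measure π W := by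
  have hG := h.addr _ ht
  have hS := h.slice G hG
  have hloc := hS.loc q hq
  have hv := (h.off G hG _).1 ht
  have ho : Opened π r q G := hS.opened_of_guardPos hi (hS.sub (hloc.read hi hb))
  obtain ⟨hσ, hp'⟩ := (isPos_branch hi).1 hp
  refine h.move hq ht (inp_branch hp) (ho.branch hb) ?_ (.inl ⟨rfl, hp'⟩) ho
    (hloc.exitBranch hS.func hi hb hσ) ?_ ?_
  · exact fun hv' => hv.2 ((hloc.exit hi hb hp).2 hv')
  · simp [occursAt_branch hi, hσ]
  · rintro q' Γ' hi' he
    simp only [guardPos, branch, Pos.mk.injEq] at he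
    have := (List.append_inj' he.1 rfl).2
    cases b <;> simp at this

theorem Config.Inv.circuit {r : Path} {c : Config} {V W : Addr → Set Pos}
    (h : c.Inv π r V W) {G : Addr} {q : Path} {o : Op} (hq : r <+: q) (ho : IsOp π q o)
    (ht : ∀ a : Pos, a.node = q → IsNeg π a → ⟨a, G, false⟩ ∈ c.tokens) :
    ∃ V' W', (c.applyOp π G q o).Inv π r V' W' ∧
      (c.applyOp π G q o).measure π W' < c.measure π W := by
  obtain ⟨a₀, ha₀, hn₀⟩ := exists_isNeg_op ho
  have hG := h.addr _ (ht a₀ ha₀ hn₀)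
  have hS := h.slice G hG
  have hloc := hS.loc q hq
  have hv₀ := (h.off G hG _).1 (ht a₀ ha₀ hn₀)
  have hop : Opened π r q G := ha₀ ▸ hS.opened_of_isNeg hv₀.1 hn₀
  have hpos : ∀ y : Pos, y.node = q → IsPos π y → y ∉ V G :=
    fun y hy hp hv => hv₀.2 ((hloc.op ho ha₀ hn₀ hy hp).2 hv)
  refine h.fire hG hq (X := {a | a.node = q ∧ IsNeg π a}) (Y := {a | a.node = q ∧ IsPos π a})
    ⟨a₀, ha₀, hn₀⟩ ?_ ?_ (localInv_applyOp ho) rfl ?_ ?_ ?_ ?_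
  · rintro x ⟨hx, hn⟩
    exact ⟨ht x hx hn, .inl ⟨hx, hn⟩, by rw [hx]; exact hop⟩
  · rintro y ⟨hy, hp⟩
    exact ⟨hpos y hy hp, .inl ⟨hy, hp⟩, by rw [hy]; exact hop⟩
  · intro t hne
    simp [Config.applyOp, hne]
  · intro a
    simp [Config.applyOp]
  · intro a
    simp only [Config.applyOp, Set.mem_union, Set.mem_ofPred_eq, true_and, Bool.true_eq_false,
      false_and, or_false]
    constructor
    · exact fun h => .inl h.1
    · rintro (h' | ⟨⟨-, hn⟩, q', Γ, -, hi, rfl⟩)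
      · refine ⟨h', fun hn => ?_⟩
        obtain ⟨-, q', Γ, -, hi, rfl⟩ := (h.on G hG a).1 h'
        exact not_isPos_of_isNeg hn.2 ⟨_, occursAt_guardPos hi⟩
      · exact (not_isPos_of_isNeg hn ⟨_, occursAt_guardPos hi⟩).elim
  · intro Θ hΘ hl
    refine .applyOp ho hΘ fun l hl' hlq => ?_
    rcases hl l hl' with ⟨hv, -, hx, B, e, hocc⟩ | hr
    · cases e
      · exact hx ⟨hlq, _, hocc⟩
      · exact hpos l hlq ⟨_, hocc⟩ hv
    · exact hr (hlq ▸ hq)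

theorem Config.Inv.toCirc {r : Path} {c : Config} {V W : Addr → Set Pos} (h : c.Inv π r V W)
    (hf : c.Final π r) {Θ : Env} (hΘ : Frame r Θ) :
    Circ.HasType (ndata π r ∪ Θ) c.circ.toCirc (pdata π r ∪ Θ) := by
  refine (h.typed Θ hΘ).toCirc fun G hG => ?_
  rw [← (hf.2 G hG).2]
  congr 1
  ext w
  simp [wires, Config.env, h.off G hG]

theorem Config.Inv.cross {r : Path} {c : Config} {V W : Addr → Set Pos}
    (h : c.Inv π r V W) {G : Addr} {q : Path} {Γ : Ctx} {c₀ c₁ : Config}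
    (hq : r <+: q) (hi : IsIte π q Γ) (hg : ⟨guardPos q, G, false⟩ ∈ c.tokens)
    (ht : ∀ a : Pos, a.node = q → BranchSlot Γ a.slot → IsNeg π a → ⟨a, G, false⟩ ∈ c.tokens)
    (h₀ : ∃ V W, c₀.Inv π (branch q false) V W) (hf₀ : c₀.Final π (branch q false))
    (h₁ : ∃ V W, c₁.Inv π (branch q true) V W) (hf₁ : c₁.Final π (branch q true)) :
    ∃ V' W', (c.cross π G q Γ c₀.circ c₁.circ).Inv π r V' W' ∧
      (c.cross π G q Γ c₀.circ c₁.circ).measure π W' < c.measure π W := by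
  have hG := h.addr _ hg
  have hS := h.slice G hG
  have hloc := hS.loc q hq
  have hgv := (h.off G hG _).1 hg
  have hop : Opened π r q G := hS.opened_of_guardPos hi hgv.1
  have hnot : ∀ b, (guardPos q, b) ∉ G := fun b hb => hgv.2 (hloc.read hi hb)
  have hpos : ∀ y ∈ shared (IsPos π) q Γ, y ∉ V G :=
    fun y hy hv => hgv.2 ((hloc.closedPos hi hnot y hy).1 hv)
  have hgn : ¬ IsNeg π (guardPos q) := fun hn =>
    not_isPos_of_isNeg hn ⟨_, occursAt_guardPos hi⟩
  refine h.fire hG hq (X := insert (guardPos q) (shared (IsNeg π) q Γ))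
    (Y := shared (IsPos π) q Γ) (Set.insert_nonempty _ _) ?_ ?_ (hloc.cross hi hgv.2) rfl
    ?_ ?_ ?_ ?_
  · rintro x (rfl | ⟨hx, hσ, hn⟩)
    · exact ⟨hg, inp_guardPos hi, opened_guardPos_iff.2 hop⟩
    · exact ⟨ht x hx hσ hn, .inl ⟨hx, hn⟩, by rw [hx]; exact hop⟩
  · rintro y ⟨hy, hσ, hp⟩
    exact ⟨hpos y ⟨hy, hσ, hp⟩, .inl ⟨hy, hp⟩, by rw [hy]; exact hop⟩
  · intro t hne
    have : t ≠ ⟨guardPos q, G, true⟩ := fun he => hne (he ▸ rfl)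
    simp [Config.cross, hne, this]
  · intro a
    simp [Config.cross, shared]
  · intro a
    simp only [Config.cross, Set.mem_union, Set.mem_ofPred_eq, true_and, Bool.true_eq_false,
      false_and, or_false, Set.mem_singleton_iff, Token.mk.injEq, and_true, Set.mem_insert_iff,
      shared]
    constructor
    · rintro (h' | rfl)
      · exact .inl h'.1
      · exact .inr ⟨.inl rfl, q, Γ, hq, hi, rfl⟩
    · rintro (h' | ⟨h' | h', q', Γ', -, hi', he⟩)
      · by_cases hag : a = guardPos q
        · exact .inr hag
        · refine .inl ⟨h', ?_⟩
          rintro (h'' | h'')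
          · exact hag h''
          · obtain ⟨-, q', Γ', -, hi', rfl⟩ := (h.on G hG a).1 h'
            exact not_isPos_of_isNeg h''.2.2 ⟨_, occursAt_guardPos hi'⟩
      · exact .inr h'
      · exact (not_isPos_of_isNeg h'.2.2 (he ▸ ⟨_, occursAt_guardPos hi'⟩)).elim
  · intro Θ hΘ hl
    have hΘq : ∀ l ∈ Θ.labels, ¬ (l.node = q ∧ BranchSlot Γ l.slot) := by
      rintro l hl' ⟨hlq, hσ⟩
      rcases hl l hl' with ⟨hv, -, hx, B, e, hocc⟩ | hr
      · cases e
        · exact hx (.inr ⟨hlq, hσ, _, hocc⟩)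
        · exact hpos l ⟨hlq, hσ, _, hocc⟩ hv
      · exact hr (hlq ▸ hq)
    have hΘb : ∀ b, ∀ l ∈ Θ.labels, ¬ branch q b <+: l.node := by
      intro b l hl' hb
      rcases hl l hl' with ⟨hv, -, -, B, e, hocc⟩ | hr
      · refine hnot b (hS.opened hv (fun ho => ?_) q Γ b hq hi hb)
        have := (ho.unique hocc).1
        simp at this
      · exact hr (hq.trans ((List.prefix_append _ _).trans hb))
    have hΘg : guardPos q ∉ Θ.labels := by
      intro hl'
      rcases hl _ hl' with h' | hr
      · exact h'.2.2.1 (.inl rfl)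
      · exact hr (hq.trans (List.prefix_append _ _))
    obtain ⟨_, _, h₀⟩ := h₀
    obtain ⟨_, _, h₁⟩ := h₁
    rw [Set.insert_eq, wires_union, wires_guardPos hi, Set.union_assoc, ← Set.insert_eq]
    refine .ite ?_ ?_ ?_
    · rw [Env.labels_union]
      rintro (h' | h')
      · exact hgn (mem_of_mem_labels_wires h').2.2
      · exact hΘg h'
    · exact .branchCirc hi hΘ hΘq (hΘb false) (h₀.toCirc hf₀ ⟨hΘ, hΘb false⟩)
    · exact .branchCirc hi hΘ hΘq (hΘb true) (h₁.toCirc hf₁ ⟨hΘ, hΘb true⟩)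

theorem ECirc.addrs_antichain {E : ECirc} (hE : E.Nodup) : ∀ {G G' : Addr}, G ∈ E.addrs →
    G' ∈ E.addrs → G ⊆ G' → G = G' := by
  induction E with
  | leaf C => rintro G G' rfl rfl _; rfl
  | node C l E₀ E₁ ih₀ ih₁ =>
    obtain ⟨h₀, h₁, hn₀, hn₁⟩ := hE
    have sub : ∀ {w : Label × Bool} {G G' : Addr}, w ∉ G → insert w G ⊆ insert w G' → G ⊆ G' := by
      intro w G G' hw hs x hx
      rcases Finset.mem_insert.1 (hs (Finset.mem_insert_of_mem hx)) with rfl | h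
      · exact absurd hx hw
      · exact h
    rintro _ _ (⟨G, hG, rfl⟩ | ⟨G, hG, rfl⟩) (⟨G', hG', rfl⟩ | ⟨G', hG', rfl⟩) hs
    · dsimp only
      rw [ih₀ hn₀ hG hG' (sub (fun h => h₀ (mem_labels hG h)) hs)]
    · have := hs (Finset.mem_insert_self _ _)
      simp only [Finset.mem_insert, Prod.mk.injEq, reduceCtorEq, and_false, false_or] at this
      exact absurd (mem_labels hG' this) h₁
    · have := hs (Finset.mem_insert_self _ _)
      simp only [Finset.mem_insert, Prod.mk.injEq, reduceCtorEq, and_false, false_or] at this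
      exact absurd (mem_labels hG' this) h₀
    · dsimp only
      rw [ih₁ hn₁ hG hG' (sub (fun h => h₁ (mem_labels hG h)) hs)]

theorem SliceInv.split {r : Path} {G : Addr} {V W : Set Pos} (h : SliceInv π r G V W) {q : Path}
    {Γ : Ctx} (hq : r <+: q) (hi : IsIte π q Γ) (hg : guardPos q ∈ V) (hgW : guardPos q ∉ W)
    (b : Bool) : SliceInv π r (insert (guardPos q, b) G) V (W ∪ {guardPos q}) where
  func l hf ht := by
    have hnot : ∀ b, (guardPos q, b) ∉ G := fun b hb => hgW ((h.loc q hq).read hi hb)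
    simp only [Finset.mem_insert, Prod.mk.injEq] at hf ht
    rcases hf with ⟨rfl, hb⟩ | hf <;> rcases ht with ⟨h', hb'⟩ | ht
    · simp [← hb] at hb'
    · exact hnot _ ht
    · exact hnot _ (h' ▸ hf)
    · exact h.func l hf ht
  occ := h.occ
  sub := by
    rintro a (ha | rfl)
    · exact h.sub ha
    · exact hg
  unop a ha ho := by
    obtain ⟨h₁, h₂⟩ := h.unop a ha fun ho' => ho (ho'.mono (Finset.subset_insert _ _))
    refine ⟨?_, h₂⟩
    rintro (h' | rfl)
    · exact h₁ h'
    · refine ho ?_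
      exact (opened_guardPos_iff.2 (h.opened_of_guardPos hi hg)).mono (Finset.subset_insert _ _)
  neg := h.neg
  star := h.star
  pos a ha hp := by
    rintro (h' | rfl)
    · exact h.pos a ha hp h'
    · exact (inp_guardPos hi).not_isPos_root hq ha hp
  loc q' hq' := by
    have hl := h.loc q' hq'
    have hnot : ∀ b, (guardPos q, b) ∉ G := fun b hb => hgW ((h.loc q hq).read hi hb)
    by_cases hqq : q' = q
    · subst hqq
      obtain ⟨D, hk⟩ := hi.kindAt
      have star_elim : ∀ a ∈ V, branch q' b <+: a.node →
          IsStar π a.node ∧ a = ⟨a.node, .concl, []⟩ := fun a ha hb =>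
        (h.unop a ha fun ho => hnot b (ho q' Γ b hq hi hb)).2
      have eq_of_mem : ∀ {b'}, (guardPos q', b') ∈ insert (guardPos q', b) G → b' = b := by
        intro b' hb'
        simpa [hnot] using hb'
      refine ⟨?_, fun ho => hi.isOp_elim ho, ?_, ?_, ?_, ?_, ?_, ?_⟩
      · intro k p p' c hk' hp hc
        have := hl.link_of_special hk (X := {guardPos q'}) (Y := ∅) ?_ ?_ hk' hp hc
        · simpa using this
        · rintro _ rfl; exact ⟨_, hi.special_guard hk, rfl⟩
        · rintro _ ⟨⟩
      · intro Γ' b' σ s hi' hb' hσ hn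
        have hσ' := (hi'.branchSlot_iff hi).1 hσ
        obtain rfl := eq_of_mem hb'
        refine iff_of_false ?_ fun hv => ?_
        · rintro (h' | h')
          · exact hgW ((hl.closedNeg hi hnot _ ⟨rfl, hσ', hn⟩).1 h')
          · exact not_isPos_of_isNeg hn (h' ▸ ⟨_, occursAt_guardPos hi⟩)
        · obtain ⟨hs, he⟩ := star_elim _ hv List.prefix_rfl
          refine not_isPos_of_isNeg ((isNeg_branch (b := b') hi).2 ⟨hσ', hn⟩) ?_
          rw [he]
          exact ⟨_, occursAt_star hs⟩
      · intro Γ' b' σ s hi' hb' hp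
        obtain ⟨hσ, hp'⟩ := (isPos_branch hi).1 hp
        obtain rfl := eq_of_mem hb'
        refine iff_of_false ?_ fun hv => ?_
        · rintro (h' | h')
          · exact (h.unop _ (h.sub h') fun ho => hnot b' (ho q' Γ b' hq hi List.prefix_rfl)).1 h'
          · simp only [guardPos, branch, Set.mem_singleton_iff, Pos.mk.injEq] at h'
            have := (List.append_inj' h'.1 rfl).2
            cases b' <;> simp at this
        · exact hgW ((hl.closedPos hi hnot _ ⟨rfl, hσ, hp'⟩).1 hv)
      · exact fun _ hn => absurd (Finset.mem_insert_self _ _) (hn b)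
      · exact fun _ hn => absurd (Finset.mem_insert_self _ _) (hn b)
      · exact fun _ _ => .inr rfl
      · exact fun hs => (hi.not_isLetStar hs).elim
    · have hne : ∀ a, Inp π q' a → (a ∈ W ∪ {guardPos q} ↔ a ∈ W) := fun a ha =>
        or_iff_left fun he => hqq (ha.unique (he ▸ inp_guardPos hi))
      have hl' := hl.congr (V' := V) (fun _ _ => Iff.rfl) hne
      have hG : ∀ b', (guardPos q', b') ∈ insert (guardPos q, b) G ↔ (guardPos q', b') ∈ G := by
        intro b'
        rw [Finset.mem_insert, or_iff_right]
        intro he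
        exact hqq (guardPos_injective (Prod.mk.inj he).1)
      exact ⟨hl'.link, hl'.op, fun hi' hb' => hl'.enter hi' ((hG _).1 hb'),
        fun hi' hb' => hl'.exit hi' ((hG _).1 hb'),
        fun hi' hn => hl'.closedNeg hi' fun b' hb' => hn b' ((hG _).2 hb'),
        fun hi' hn => hl'.closedPos hi' fun b' hb' => hn b' ((hG _).2 hb'),
        fun hi' hb' => hl'.read hi' ((hG _).1 hb'), hl'.letStar⟩

end


section

variable {Δ₀ : Ctx} {M₀ : Tm} {A₀ : Ty} {π : Der Δ₀ M₀ A₀}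

theorem Config.Inv.guard {r : Path} {c : Config} {V W : Addr → Set Pos}
    (h : c.Inv π r V W) {G : Addr} {q : Path} {Γ : Ctx} (hq : r <+: q) (hi : IsIte π q Γ)
    (ht : ⟨guardPos q, G, false⟩ ∈ c.tokens) :
    ∃ V' W', (c.split G q).Inv π r V' W' ∧ (c.split G q).measure π W' < c.measure π W := by
  classical
  have hG : G ∈ c.circ.addrs := h.addr _ ht
  have hS := h.slice G hG
  obtain ⟨hgV, hgW⟩ := (h.off G hG _).1 ht
  have hnot : ∀ b, (guardPos q, b) ∉ G := fun b hb => hgW ((hS.loc q hq).read hi hb)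
  set f : Circ → ECirc := fun C => .node C (guardPos q) (.leaf .id) (.leaf .id) with hf
  have hupd := ECirc.upd_update h.nodup f hG
  have hA : ∀ C, (f C).addrs = {{(guardPos q, false)}, {(guardPos q, true)}} := by
    intro C
    simp [hf, ECirc.addrs, Set.pair_comm]
  have haddr : (c.split G q).circ.addrs =
      (c.circ.addrs \ {G}) ∪ {insert (guardPos q, false) G, insert (guardPos q, true) G} := by
    refine (hupd.addrs_eq hA).trans ?_
    rw [Set.image_pair]
    simp only [Finset.union_comm G, ← Finset.insert_eq]
  have hnew : ∀ b, insert (guardPos q, b) G ∉ c.circ.addrs := by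
    intro b hb
    have := ECirc.addrs_antichain h.nodup hG hb (Finset.subset_insert _ _)
    exact hnot b (this ▸ Finset.mem_insert_self _ _)
  have hinj : ∀ {b b'}, insert (guardPos q, b) G = insert (guardPos q, b') G → b = b' := by
    intro b b' he
    have : (guardPos q, b) ∈ insert (guardPos q, b') G := he ▸ Finset.mem_insert_self _ _
    simpa [hnot] using this
  set V' : Addr → Set Pos := fun G' => if G' ∈ c.circ.addrs then V G' else V G with hV'
  set W' : Addr → Set Pos := fun G' => if G' ∈ c.circ.addrs then W G' else W G ∪ {guardPos q}
    with hW'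
  have hVn : ∀ b, V' (insert (guardPos q, b) G) = V G := fun b => if_neg (hnew b)
  have hWn : ∀ b, W' (insert (guardPos q, b) G) = W G ∪ {guardPos q} := fun b => if_neg (hnew b)
  have hVo : ∀ {G'}, G' ∈ c.circ.addrs → V' G' = V G' := fun h => if_pos h
  have hWo : ∀ {G'}, G' ∈ c.circ.addrs → W' G' = W G' := fun h => if_pos h
  have cases_addr : ∀ {P : Addr → Prop}, (∀ G' ∈ c.circ.addrs, G' ≠ G → P G') →
      (∀ b, P (insert (guardPos q, b) G)) → ∀ G' ∈ (c.split G q).circ.addrs, P G' := by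
    intro P h₁ h₂ G' hG'
    rw [haddr] at hG'
    rcases hG' with ⟨h', hne⟩ | rfl | rfl
    · exact h₁ G' h' hne
    · exact h₂ _
    · exact h₂ _
  have mem_old : ∀ {a e G'}, G' ∈ c.circ.addrs → G' ≠ G →
      (⟨a, G', e⟩ ∈ (c.split G q).tokens ↔ ⟨a, G', e⟩ ∈ c.tokens) := by
    intro a e G' hG' hne
    refine ⟨?_, fun h' => .inl ⟨h', hne⟩⟩
    rintro (h' | ⟨u, hu, b, -, -, he, -⟩)
    · exact h'.1
    · exact absurd hG' ((show G' = _ from he) ▸ hnew b)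
  have mem_new : ∀ {a e b}, ⟨a, insert (guardPos q, b) G, e⟩ ∈ (c.split G q).tokens ↔
      ∃ e', ⟨a, G, e'⟩ ∈ c.tokens ∧ (e = true ↔ e' = true ∨ a = guardPos q) := by
    intro a e b
    constructor
    · rintro (h' | ⟨⟨a', G', e'⟩, hu, b', hG', ha', he, hfl⟩)
      · exact absurd (h.addr _ h'.1) (hnew b)
      · simp only at hG' ha'
        subst hG' ha'
        exact ⟨e', hu, hfl⟩
    · rintro ⟨e', hu, hfl⟩
      exact .inr ⟨_, hu, b, rfl, rfl, rfl, hfl⟩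
  refine ⟨V', W', ⟨?_, ?_, ?_, ?_, ?_, ?_⟩, ?_⟩
  · refine hupd.nodup (L := {guardPos q}) (fun C => ?_) (fun C => ?_) h.nodup ?_
    · simp [hf, ECirc.labels]
    · simp [hf, ECirc.Nodup, ECirc.labels]
    · rintro ⟨l, b⟩ hw rfl
      exact hnot b hw
  · rintro t (⟨ht, hne⟩ | ⟨u, hu, b, huG, -, hta, -⟩)
    · rw [haddr]
      exact .inl ⟨h.addr t ht, hne⟩
    · rw [haddr, hta]
      cases b <;> simp
  · refine cases_addr (fun G' hG' _ => ?_) fun b => ?_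
    · rw [hVo hG', hWo hG']; exact h.slice G' hG'
    · rw [hVn, hWn]; exact hS.split hq hi hgV hgW b
  · refine cases_addr (fun G' hG' hne a => ?_) fun b a => ?_
    · rw [hVo hG', hWo hG', mem_old hG' hne]; exact h.off G' hG' a
    · rw [hVn, hWn, mem_new]
      have h₁ := h.off G hG a
      constructor
      · rintro ⟨e', ha, hfl⟩
        simp only [Bool.false_eq_true, false_iff, not_or] at hfl
        obtain rfl : e' = false := by simpa using hfl.1
        obtain ⟨hv, hw⟩ := h₁.1 ha
        exact ⟨hv, by rintro (h' | h'); exacts [hw h', hfl.2 h']⟩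
      · rintro ⟨hv, hw⟩
        refine ⟨false, h₁.2 ⟨hv, fun h' => hw (.inl h')⟩, ?_⟩
        simp only [Bool.false_eq_true, false_or, false_iff]
        exact fun h' => hw (.inr h')
  · refine cases_addr (fun G' hG' hne a => ?_) fun b a => ?_
    · rw [hWo hG', mem_old hG' hne]; exact h.on G' hG' a
    · rw [hWn, mem_new]
      constructor
      · rintro ⟨e', ha, hfl⟩
        simp only [true_iff] at hfl
        rcases hfl with rfl | rfl
        · obtain ⟨hw, hex⟩ := (h.on G hG a).1 ha
          exact ⟨.inl hw, hex⟩
        · exact ⟨.inr rfl, q, Γ, hq, hi, rfl⟩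
      · rintro ⟨hw | rfl, hex⟩
        · exact ⟨true, (h.on G hG a).2 ⟨hw, hex⟩, by simp⟩
        · exact ⟨false, ht, by simp⟩
  · intro Θ hΘ
    refine hupd.hasType (h.typed Θ hΘ) (fun Γ' C hC => ?_) fun G' hG' hne => ?_
    · have hd : V G \ W G = {guardPos q} ∪ V G \ (W G ∪ {guardPos q}) := by
        ext a
        by_cases ha : a = guardPos q
        · simp [ha, hgV, hgW]
        · simp [ha]
      rw [hd, wires_union, wires_guardPos hi, Set.union_assoc, ← Set.insert_eq] at hC
      have hwf : Env.WF (wires π (V G \ (W G ∪ {guardPos q})) ∪ Θ) := by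
        refine (wires_wf _).union hΘ.1 fun l hl hl' => hΘ.2 l hl' ?_
        exact (hS.occ l (mem_of_mem_labels_wires hl).1).1
      refine .node ?_ hC (.leaf ?_) (.leaf ?_)
      · rw [Env.labels_union]
        rintro (h' | h')
        · exact (mem_of_mem_labels_wires h').2 (.inr rfl)
        · exact hΘ.2 _ h' (hS.occ _ hgV).1
      · rw [Finset.union_comm]
        simp only [Finset.insert_union, Finset.empty_union, hVn, hWn]
        exact .id hwf
      · rw [Finset.union_comm]
        simp only [Finset.insert_union, Finset.empty_union, hVn, hWn]
        exact .id hwf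
    · simp only [hVo hG', hWo hG']
  · refine hupd.weight_lt (fun C => ?_) fun G' hG' _ => by simp only [hWo hG']
    simp only [hf, ECirc.weight, Finset.union_comm G, Finset.insert_union, Finset.empty_union, hWn]
    have hlt : slack π (W G ∪ {guardPos q}) < slack π (W G) :=
      slack_lt (hS.occ _ hgV).2 hgW rfl
    have h₁ : 3 ^ (slack π (W G ∪ {guardPos q}) + 1) ≤ 3 ^ slack π (W G) :=
      Nat.pow_le_pow_right (by norm_num) hlt
    have h₂ : 0 < 3 ^ slack π (W G ∪ {guardPos q}) := by positivity
    rw [pow_succ] at h₁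
    omega

variable (π) in
/-- The positions of the tokens of the initial configuration. -/
def sources (r : Path) : Set Pos :=
  {a | a.node = r ∧ IsNeg π a} ∪ {a | ∃ p, r <+: p ∧ IsStar π p ∧ a = ⟨p, .concl, []⟩}

theorem sliceInv_initial (r : Path) : SliceInv π r ∅ (sources π r) ∅ where
  func := by simp
  occ := by
    rintro a (⟨rfl, c, h⟩ | ⟨p, hp, hs, rfl⟩)
    · exact ⟨List.prefix_rfl, _, _, h⟩
    · exact ⟨hp, _, _, occursAt_star hs⟩
  sub := Set.empty_subset _
  unop := by
    rintro a (⟨rfl, h⟩ | ⟨p, hp, hs, rfl⟩) ho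
    · exact absurd (opened_self _) ho
    · exact ⟨fun h => h, hs, rfl⟩
  neg a ha hn := .inl ⟨ha, hn⟩
  star p hp hs := .inr ⟨p, hp, hs, rfl⟩
  pos a _ _ h := h
  loc q hq := by
    have star_of_out : ∀ a, Out π q a → a ∈ sources π r → IsStar π q := by
      rintro a ho (⟨ha, hn⟩ | ⟨p, hp, hs, rfl⟩)
      · exfalso
        rcases ho with ⟨-, hp⟩ | ⟨i, hi, -⟩
        · exact not_isPos_of_isNeg hn hp
        · have := hq.length_le
          rw [← ha, hi] at this
          simp at this
      · have : Out π p ⟨p, .concl, []⟩ := .inl ⟨rfl, _, occursAt_star hs⟩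
        rwa [ho.unique this]
    refine ⟨?_, ?_, ?_, ?_, ?_, ?_, ?_, ?_⟩
    · intro k p p' c hk hl hc
      refine iff_of_false (fun h => h) fun h => ?_
      have hs := star_of_out _ (hc.link hk hl).out h
      obtain rfl := Option.some_injective _ (hk.symm.trans hs.kindAt)
      cases p <;> simp [Kind.link] at hl
    · intro o ho a b _ _ hb hp
      refine iff_of_false (fun h => h) fun h => ?_
      have hs := star_of_out _ (.inl ⟨hb, hp⟩) h
      have := hs.kindAt
      simp [ho.kindAt] at this
    · intro _ _ _ _ _ h; simp at h
    · intro _ _ _ _ _ h; simp at h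
    · exact fun _ _ _ _ => Iff.rfl
    · intro Γ hi _ a ha
      refine iff_of_false (fun h => ?_) fun h => h
      have hs := star_of_out _ (.inl ⟨ha.1, ha.2.2⟩) h
      obtain ⟨D, hk⟩ := hi.kindAt
      have := hs.kindAt
      simp [hk] at this
    · intro _ _ _ h; simp at h
    · exact fun _ h => h

theorem inv_initial (r : Path) : ∃ V W, (initial π r).Inv π r V W := by
  have hS := sliceInv_initial (π := π) r
  refine ⟨fun _ => sources π r, fun _ => ∅, trivial, ?_, ?_, ?_, ?_, ?_⟩
  rotate_left
  · rintro G rfl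
    exact hS
  · rintro G rfl a
    simp [initial, sources]
  · rintro G rfl a
    simp [initial, sources]
  · intro Θ hΘ
    refine .leaf ?_
    have : ndata π r = wires π (sources π r \ ∅) := by
      ext ⟨l, B⟩
      constructor
      · rintro ⟨h, ho⟩
        exact ⟨⟨.inl ⟨h, _, ho⟩, id⟩, _, ho⟩
      · rintro ⟨⟨⟨h, c, hn⟩ | ⟨p, hp, hs, he⟩, -⟩, e, ho⟩
        · obtain ⟨-, rfl⟩ := hn.unique ho
          exact ⟨h, ho⟩
        · simp only at he ho
          rw [he] at ho
          have := (ho.unique (occursAt_star hs)).1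
          simp at this
    rw [this]
    refine .id ((wires_wf _).union hΘ.1 fun l hl hl' => hΘ.2 l hl' ?_)
    exact (hS.occ l (mem_of_mem_labels_wires hl).1).1
  · rintro t ⟨ht, -⟩
    exact ht

mutual

theorem Step.inv {r : Path} {c c' : Config} (h : Step π r c c') {V W : Addr → Set Pos}
    (hc : c.Inv π r V W) : ∃ V' W', c'.Inv π r V' W' ∧ c'.measure π W' < c.measure π W :=
  match h with
  | .structural ht hm ha hb ho => hc.structural ht hm ha hb ho
  | .circuit hq ho ht => hc.circuit hq ho ht
  | .guard hq hi ht => hc.guard hq hi ht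
  | .enter hq hi _ hb hσ hn ht => hc.enter hq hi hb hσ hn ht
  | .exit hq hi _ hb hp ht => hc.exit hq hi hb hp ht
  | .sync hq hi hg ht h₀ hf₀ h₁ hf₁ =>
    hc.cross hq hi hg ht (h₀.inv (inv_initial _)) hf₀ (h₁.inv (inv_initial _)) hf₁

theorem Run.inv {r : Path} {c c' : Config} (h : Run π r c c') (hc : ∃ V W, c.Inv π r V W) :
    ∃ V W, c'.Inv π r V W :=
  match h with
  | .refl => hc
  | .tail h hs =>
    let ⟨_, _, hi⟩ := h.inv hc
    let ⟨V, W, hi, _⟩ := hs.inv hi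
    ⟨V, W, hi⟩

end

theorem not_exists_infinite_run {r : Path} {c : Config} {V W : Addr → Set Pos}
    (hc : c.Inv π r V W) :
    ¬ ∃ f : ℕ → Config, f 0 = c ∧ ∀ n, Step π r (f n) (f (n + 1)) := by
  suffices H : ∀ n, ∀ {c : Config} {V W : Addr → Set Pos}, c.Inv π r V W → c.measure π W = n →
      ¬ ∃ f : ℕ → Config, f 0 = c ∧ ∀ n, Step π r (f n) (f (n + 1)) from H _ hc rfl
  intro n
  induction n using Nat.strong_induction_on with
  | _ n ih =>
    rintro c V W hc rfl ⟨f, rfl, hf⟩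
    obtain ⟨V', W', hc', hlt⟩ := (hf 0).inv hc
    exact ih _ hlt hc' rfl ⟨fun n => f (n + 1), rfl, fun n => hf (n + 1)⟩

end


/-! ### Absence of deadlocks -/

/-- All the atoms of polarity `e` in a type are marked. -/
def Ty.Full (A : Ty) (e : Bool) (u : List Dir → Prop) : Prop :=
  ∀ s a, A.atomAt s = some (a, e) → u s

/-- The marking `u` of the atoms of a type is compatible with the behaviour of a value of this type:
a function delivers its result when it is given its argument, and then, if its result is given
what it asks for, it gives what its argument asks for. -/
def Ty.Delivers : Ty → (List Dir → Prop) → Prop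
  | .atom _, u => u []
  | .tensor A B, u => A.Delivers (fun s => u (.L :: s)) ∧ B.Delivers fun s => u (.R :: s)
  | .lolli A B, u => A.Delivers (fun s => u (.L :: s)) →
      B.Delivers (fun s => u (.R :: s)) ∧
        (B.Full false (fun s => u (.R :: s)) → A.Full false fun s => u (.L :: s))

theorem Ty.full_lolli {A B : Ty} {e : Bool} {u : List Dir → Prop} : (Ty.lolli A B).Full e u ↔
    A.Full (!e) (fun s => u (.L :: s)) ∧ B.Full e fun s => u (.R :: s) := by
  constructor
  · intro h
    exact ⟨fun s a hs => h _ a (Ty.atomAt_lolli_left.2 hs), fun s a hs => h (.R :: s) a hs⟩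
  · rintro ⟨h₁, h₂⟩ (_ | ⟨_ | _, s⟩) a hs
    · simp [Ty.atomAt] at hs
    · exact h₁ s a (Ty.atomAt_lolli_left.1 hs)
    · exact h₂ s a hs

theorem Ty.full_tensor {A B : Ty} {e : Bool} {u : List Dir → Prop} : (Ty.tensor A B).Full e u ↔
    A.Full e (fun s => u (.L :: s)) ∧ B.Full e fun s => u (.R :: s) := by
  constructor
  · intro h
    exact ⟨fun s a hs => h (.L :: s) a hs, fun s a hs => h (.R :: s) a hs⟩
  · rintro ⟨h₁, h₂⟩ (_ | ⟨_ | _, s⟩) a hs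
    · simp [Ty.atomAt] at hs
    · exact h₁ s a hs
    · exact h₂ s a hs

theorem Ty.delivers_full (A : Ty) : ∀ u : List Dir → Prop,
    (A.Full true u → A.Delivers u) ∧ (A.Delivers u → A.Full false u → A.Full true u) := by
  induction A with
  | atom a =>
    refine fun u => ⟨fun h => h [] a rfl, fun h _ s b hs => ?_⟩
    cases s
    · exact h
    · simp [Ty.atomAt] at hs
  | lolli A B ihA ihB =>
    intro u
    simp only [Ty.full_lolli, Ty.Delivers, Bool.not_true, Bool.not_false]
    exact ⟨fun h _ => ⟨(ihB _).1 h.2, fun _ => h.1⟩, fun h hn =>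
      have h' := h ((ihA _).1 hn.1)
      ⟨h'.2 hn.2, (ihB _).2 h'.1 hn.2⟩⟩
  | tensor A B ihA ihB =>
    intro u
    simp only [Ty.full_tensor, Ty.Delivers]
    exact ⟨fun h => ⟨(ihA _).1 h.1, (ihB _).1 h.2⟩,
      fun h hn => ⟨(ihA _).2 h.1 hn.1, (ihB _).2 h.2 hn.2⟩⟩

theorem delivers_tensorList {u : List Dir → Prop} {Bs : List BTy}
    (h : (tensorList Bs).Delivers u) : (tensorList Bs).Full true u :=
  ((tensorList Bs).delivers_full u).2 h fun _ _ hs => absurd (polarity_tensorList hs) (by simp)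

section

variable {Δ₀ : Ctx} {M₀ : Tm} {A₀ : Ty} (π : Der Δ₀ M₀ A₀)

/-- The set `V` of positions is closed under the rules in the part of the sub-derivation `r` that
is opened by the address `G`. -/
structure Settled (r : Path) (G : Addr) (V : Set Pos) : Prop where
  func : ∀ l, (l, false) ∈ G → (l, true) ∉ G
  link : ∀ {q k p p'}, r <+: q → Opened π r q G → π.kindAt q = some k → k.link p = some p' →
    (p.place q ∈ V ↔ p'.place q ∈ V)
  op : ∀ {q o}, r <+: q → IsOp π q o → (∀ a : Pos, a.node = q → IsNeg π a → a ∈ V) →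
    ∀ a : Pos, a.node = q → IsPos π a → a ∈ V
  ite : ∀ {q Γ}, r <+: q → IsIte π q Γ → guardPos q ∈ V →
    (∃ b, (guardPos q, b) ∈ G ∧
      ∀ σ s, BranchSlot Γ σ → (⟨q, σ, s⟩ ∈ V ↔ ⟨branch q b, σ, s⟩ ∈ V)) ∨
    (∀ b, (guardPos q, b) ∉ G) ∧ ∀ a ∈ positions π, a.node = q → BranchSlot Γ a.slot → a ∈ V
  star : ∀ {q}, r <+: q → IsStar π q → ⟨q, .concl, []⟩ ∈ V

/-- Every opened position above the node `q` belongs to `V`. -/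
def Covers (r : Path) (G : Addr) (V : Set Pos) (q : Path) : Prop :=
  ∀ a ∈ positions π, q <+: a.node → Opened π r a.node G → a ∈ V

/-- The marking of the atoms of a formula by a set of positions. -/
def marking (V : Set Pos) (q : Path) (σ : Slot) (s : List Dir) : Prop := ⟨q, σ, s⟩ ∈ V

variable {π} {r : Path} {G : Addr} {V : Set Pos}

theorem exists_premise {q : Path} {N : Node} (hN : π.sub q = some N) {i : ℕ} {a : Pos}
    (ha : a ∈ positions π) (hi : q ++ [i] <+: a.node) : ∃ N', N.der.premise i = some N' := by
  obtain ⟨p, hp⟩ := hi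
  obtain ⟨_, _, N₁, h₁, -⟩ := ha
  rw [← hp, Der.sub_append, Der.sub_snoc hN] at h₁
  cases h : N.der.premise i <;> simp_all

/-- The rules whose conclusion is linked to the premises only. -/
def Kind.Inner : Kind → Prop
  | .lam _ _ | .app _ _ | .letStar _ _ | .pair _ _ | .letPair _ _ _ _ => True
  | _ => False

theorem Kind.Inner.link_top {k : Kind} (hk : k.Inner) {σ : Slot} {s : List Dir} {p : Port}
    (h : k.link (.top σ s) = some p) : ∃ i σ' s', p = .prem i σ' s' := by
  unfold Kind.link at h
  split at h <;> (first | contradiction | skip) <;> rename_i hp hd <;>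
    (try split_ifs at h) <;> cases h <;> cases hd <;>
    exact ⟨_, _, _, rfl⟩

theorem prefix_iff_eq_or_snoc {q p : Path} (h : q <+: p) : p = q ∨ ∃ i, q ++ [i] <+: p := by
  obtain ⟨_ | ⟨i, t⟩, rfl⟩ := h
  · exact .inl (List.append_nil q)
  · exact .inr ⟨i, t, by simp⟩

theorem Settled.covers (hV : Settled π r G V) {q : Path} (hq : r <+: q) {N : Node}
    (hN : π.sub q = some N) (hk : N.der.kind.Inner)
    (h : ∀ i N', N.der.premise i = some N' → Covers π r G V (q ++ [i])) : Covers π r G V q := by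
  have hkq := Der.kindAt_of_sub hN
  have hch : ∀ a ∈ positions π, ∀ i, q ++ [i] <+: a.node → Opened π r a.node G → a ∈ V := by
    intro a ha i hi ho
    obtain ⟨N', hN'⟩ := exists_premise hN ha hi
    exact h i N' hN' a ha hi ho
  intro a ha hqa ho
  rcases prefix_iff_eq_or_snoc hqa with he | ⟨i, hi⟩
  · obtain ⟨q', σ, s⟩ := a
    obtain rfl : q' = q := he
    obtain ⟨c, e, hocc⟩ := ha
    have hc : Port.Carries π q' (.top σ s) c !e := by simpa [Port.Carries] using hocc
    rcases hc.link_or_special hkq with ⟨p', hp'⟩ | hsp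
    · refine (hV.link hq ho hkq hp').2 ?_
      have hc' := hc.link hkq hp'
      have hl' := Kind.link_symm (Der.kindAt_valid hkq) hp'
      have ho' := (opened_place_iff hkq hl').2 ho
      obtain ⟨i, σ', s', rfl⟩ := hk.link_top hp'
      exact hch _ ⟨_, hc'.occursAt⟩ i List.prefix_rfl ho'
    · cases hkk : N.der.kind <;> simp only [hkk, Kind.Inner] at hk <;> rw [hkk] at hsp <;>
        cases hsp
  · exact hch a ha i hi ho

theorem opened_premise {q : Path} (ho : Opened π r q G) {N : Node} (hN : π.sub q = some N)
    (hk : N.der.kind.Inner) (i : ℕ) : Opened π r (q ++ [i]) G := by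
  refine ho.snoc fun Γ b _ hi _ => ?_
  obtain ⟨D, hD⟩ := hi.kindAt
  rw [Der.kindAt_of_sub hN, Option.some.injEq] at hD
  simp [hD, Kind.Inner] at hk

/-- In a set of positions that is closed under the rules, a sub-derivation delivers its conclusion
if its hypotheses are delivered, and it uses all its positions if its conclusion is used. -/
theorem Settled.delivers (hV : Settled π r G V) {Δ : Ctx} {M : Tm} {A : Ty} (d : Der Δ M A) :
    ∀ {q : Path}, r <+: q → Opened π r q G → π.sub q = some ⟨Δ, M, A, d⟩ →
      (∀ x B, (x, B) ∈ Δ → B.Delivers (marking V q (.hyp x))) →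
      A.Delivers (marking V q .concl) ∧
        (A.Full false (marking V q .concl) → Covers π r G V q) := by
  induction d with
  | var x A hΞ =>
    intro q hq ho hN hyp
    subst hΞ
    have hk := Der.kindAt_of_sub hN
    have heq : marking V q .concl = marking V q (.hyp x) := by
      funext s
      exact propext (hV.link (p := .top .concl s) hq ho hk rfl)
    have hd := hyp x A (by simp)
    refine ⟨heq ▸ hd, fun hf => ?_⟩
    have hf' := (A.delivers_full _).2 (heq ▸ hd) hf
    have hall : ∀ s a e, A.atomAt s = some (a, e) → marking V q .concl s := by
      intro s a e hs
      cases e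
      · exact hf s a hs
      · exact hf' s a hs
    intro a ha hqa ho'
    rcases prefix_iff_eq_or_snoc hqa with he | ⟨i, hi⟩
    · obtain ⟨_, σ, s⟩ := a
      obtain rfl : _ = q := he
      obtain ⟨c, e, hocc⟩ := ha
      cases σ with
      | concl => exact hall s c e ((occursAt_concl hN).1 hocc)
      | hyp y =>
        obtain ⟨B, hB, hs⟩ := (occursAt_hyp hN).1 hocc
        simp only [Finset.mem_singleton, Prod.mk.injEq] at hB
        obtain ⟨rfl, rfl⟩ := hB
        have := hall s _ _ hs
        rwa [heq] at this
    · obtain ⟨N', hN'⟩ := exists_premise hN ha hi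
      simp [Der.premise] at hN'
  | star hΞ =>
    intro q hq ho hN hyp
    subst hΞ
    have hst := hV.star hq ⟨_, _, hN⟩
    refine ⟨hst, fun _ a ha hqa _ => ?_⟩
    rcases prefix_iff_eq_or_snoc hqa with he | ⟨i, hi⟩
    · obtain ⟨_, σ, s⟩ := a
      obtain rfl : _ = q := he
      obtain ⟨c, e, hocc⟩ := ha
      cases σ with
      | concl =>
        have := (occursAt_concl hN).1 hocc
        cases s
        · exact hst
        · simp [Ty.atomAt] at this
      | hyp y =>
        obtain ⟨B, hB, hs⟩ := (occursAt_hyp hN).1 hocc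
        simp at hB
    · obtain ⟨N', hN'⟩ := exists_premise hN ha hi
      simp [Der.premise] at hN'
  | op c hΞ =>
    intro q hq ho hN hyp
    have hop : IsOp π q c := ⟨_, hΞ, hN⟩
    have key : (∀ a : Pos, a.node = q → IsNeg π a → a ∈ V) →
        (tensorList c.outTy).Full true fun s => marking V q .concl (.R :: s) :=
      fun h s a hs => hV.op hq hop h ⟨q, .concl, .R :: s⟩ rfl ((isPos_op hop).2 ⟨rfl, s, rfl, a, hs⟩)
    have neg_of_full : (tensorList c.inTy).Full true (fun s => marking V q .concl (.L :: s)) →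
        ∀ a : Pos, a.node = q → IsNeg π a → a ∈ V := by
      rintro h ⟨_, σ, s⟩ rfl hn
      obtain ⟨rfl, s', rfl, a, hs⟩ := (isNeg_op hop).1 hn
      exact h s' a hs
    refine ⟨fun hd => ⟨?_, fun _ s a hs => absurd (polarity_tensorList hs) (by simp)⟩, ?_⟩
    · exact (Ty.delivers_full _ _).1 (key (neg_of_full (delivers_tensorList hd)))
    · intro hf a ha hqa _
      have hneg := neg_of_full (Ty.full_lolli.1 hf).1
      rcases prefix_iff_eq_or_snoc hqa with he | ⟨i, hi⟩
      · obtain ⟨c', e, hocc⟩ := ha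
        cases e
        · exact hneg a he ⟨_, hocc⟩
        · exact hV.op hq hop hneg a he ⟨_, hocc⟩
      · obtain ⟨N', hN'⟩ := exists_premise hN ha hi
        simp [Der.premise] at hN'
  | @lam Δ Ξ M B x A hΞ hx d ih =>
    intro q hq ho hN hyp
    subst hΞ
    have hk := Der.kindAt_of_sub hN
    have hq0 : r <+: q ++ [0] := hq.trans (List.prefix_append _ _)
    have hN0 := Der.sub_snoc hN 0
    have hL : (fun s => marking V q .concl (.L :: s)) = marking V (q ++ [0]) (.hyp x) := by
      funext s
      exact propext (hV.link (p := .top .concl (.L :: s)) hq ho hk rfl)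
    have hR : (fun s => marking V q .concl (.R :: s)) = marking V (q ++ [0]) .concl := by
      funext s
      exact propext (hV.link (p := .top .concl (.R :: s)) hq ho hk rfl)
    have hH : ∀ y ∈ Ctx.dom Δ, marking V (q ++ [0]) (.hyp y) = marking V q (.hyp y) := by
      intro y hy
      funext s
      exact propext (hV.link (p := .top (.hyp y) s) (p' := .prem 0 (.hyp y) s) hq ho hk
        (by simp [Der.kind, Kind.link, hy])).symm
    have main : A.Delivers (fun s => marking V q .concl (.L :: s)) →
        B.Delivers (fun s => marking V q .concl (.R :: s)) ∧
        (B.Full false (fun s => marking V q .concl (.R :: s)) →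
          Covers π r G V (q ++ [0])) := by
      intro hA
      rw [hR]
      refine ih hq0 (opened_premise ho hN trivial 0) hN0 fun y C hy => ?_
      rcases Finset.mem_insert.1 hy with hy | hy
      · simp only [Prod.mk.injEq] at hy
        obtain ⟨rfl, rfl⟩ := hy
        rwa [← hL]
      · rw [hH y (Ctx.mem_dom_of_mem hy)]
        exact hyp y C hy
    refine ⟨fun hA => ⟨(main hA).1, fun hf s a hs => ?_⟩, fun hf => ?_⟩
    · have hocc : OccursAt π ⟨q ++ [0], .hyp x, s⟩ a true :=
        (occursAt_hyp hN0).2 ⟨A, Finset.mem_insert_self _ _, hs⟩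
      have hm : marking V (q ++ [0]) (.hyp x) s := (main hA).2 hf _ ⟨_, _, hocc⟩ List.prefix_rfl
        (opened_premise ho hN trivial 0)
      rwa [← hL] at hm
    · have hf' := Ty.full_lolli.1 hf
      have hc := (main ((A.delivers_full _).1 hf'.1)).2 hf'.2
      refine hV.covers hq hN trivial fun i N' hi => ?_
      obtain _ | i := i
      · exact hc
      · simp [Der.premise] at hi
  | @app Δ Γ Ξ M N A B hΞ hd d₀ d₁ ih₀ ih₁ =>
    intro q hq ho hN hyp
    subst hΞ
    have hk := Der.kindAt_of_sub hN
    have hq' : ∀ i, r <+: q ++ [i] := fun i => hq.trans (List.prefix_append _ _)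
    have ho' := opened_premise ho hN trivial
    have hC : marking V q .concl = fun s => marking V (q ++ [0]) .concl (.R :: s) := by
      funext s
      exact propext (hV.link (p := .top .concl s) hq ho hk rfl)
    have hcut : (fun s => marking V (q ++ [0]) .concl (.L :: s)) = marking V (q ++ [1]) .concl := by
      funext s
      exact propext (hV.link (p := .prem 0 .concl (.L :: s)) hq ho hk rfl)
    have h₀ := ih₀ (hq' 0) (ho' 0) (Der.sub_snoc hN 0) fun y C hy => by
      have : marking V (q ++ [0]) (.hyp y) = marking V q (.hyp y) := by
        funext s
        exact propext (hV.link (p := .top (.hyp y) s) (p' := .prem 0 (.hyp y) s) hq ho hk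
          (by simp [Der.kind, Kind.link, Ctx.mem_dom_of_mem hy])).symm
      rw [this]
      exact hyp y C (Finset.mem_union_left _ hy)
    have h₁ := ih₁ (hq' 1) (ho' 1) (Der.sub_snoc hN 1) fun y C hy => by
      have : marking V (q ++ [1]) (.hyp y) = marking V q (.hyp y) := by
        funext s
        exact propext (hV.link (p := .top (.hyp y) s) (p' := .prem 1 (.hyp y) s) hq ho hk
          (by simp [Der.kind, Kind.link, Ctx.mem_dom_of_mem hy,
            Finset.disjoint_right.1 hd (Ctx.mem_dom_of_mem hy)])).symm
      rw [this]
      exact hyp y C (Finset.mem_union_right _ hy)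
    obtain ⟨hB, hA⟩ := h₀.1 (by rw [hcut]; exact h₁.1)
    rw [hC]
    refine ⟨hB, fun hf => hV.covers hq hN trivial fun i N' hi => ?_⟩
    have hA' := hA hf
    have hA'' := (A.delivers_full _).2 (hcut ▸ h₁.1) hA'
    obtain _ | _ | i := i
    · exact h₀.2 (Ty.full_lolli.2 ⟨hA'', hf⟩)
    · exact h₁.2 (hcut ▸ hA')
    · simp [Der.premise] at hi
  | @letStar Δ Γ Ξ M N A hΞ hd d₀ d₁ ih₀ ih₁ =>
    intro q hq ho hN hyp
    subst hΞ
    have hk := Der.kindAt_of_sub hN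
    have hq' : ∀ i, r <+: q ++ [i] := fun i => hq.trans (List.prefix_append _ _)
    have ho' := opened_premise ho hN trivial
    have hC : marking V q .concl = marking V (q ++ [1]) .concl := by
      funext s
      exact propext (hV.link (p := .top .concl s) hq ho hk rfl)
    have h₀ := ih₀ (hq' 0) (ho' 0) (Der.sub_snoc hN 0) fun y C hy => by
      have : marking V (q ++ [0]) (.hyp y) = marking V q (.hyp y) := by
        funext s
        exact propext (hV.link (p := .top (.hyp y) s) (p' := .prem 0 (.hyp y) s) hq ho hk
          (by simp [Der.kind, Kind.link, Ctx.mem_dom_of_mem hy])).symm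
      rw [this]
      exact hyp y C (Finset.mem_union_left _ hy)
    have h₁ := ih₁ (hq' 1) (ho' 1) (Der.sub_snoc hN 1) fun y C hy => by
      have : marking V (q ++ [1]) (.hyp y) = marking V q (.hyp y) := by
        funext s
        exact propext (hV.link (p := .top (.hyp y) s) (p' := .prem 1 (.hyp y) s) hq ho hk
          (by simp [Der.kind, Kind.link, Ctx.mem_dom_of_mem hy,
            Finset.disjoint_right.1 hd (Ctx.mem_dom_of_mem hy)])).symm
      rw [this]
      exact hyp y C (Finset.mem_union_right _ hy)
    rw [hC]
    refine ⟨h₁.1, fun hf => hV.covers hq hN trivial fun i N' hi => ?_⟩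
    obtain _ | _ | i := i
    · refine h₀.2 fun s a hs => ?_
      cases s <;> simp [Ty.atomAt] at hs
    · exact h₁.2 hf
    · simp [Der.premise] at hi
  | @pair Δ Γ Ξ M N A B hΞ hd d₀ d₁ ih₀ ih₁ =>
    intro q hq ho hN hyp
    subst hΞ
    have hk := Der.kindAt_of_sub hN
    have hq' : ∀ i, r <+: q ++ [i] := fun i => hq.trans (List.prefix_append _ _)
    have ho' := opened_premise ho hN trivial
    have hL : (fun s => marking V q .concl (.L :: s)) = marking V (q ++ [0]) .concl := by
      funext s
      exact propext (hV.link (p := .top .concl (.L :: s)) hq ho hk rfl)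
    have hR : (fun s => marking V q .concl (.R :: s)) = marking V (q ++ [1]) .concl := by
      funext s
      exact propext (hV.link (p := .top .concl (.R :: s)) hq ho hk rfl)
    have h₀ := ih₀ (hq' 0) (ho' 0) (Der.sub_snoc hN 0) fun y C hy => by
      have : marking V (q ++ [0]) (.hyp y) = marking V q (.hyp y) := by
        funext s
        exact propext (hV.link (p := .top (.hyp y) s) (p' := .prem 0 (.hyp y) s) hq ho hk
          (by simp [Der.kind, Kind.link, Ctx.mem_dom_of_mem hy])).symm
      rw [this]
      exact hyp y C (Finset.mem_union_left _ hy)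
    have h₁ := ih₁ (hq' 1) (ho' 1) (Der.sub_snoc hN 1) fun y C hy => by
      have : marking V (q ++ [1]) (.hyp y) = marking V q (.hyp y) := by
        funext s
        exact propext (hV.link (p := .top (.hyp y) s) (p' := .prem 1 (.hyp y) s) hq ho hk
          (by simp [Der.kind, Kind.link, Ctx.mem_dom_of_mem hy,
            Finset.disjoint_right.1 hd (Ctx.mem_dom_of_mem hy)])).symm
      rw [this]
      exact hyp y C (Finset.mem_union_right _ hy)
    rw [Ty.Delivers, Ty.full_tensor, hL, hR]
    refine ⟨⟨h₀.1, h₁.1⟩, fun hf => hV.covers hq hN trivial fun i N' hi => ?_⟩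
    obtain _ | _ | i := i
    · exact h₀.2 hf.1
    · exact h₁.2 hf.2
    · simp [Der.premise] at hi
  | @letPair Δ Γ Γ' Ξ M N C x y A B hΞ hd hΓ' hxy hx hy d₀ d₁ ih₀ ih₁ =>
    intro q hq ho hN hyp
    subst hΞ
    have hk := Der.kindAt_of_sub hN
    have hq' : ∀ i, r <+: q ++ [i] := fun i => hq.trans (List.prefix_append _ _)
    have ho' := opened_premise ho hN trivial
    have hN1 := Der.sub_snoc hN 1
    have hC : marking V q .concl = marking V (q ++ [1]) .concl := by
      funext s
      exact propext (hV.link (p := .top .concl s) hq ho hk rfl)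
    have hL : (fun s => marking V (q ++ [0]) .concl (.L :: s)) =
        marking V (q ++ [1]) (.hyp x) := by
      funext s
      exact propext (hV.link (p := .prem 0 .concl (.L :: s)) hq ho hk rfl)
    have hR : (fun s => marking V (q ++ [0]) .concl (.R :: s)) =
        marking V (q ++ [1]) (.hyp y) := by
      funext s
      exact propext (hV.link (p := .prem 0 .concl (.R :: s)) hq ho hk rfl)
    have h₀ := ih₀ (hq' 0) (ho' 0) (Der.sub_snoc hN 0) fun z C hz => by
      have : marking V (q ++ [0]) (.hyp z) = marking V q (.hyp z) := by
        funext s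
        exact propext (hV.link (p := .top (.hyp z) s) (p' := .prem 0 (.hyp z) s) hq ho hk
          (by simp [Der.kind, Kind.link, Ctx.mem_dom_of_mem hz])).symm
      rw [this]
      exact hyp z C (Finset.mem_union_left _ hz)
    have hAB := h₀.1
    rw [Ty.Delivers, hL, hR] at hAB
    have h₁ := ih₁ (hq' 1) (ho' 1) hN1 fun z C hz => by
      rw [hΓ'] at hz
      rcases Finset.mem_insert.1 hz with hz | hz
      · obtain ⟨rfl, rfl⟩ := Prod.mk.inj hz
        exact hAB.1
      rcases Finset.mem_insert.1 hz with hz | hz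
      · obtain ⟨rfl, rfl⟩ := Prod.mk.inj hz
        exact hAB.2
      have : marking V (q ++ [1]) (.hyp z) = marking V q (.hyp z) := by
        funext s
        exact propext (hV.link (p := .top (.hyp z) s) (p' := .prem 1 (.hyp z) s) hq ho hk
          (by simp [Der.kind, Kind.link, Ctx.mem_dom_of_mem hz,
            Finset.disjoint_right.1 hd (Ctx.mem_dom_of_mem hz)])).symm
      rw [this]
      exact hyp z C (Finset.mem_union_right _ hz)
    rw [hC]
    refine ⟨h₁.1, fun hf => ?_⟩
    have hcov := h₁.2 hf
    refine hV.covers hq hN trivial fun i N' hi => ?_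
    obtain _ | _ | i := i
    · refine h₀.2 (Ty.full_tensor.2 ⟨?_, ?_⟩)
      · rw [hL]
        refine fun s a hs => hcov _ ⟨a, true, ?_⟩ List.prefix_rfl (ho' 1)
        exact (occursAt_hyp hN1).2 ⟨A, by simp [hΓ'], hs⟩
      · rw [hR]
        refine fun s a hs => hcov _ ⟨a, true, ?_⟩ List.prefix_rfl (ho' 1)
        exact (occursAt_hyp hN1).2 ⟨B, by simp [hΓ'], hs⟩
    · exact hcov
    · simp [Der.premise] at hi
  | @ite Δ Γ Ξ M N P A hΞ hd d₀ d₁ d₂ ih₀ ih₁ ih₂ =>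
    intro q hq ho hN hyp
    have hi : IsIte π q Γ := ⟨_, _, _, _, _, _, hΞ, hd, d₀, d₁, d₂, hN⟩
    subst hΞ
    have hk := Der.kindAt_of_sub hN
    have hq' : ∀ i, r <+: q ++ [i] := fun i => hq.trans (List.prefix_append _ _)
    have ho0 : Opened π r (q ++ [0]) G := opened_guardPos_iff.2 ho
    have h₀ := ih₀ (hq' 0) ho0 (Der.sub_snoc hN 0) fun y C hy => by
      have : marking V (q ++ [0]) (.hyp y) = marking V q (.hyp y) := by
        funext s
        exact propext (hV.link (p := .top (.hyp y) s) (p' := .prem 0 (.hyp y) s) hq ho hk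
          (by simp [Der.kind, Kind.link, Ctx.mem_dom_of_mem hy])).symm
      rw [this]
      exact hyp y C (Finset.mem_union_left _ hy)
    have hcov0 : Covers π r G V (q ++ [0]) := h₀.2 fun s a hs => by
      cases s <;> simp [Ty.atomAt] at hs
    have hguard : guardPos q ∈ V := h₀.1
    have reduce : (∀ a ∈ positions π, a.node = q → BranchSlot Γ a.slot → a ∈ V) →
        (∀ b, (guardPos q, b) ∈ G → Covers π r G V (branch q b)) → Covers π r G V q := by
      intro hsh hbr a ha hqa hoa
      rcases prefix_iff_eq_or_snoc hqa with he | ⟨i, hia⟩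
      · by_cases hσ : BranchSlot Γ a.slot
        · exact hsh a ha he hσ
        · obtain ⟨_, σ, s⟩ := a
          obtain rfl : _ = q := he
          obtain ⟨c, e, hocc⟩ := ha
          cases σ with
          | concl => exact absurd trivial hσ
          | hyp y =>
            obtain ⟨B, hB, hs⟩ := (occursAt_hyp hN).1 hocc
            have hy : y ∈ Ctx.dom Δ := by
              rcases Finset.mem_union.1 hB with hB | hB
              · exact Ctx.mem_dom_of_mem hB
              · exact absurd (Ctx.mem_dom_of_mem hB) hσ
            have hl : Kind.link (Der.ite rfl hd d₀ d₁ d₂).kind (.top (.hyp y) s) =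
                some (.prem 0 (.hyp y) s) := by
              simp [Der.kind, Kind.link, hy]
            refine (hV.link hq ho hk hl).2 (hcov0 _ ⟨c, e, ?_⟩ List.prefix_rfl ho0)
            refine (occursAt_hyp (Der.sub_snoc hN 0)).2 ⟨B, ?_, hs⟩
            exact (Ctx.mem_union_left_iff hd hy B).1 hB
      · obtain ⟨N', hN'⟩ := exists_premise hN ha hia
        have hbranch : ∀ b, branch q b <+: a.node → a ∈ V := fun b hb =>
          hbr b (hoa q Γ b hq hi hb) a ha hb hoa
        obtain _ | _ | _ | i := i
        · exact hcov0 a ha hia hoa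
        · exact hbranch false hia
        · exact hbranch true hia
        · simp [Der.premise] at hN'
    rcases hV.ite hq hi hguard with ⟨b, hb, heq⟩ | ⟨hnone, hall⟩
    · have hob := ho.branch hb
      have hC : marking V q .concl = marking V (branch q b) .concl := by
        funext s
        exact propext (heq .concl s trivial)
      have hyp' : ∀ y C, (y, C) ∈ Γ → C.Delivers (marking V (branch q b) (.hyp y)) := by
        intro y C hy
        have : marking V (branch q b) (.hyp y) = marking V q (.hyp y) := by
          funext s
          exact propext (heq (.hyp y) s (Ctx.mem_dom_of_mem hy)).symm
        rw [this]
        exact hyp y C (Finset.mem_union_right _ hy)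
      have hbr : A.Delivers (marking V (branch q b) .concl) ∧
          (A.Full false (marking V (branch q b) .concl) → Covers π r G V (branch q b)) := by
        cases b
        · exact ih₁ (hq' 1) hob (Der.sub_snoc hN 1) hyp'
        · exact ih₂ (hq' 2) hob (Der.sub_snoc hN 2) hyp'
      rw [hC]
      refine ⟨hbr.1, fun hf => reduce ?_ ?_⟩
      · rintro ⟨_, σ, s⟩ ⟨c, e, hocc⟩ rfl hσ
        refine (heq σ s hσ).2 (hbr.2 hf _ ⟨c, e, ?_⟩ List.prefix_rfl hob)
        exact (occursAt_branch hi).2 ⟨hσ, hocc⟩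
      · intro b' hb'
        have : b' = b := by
          cases b <;> cases b'
          · rfl
          · exact absurd hb' (hV.func _ hb)
          · exact absurd hb (hV.func _ hb')
          · rfl
        rw [this]
        exact hbr.2 hf
    · refine ⟨(A.delivers_full _).1 fun s a hs => ?_, fun _ => reduce hall ?_⟩
      · exact hall ⟨q, .concl, s⟩ ⟨a, true, (occursAt_concl hN).2 hs⟩ rfl trivial
      · exact fun b hb => absurd hb (hnone b)

end


/-! ### Stuck configurations are final -/

section

variable {Δ₀ : Ctx} {M₀ : Tm} {A₀ : Ty} {π : Der Δ₀ M₀ A₀}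

theorem IsStar.not_isNeg {a : Pos} (h : IsStar π a.node) : ¬ IsNeg π a := by
  obtain ⟨_, σ, s⟩ := a
  obtain ⟨_, rfl, hN⟩ := h
  rintro ⟨c, ho⟩
  cases σ with
  | concl =>
    have := (occursAt_concl hN).1 ho
    cases s <;> simp [Ty.atomAt] at this
  | hyp y =>
    obtain ⟨B, hB, -⟩ := (occursAt_hyp hN).1 ho
    simp at hB

variable {r : Path} {c : Config} {V W : Addr → Set Pos} {G : Addr} {q : Path}

theorem Config.Inv.link_of_stuck (h : c.Inv π r V W) (hst : ¬ ∃ c', Step π r c c')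
    (hG : G ∈ c.circ.addrs) (hq : r <+: q) (ho : Opened π r q G) {k : Kind}
    (hk : π.kindAt q = some k) {p p' : Port} (hl : k.link p = some p') {a : Atom}
    (hc : p.Carries π q a true) (hV : p.place q ∈ V G) : p.place q ∈ W G := by
  by_contra hW
  exact hst ⟨_, .structural ((h.off G hG _).2 ⟨hV, hW⟩) (move_of_link hk hl hc) (prefix_place hq)
    (prefix_place hq) ((opened_place_iff hk hl).2 ho)⟩

theorem Config.Inv.op_of_stuck (h : c.Inv π r V W) (hst : ¬ ∃ c', Step π r c c')
    (hG : G ∈ c.circ.addrs) (hq : r <+: q) {o : Op} (hi : IsOp π q o)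
    (hV : ∀ a : Pos, a.node = q → IsNeg π a → a ∈ V G) {a : Pos} (ha : a.node = q)
    (hn : IsNeg π a) : a ∈ W G := by
  by_contra hW
  obtain ⟨b, hb, hp⟩ := exists_isPos_op hi
  have hloc := (h.slice G hG).loc q hq
  refine hst ⟨_, .circuit hq hi fun a' ha' hn' => (h.off G hG _).2 ⟨hV a' ha' hn', fun hW' => hW ?_⟩⟩
  exact (hloc.op hi ha hn hb hp).2 ((hloc.op hi ha' hn' hb hp).1 hW')

theorem Config.Inv.guard_of_stuck (h : c.Inv π r V W) (hst : ¬ ∃ c', Step π r c c')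
    (hG : G ∈ c.circ.addrs) (hq : r <+: q) {Γ : Ctx} (hi : IsIte π q Γ)
    (hV : guardPos q ∈ V G) : guardPos q ∈ W G := by
  by_contra hW
  exact hst ⟨_, .guard hq hi ((h.off G hG _).2 ⟨hV, hW⟩)⟩

theorem Config.Inv.enter_of_stuck (h : c.Inv π r V W) (hst : ¬ ∃ c', Step π r c c')
    (hG : G ∈ c.circ.addrs) (hq : r <+: q) {Γ : Ctx} (hi : IsIte π q Γ) {b : Bool}
    (hb : (guardPos q, b) ∈ G) {σ : Slot} {s : List Dir} (hσ : BranchSlot Γ σ)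
    (hn : IsNeg π ⟨q, σ, s⟩) (hV : ⟨q, σ, s⟩ ∈ V G) : ⟨q, σ, s⟩ ∈ W G := by
  by_contra hW
  have hg := (h.on G hG _).2 ⟨((h.slice G hG).loc q hq).read hi hb, q, Γ, hq, hi, rfl⟩
  exact hst ⟨_, .enter hq hi hg hb hσ hn ((h.off G hG _).2 ⟨hV, hW⟩)⟩

theorem Config.Inv.exit_of_stuck (h : c.Inv π r V W) (hst : ¬ ∃ c', Step π r c c')
    (hG : G ∈ c.circ.addrs) (hq : r <+: q) {Γ : Ctx} (hi : IsIte π q Γ) {b : Bool}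
    (hb : (guardPos q, b) ∈ G) {σ : Slot} {s : List Dir} (hp : IsPos π ⟨branch q b, σ, s⟩)
    (hV : ⟨branch q b, σ, s⟩ ∈ V G) : ⟨branch q b, σ, s⟩ ∈ W G := by
  by_contra hW
  have hg := (h.on G hG _).2 ⟨((h.slice G hG).loc q hq).read hi hb, q, Γ, hq, hi, rfl⟩
  exact hst ⟨_, .exit hq hi hg hb hp ((h.off G hG _).2 ⟨hV, hW⟩)⟩

theorem Config.Inv.settled (h : c.Inv π r V W) (hst : ¬ ∃ c', Step π r c c')
    (hG : G ∈ c.circ.addrs) : Settled π r G (V G) := by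
  have hS := h.slice G hG
  have hlink : ∀ {q k p p'}, r <+: q → Opened π r q G → π.kindAt q = some k →
      k.link p = some p' → p.place q ∈ V G → p'.place q ∈ V G := by
    intro q k p p' hq ho hk hl hV
    have hl' := Kind.link_symm (Der.kindAt_valid hk) hl
    obtain ⟨-, a, e, hocc⟩ := hS.occ _ hV
    obtain ⟨e, hc⟩ : ∃ e, p.Carries π q a e := by
      cases p
      · exact ⟨!e, by rw [Port.Carries, Bool.not_not]; exact hocc⟩
      · exact ⟨e, hocc⟩
    have hc' := hc.link hk hl
    cases e
    · exact hS.sub (((hS.loc q hq).link hk hl' hc').2 hV)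
    · exact ((hS.loc q hq).link hk hl hc).1 (h.link_of_stuck hst hG hq ho hk hl hc hV)
  refine ⟨hS.func, ?_, ?_, ?_, fun hq hs => hS.star _ hq hs⟩
  · intro q k p p' hq ho hk hl
    exact ⟨hlink hq ho hk hl, hlink hq ho hk (Kind.link_symm (Der.kindAt_valid hk) hl)⟩
  · intro q o hq hi hV b hb hp
    obtain ⟨a, ha, hn⟩ := exists_isNeg_op hi
    exact ((hS.loc q hq).op hi ha hn hb hp).1 (h.op_of_stuck hst hG hq hi hV ha hn)
  · intro q Γ hq hi hg
    have hloc := hS.loc q hq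
    by_cases hex : ∃ b, (guardPos q, b) ∈ G
    · obtain ⟨b, hb⟩ := hex
      refine .inl ⟨b, hb, fun σ s hσ => ⟨fun hV => ?_, fun hV => ?_⟩⟩
      · obtain ⟨-, a, _ | _, hocc⟩ := hS.occ _ hV
        · exact (hloc.enter hi hb hσ ⟨_, hocc⟩).1 (h.enter_of_stuck hst hG hq hi hb hσ ⟨_, hocc⟩ hV)
        · exact hS.sub ((hloc.exit hi hb ((isPos_branch hi).2 ⟨hσ, _, hocc⟩)).2 hV)
      · obtain ⟨-, a, _ | _, hocc⟩ := hS.occ _ hV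
        · exact hS.sub ((hloc.enter hi hb hσ ((isNeg_branch hi).1 ⟨_, hocc⟩).2).2 hV)
        · exact (hloc.exit hi hb ⟨_, hocc⟩).1 (h.exit_of_stuck hst hG hq hi hb ⟨_, hocc⟩ hV)
    · push Not at hex
      have hgW := h.guard_of_stuck hst hG hq hi hg
      refine .inr ⟨hex, ?_⟩
      rintro a ⟨_, _ | _, hocc⟩ ha hσ
      · exact hS.sub ((hloc.closedNeg hi hex a ⟨ha, hσ, _, hocc⟩).2 hgW)
      · exact (hloc.closedPos hi hex a ⟨ha, hσ, _, hocc⟩).2 hgW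

theorem Config.Inv.covers (h : c.Inv π r V W) (hst : ¬ ∃ c', Step π r c c')
    (hG : G ∈ c.circ.addrs) {N : Node} (hN : π.sub r = some N) : Covers π r G (V G) r := by
  have hS := h.slice G hG
  refine ((h.settled hst hG).delivers N.der List.prefix_rfl (opened_self G) hN fun x B hx => ?_).2
    fun s a hs => ?_
  · refine (B.delivers_full _).1 fun s a hs => hS.neg ⟨r, .hyp x, s⟩ rfl ⟨a, ?_⟩
    exact (occursAt_hyp hN).2 ⟨B, hx, hs⟩
  · exact hS.neg ⟨r, .concl, s⟩ rfl ⟨a, (occursAt_concl hN).2 hs⟩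

/-- In a stuck configuration, the tokens whose flag is off stand at final positions. -/
theorem Config.Inv.mem_finalPositions (h : c.Inv π r V W) (hst : ¬ ∃ c', Step π r c c')
    (hG : G ∈ c.circ.addrs) {N : Node} (hN : π.sub r = some N) {a : Pos} (hV : a ∈ V G)
    (hW : a ∉ W G) : a ∈ finalPositions π r G := by
  have hS := h.slice G hG
  have hcov := h.covers hst hG hN
  obtain ⟨hr, d, e, hocc⟩ := hS.occ a hV
  by_cases ho : Opened π r a.node G
  swap
  · obtain ⟨-, hs, he⟩ := hS.unop a hV ho
    exact .inr ⟨_, hr, hs, ho, he⟩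
  cases e
  · exfalso
    obtain ⟨q, σ, s⟩ := a
    have hn : IsNeg π ⟨q, σ, s⟩ := ⟨_, hocc⟩
    obtain ⟨k, hk⟩ := exists_kindAt_of_occursAt hocc
    have hc : Port.Carries π q (.top σ s) d true := by simpa [Port.Carries] using hocc
    rcases hc.link_or_special hk with ⟨p', hl⟩ | hsp
    · exact hW (h.link_of_stuck hst hG hr ho hk hl hc hV)
    · cases hsp with
      | star => exact (isStar_of_kindAt hk).not_isNeg hn
      | op o =>
        refine hW (h.op_of_stuck hst hG hr (isOp_of_kindAt hk) (fun a' ha' hn' => ?_) rfl hn)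
        exact hcov a' ⟨_, _, hn'.choose_spec⟩ (ha' ▸ hr) (ha' ▸ ho)
      | shared D E _ _ hσ =>
        obtain ⟨Γ, rfl, hi⟩ := isIte_of_kindAt hk
        have hσ' := branchSlot_iff.2 hσ
        have hg : guardPos q ∈ V G := hcov _ ⟨_, _, occursAt_guardPos hi⟩
          (hr.trans (List.prefix_append _ _)) (opened_guardPos_iff.2 ho)
        have hloc := hS.loc q hr
        by_cases hex : ∃ b, (guardPos q, b) ∈ G
        · obtain ⟨b, hb⟩ := hex
          exact hW (h.enter_of_stuck hst hG hr hi hb hσ' hn hV)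
        · push Not at hex
          exact hW ((hloc.closedNeg hi hex _ ⟨rfl, hσ', hn⟩).2
            (h.guard_of_stuck hst hG hr hi hg))
  · obtain ⟨p, σ, s⟩ := a
    obtain ⟨t, ht⟩ := hr
    simp only at ht ho
    subst ht
    rcases t.eq_nil_or_concat with rfl | ⟨t, i, rfl⟩
    · exact .inl (.inl (.inl ⟨List.append_nil r, _, hocc⟩))
    simp only [List.concat_eq_append, ← List.append_assoc] at *
    have hr : r <+: r ++ t := List.prefix_append _ _
    generalize r ++ t = q at *
    have hoq : Opened π r q G := ho.of_prefix (List.prefix_append _ _)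
    have hc : Port.Carries π q (.prem i σ s) d true := hocc
    obtain ⟨k, hk⟩ := hc.inp.exists_kindAt
    rcases hc.link_or_special hk with ⟨p', hl⟩ | hsp
    · exact absurd (h.link_of_stuck hst hG hr hoq hk hl hc hV) hW
    · cases hsp with
      | letStar => exact .inl (.inl (.inr ⟨q, hr, isLetStar_of_kindAt hk, hoq, rfl⟩))
      | guard =>
        obtain ⟨Γ, rfl, hi⟩ := isIte_of_kindAt hk
        exact .inl (.inr ⟨q, Γ, hr, hi, hoq, rfl⟩)
      | branch D E b =>
        obtain ⟨Γ, rfl, hi⟩ := isIte_of_kindAt hk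
        have hb := ho q Γ b hr hi List.prefix_rfl
        exact absurd (h.exit_of_stuck hst hG hr hi hb ⟨_, hocc⟩ hV) hW

theorem Config.Inv.positions_eq (h : c.Inv π r V W) (hst : ¬ ∃ c', Step π r c c')
    (hG : G ∈ c.circ.addrs) {N : Node} (hN : π.sub r = some N) :
    c.positions G = finalPositions π r G := by
  have hS := h.slice G hG
  have hcov := h.covers hst hG hN
  ext a
  constructor
  · rintro ⟨_ | _, ht⟩
    · obtain ⟨hV, hW⟩ := (h.off G hG a).1 ht
      exact h.mem_finalPositions hst hG hN hV hW
    · obtain ⟨hW, q, Γ, hq, hi, rfl⟩ := (h.on G hG a).1 ht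
      exact .inl (.inr ⟨q, Γ, hq, hi, hS.opened_of_guardPos hi (hS.sub hW), rfl⟩)
  · rintro (((⟨rfl, hp⟩ | ⟨q, hq, hl, ho, rfl⟩) | ⟨q, Γ, hq, hi, ho, rfl⟩) | ⟨p, hp, hs, ho, rfl⟩)
    · refine ⟨false, (h.off G hG a).2 ⟨?_, hS.pos a rfl hp⟩⟩
      exact hcov a ⟨_, _, hp.choose_spec⟩ List.prefix_rfl (opened_self G)
    · refine ⟨false, (h.off G hG _).2 ⟨?_, (hS.loc q hq).letStar hl⟩⟩
      refine hcov _ ⟨_, _, occursAt_letStar hl⟩ (hq.trans (List.prefix_append _ _)) ?_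
      exact ho.snoc fun Γ b _ hi _ => absurd hl hi.not_isLetStar
    · refine ⟨true, (h.on G hG _).2 ⟨h.guard_of_stuck hst hG hq hi ?_, q, Γ, hq, hi, rfl⟩⟩
      exact hcov _ ⟨_, _, occursAt_guardPos hi⟩ (hq.trans (List.prefix_append _ _))
        (opened_guardPos_iff.2 ho)
    · have hV := hS.star p hp hs
      exact ⟨false, (h.off G hG _).2 ⟨hV, (hS.unop _ hV ho).1⟩⟩

theorem Config.Inv.env_eq (h : c.Inv π r V W) (hst : ¬ ∃ c', Step π r c c')
    (hG : G ∈ c.circ.addrs) {N : Node} (hN : π.sub r = some N) : c.env π G = pdata π r := by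
  have hS := h.slice G hG
  ext ⟨a, B⟩
  constructor
  · rintro ⟨ht, e, hocc⟩
    obtain ⟨hV, hW⟩ := (h.off G hG a).1 ht
    have not_one : ¬ OccursAt π a .one true := fun ho => by
      have := (ho.unique hocc).1
      simp at this
    rcases h.mem_finalPositions hst hG hN hV hW with
      ((⟨hr, d, hp⟩ | ⟨q, hq, hl, ho, rfl⟩) | ⟨q, Γ, hq, hi, ho, rfl⟩) | ⟨p, hp, hs, ho, rfl⟩
    · obtain ⟨-, rfl⟩ := hp.unique hocc
      exact ⟨hr, hocc⟩
    · exact absurd (occursAt_letStar hl) not_one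
    · exact absurd (h.guard_of_stuck hst hG hq hi hV) hW
    · exact absurd (occursAt_star hs) not_one
  · rintro ⟨rfl, hocc⟩
    refine ⟨(h.off G hG a).2 ⟨?_, hS.pos a rfl ⟨_, hocc⟩⟩, _, hocc⟩
    exact h.covers hst hG hN a ⟨_, _, hocc⟩ List.prefix_rfl (opened_self G)

/-- Configurations without transitions are final. -/
theorem Config.Inv.final (h : c.Inv π r V W) (hst : ¬ ∃ c', Step π r c c') {N : Node}
    (hN : π.sub r = some N) : c.Final π r := by
  refine ⟨⟨h.addr, ?_⟩, fun G hG => ⟨h.positions_eq hst hG hN, h.env_eq hst hG hN⟩⟩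
  have ht := h.typed ∅ ⟨by simp [Env.WF], by simp [Env.labels]⟩
  simp only [Set.union_empty] at ht
  refine ht.congr fun G hG => ?_
  ext ⟨a, B⟩
  exact and_congr_left' (h.off G hG a)

end

end QCSIAM

theorem mainTheorem2 {Δ : QCSIAM.Ctx} {M : QCSIAM.Tm} {A : QCSIAM.Ty} (π : QCSIAM.Der Δ M A) :
    (¬ ∃ f : ℕ → QCSIAM.Config, f 0 = QCSIAM.initial π [] ∧
      ∀ n, QCSIAM.Step π [] (f n) (f (n + 1))) ∧
    (∀ c : QCSIAM.Config, QCSIAM.Run π [] (QCSIAM.initial π []) c →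
      (¬ ∃ c' : QCSIAM.Config, QCSIAM.Step π [] c c') → c.Final π []) := by
  have hi := QCSIAM.inv_initial (π := π) []
  constructor
  · obtain ⟨V, W, h⟩ := hi
    exact QCSIAM.not_exists_infinite_run h
  · intro c hc hst
    obtain ⟨V, W, h⟩ := hc.inv hi
    exact h.final hst (N := ⟨Δ, M, A, π⟩) rfl
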